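/- Let $m$ indivisible items be allocated to $n$ agents. Agent $i$ has a private valuation function $v_i$ assigning a non-negative real value to every set of items. A valuation is *unit demand* if $v(S)=\max_{e\in S}v(\{e\})$ (with $v(\emptyset)=0$), and *additive* if $v(S)=\sum_{e\in S}v(\{e\})$. An additive valuation is *binary* if every single item has value $0$ or $1$; an instance is *2-valued additive* if all valuations are additive and there are $a>b\ge 0$, the same for all agents, such that every single item has value $a$ or $b$ for every agent. The maximin share (MMS) of an agent with valuation $v$ is $\max_{(S_1,\dots,S_n)}\min_i v(S_i)$ over all partitions of the items into $n$ (possibly empty) sets, and an allocation $(A_1,\dots,A_n)$ is an *MMS allocation* if $v_i(A_i)$ is at least the MMS of agent $i$, for every $i$. A deterministic protocol adaptively asks agents arbitrary yes/no questions about their own valuations and ends with an allocation; its cost on an instance is the number of bits sent by the agents. A randomized protocol selects a deterministic protocol by a common random string; it must output an MMS allocation for every instance of the class under consideration and for every value of the random string. For a class of instances with $n$ agents and $m$ items, the *average randomized communication complexity* $ARCC$ of MMS allocations is $\frac1n$ times the infimum, over all such randomized protocols, of the maximum (supremum), over the instances in the class, of the expected cost. **Theorem.** There are absolute constants $c,C>0$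 such that the following holds for all $n\ge 1$ and $m\ge 2n$, where the lower bounds are asserted only for $n\ge 2$. 1. For unit demand valuations, $c\le ARCC\le C$; the lower bound holds even for the class of instances in which all agents have the same unit demand valuation. 2. For binary additive valuations, $c\log_2\frac mn\le ARCC\le C\log_2\frac mn$; the lower bound holds even for the class of instances in which all agents have the same binary additive valuation. 3. For 2-valued additive valuations, $ARCC\ge c\,\frac mn$; this holds even for the class of instances in which all agents have the same 2-valued additive valuation, and even if the two values $a>b$ are fixed in advance (and may be used by the protocol), for every choice of $a,b$ with $0<b\le \frac am$. -/

import Mathlib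

open MeasureTheory
open scoped NNReal ENNReal

noncomputable section

namespace FairAllocation

/-- A valuation function on `m` indivisible items: every set of items has a non-negative value. -/
abbrev Valuation (m : ℕ) : Type := Finset (Fin m) → ℝ≥0

/-- An allocation instance with `n` agents and `m` items: the valuation function of each agent. -/
abbrev Instance (n m : ℕ) : Type := Fin n → Valuation m

/-- An allocation of `m` items to `n` agents, i.e. an ordered partition of the items into `n`
disjoint (possibly empty) bundles, given by the agent that receives each item. -/
abbrev Allocation (n m : ℕ) : Type := Fin m → Fin n

/-- The bundle that agent `i` receives. -/
def bundle {n m : ℕ} (A : Allocation n m) (i : Fin n) : Finset (Fin m) :=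
  Finset.univ.filter fun e => A e = i

/-- Unit demand valuations: the value of a set is the largest value of an item in it
(the empty set has value `0`). -/
def IsUnitDemand {m : ℕ} (v : Valuation m) : Prop :=
  ∀ S : Finset (Fin m), v S = S.sup fun e => v {e}

/-- Additive valuations. -/
def IsAdditive {m : ℕ} (v : Valuation m) : Prop :=
  ∀ S : Finset (Fin m), v S = ∑ e ∈ S, v {e}

/-- Additive valuations in which every single item has value `a` or `b`. -/
def IsTwoValuedWith {m : ℕ} (a b : ℝ≥0) (v : Valuation m) : Prop :=
  IsAdditive v ∧ ∀ e : Fin m, v {e} = a ∨ v {e} = b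

/-- Binary (additive) valuations: every single item has value `0` or `1`. -/
def IsBinary {m : ℕ} (v : Valuation m) : Prop :=
  IsAdditive v ∧ ∀ e : Fin m, v {e} = 0 ∨ v {e} = 1

/-- The maximin share among `n` agents: the value of the least valuable bundle in the best
partition of the items into `n` bundles. -/
def mms (n : ℕ) {m : ℕ} (v : Valuation m) : ℝ≥0 :=
  ⨆ P : Allocation n m, ⨅ i : Fin n, v (bundle P i)

/-- An MMS allocation gives every agent at least her maximin share. -/
def IsMMSAllocation {n m : ℕ} (v : Instance n m) (A : Allocation n m) : Prop :=
  ∀ i : Fin n, mms n (v i) ≤ v i (bundle A i)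

/-- The instances in which all agents have unit demand valuations. -/
def unitDemandInstances (n m : ℕ) : Set (Instance n m) := {v | ∀ i, IsUnitDemand (v i)}

/-- The instances in which all agents have binary additive valuations. -/
def binaryInstances (n m : ℕ) : Set (Instance n m) := {v | ∀ i, IsBinary (v i)}

/-- The instances in which all agents have 2-valued additive valuations, for two prespecified
values `a` and `b`. -/
def twoValuedInstancesWith (a b : ℝ≥0) (n m : ℕ) : Set (Instance n m) :=
  {v | ∀ i, IsTwoValuedWith a b (v i)}

/-- The instances in which all agents have 2-valued additive valuations, with the same two values
`a > b ≥ 0` for all agents. -/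
def twoValuedInstances (n m : ℕ) : Set (Instance n m) :=
  {v | ∃ a b : ℝ≥0, b < a ∧ v ∈ twoValuedInstancesWith a b n m}

/-- The instances in which all agents have the same valuation function. -/
def identicalInstances (n m : ℕ) : Set (Instance n m) := {v | ∀ i j, v i = v j}

/-- Deterministic protocols. A protocol either ends with an allocation, or asks some agent `i` an
arbitrary question `q` about her own valuation function that is answered by one bit, and continues
depending on the answer. (A question answered by several bits is asked bit by bit.) -/
inductive Protocol (n m : ℕ) : Type where
  | done (A : Allocation n m) : Protocol n m
  | ask (i : Fin n) (q : Valuation m → Bool) (next : Bool → Protocol n m) : Protocol n m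

namespace Protocol

/-- The allocation at which the protocol arrives on a given instance. -/
def outcome {n m : ℕ} : Protocol n m → Instance n m → Allocation n m
  | .done A, _ => A
  | .ask i q next, v => (next (q (v i))).outcome v

/-- The length of the transcript: the number of bits that the agents transmit on an instance. -/
def cost {n m : ℕ} : Protocol n m → Instance n m → ℕ
  | .done _, _ => 0
  | .ask i q next, v => (next (q (v i))).cost v + 1

end Protocol

/-- Randomized protocols: the common random string, drawn from an arbitrary probability space,
selects the deterministic protocol that is run. -/
structure RandomizedProtocol (n m : ℕ) where
  /-- the contents of the common random string -/
  Ω : Type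
  /-- the events -/
  [mΩ : MeasurableSpace Ω]
  /-- the distribution of the common random string -/
  μ : Measure Ω
  [prob : IsProbabilityMeasure μ]
  /-- the deterministic protocol selected by the common random string -/
  protocol : Ω → Protocol n m
  measurable_cost : ∀ v : Instance n m, Measurable fun ω => (protocol ω).cost v

attribute [instance] RandomizedProtocol.mΩ RandomizedProtocol.prob

/-- A randomized protocol computes MMS allocations for a class `C` of instances if it always
outputs an MMS allocation, for every instance in `C`. -/
def RandomizedProtocol.ComputesMMS {n m : ℕ} (P : RandomizedProtocol n m)
    (C : Set (Instance n m)) : Prop :=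
  ∀ v ∈ C, ∀ ω, IsMMSAllocation v ((P.protocol ω).outcome v)

/-- The expected number of transmitted bits on an instance. -/
def RandomizedProtocol.expectedCost {n m : ℕ} (P : RandomizedProtocol n m)
    (v : Instance n m) : ℝ≥0∞ :=
  ∫⁻ ω, ((P.protocol ω).cost v : ℝ≥0∞) ∂P.μ

/-- The randomized communication complexity of MMS allocations for a class `C` of instances: the
best worst-case expected number of bits. -/
def rcc {n m : ℕ} (C : Set (Instance n m)) : ℝ≥0∞ :=
  ⨅ (P : RandomizedProtocol n m) (_ : P.ComputesMMS C), ⨆ v ∈ C, P.expectedCost v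

/-- The average randomized communication complexity: the complexity divided by the number of
agents. -/
def arcc {n m : ℕ} (C : Set (Instance n m)) : ℝ≥0∞ := rcc C / (n : ℝ≥0∞)

end FairAllocation

end

noncomputable section

/-! Lower bounds. For a fixed random string, a protocol is a binary tree with allocations at its
leaves. If every allocation is correct for at most `κ` instances of a finite family `S`, then the
average cost over `S` is at least `log₂(|S| / κ)` (`Protocol.card_mul_log_le`, `le_rcc`). For unit
demand and binary valuations, all agents like the same hidden `kn` of `2kn` items. Each agent must
get exactly `k` of them, so an allocation is correct for at most `C(2k,k)ⁿ` of the `C(2kn,kn)`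
hidden sets; the logarithm of the ratio is at least `n/4 · log((9k+3)/8)` (`le_rcc_of_even_split`).
For two values, `kn - 1` hidden items are valuable. Some agent gets fewer than `k` of them and has
to be compensated by all cheap items, so a correct allocation nearly reveals the hidden set
(`twoValued_lower`).

Unit demand, upper bound. Every agent fixes `n` items that are worth her share. A public coin throws
all items into `n` buckets, and the agents are inserted one at a time: a newcomer takes a free
bucket that contains one of her items, or splits the part of an earlier agent that contains two of
them. If few of her items collide, Cauchy-Schwarz leaves her of the order of `(n-j)²/n` possible
parts when `j` agents are present, and with public randomness she names one by `O(1 + log(n/(n-j)))`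
expected bits (`RTree.exists_name`). These costs add up to `O(n)`.

Binary valuations, upper bound. A share is the number of liked items divided by `n`, rounded down.
The Even-Paz halving procedure with quickselect distributes shares for `O(log m)` bits per agent
(`exists_evenPaz`), which is too much if `m/n` is small compared to `n`. In that case a round serves
a constant fraction of the `u` remaining agents for `O(1 + log(m/u))` bits per agent
(`exists_averaged_round`). Short random sequences of items are cut into windows: two random agents
race for seeing a share in the window, and the first one hosts it. In expectation a window costs
nobody more than about one share; the obstacle are the fluctuations. There is a dichotomy
(`expect_card_deprived_le`). If the racers often finish at different times, the windows are shorter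
than average and almost everybody keeps a surplus. Otherwise almost all agents finish at the same
places, that is, they like the last items of most windows. Then an agent who lacks items takes over
a window after its last item is removed, and such removals soon help all other agents too
(`exists_kicks`). Rounds are iterated until the Even-Paz cost of the remaining agents is absorbed by
the potential `x (log₂(m/x) + 10)` (`exists_rounds`). -/

namespace FairAllocation

/-! ### Query trees with public coins and randomized protocols. -/

/-- Query trees with public coins: an agent answers a question about her private information by
one bit, or a uniformly distributed public coin is tossed. -/
inductive RTree (X : Type) (n : ℕ) (α : Type) : Type where
  | ret (a : α) : RTree X n α
  | ask (i : Fin n) (q : X → Bool) (next : Bool → RTree X n α) : RTree X n α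
  | coin (N : ℕ) (next : Fin (N + 1) → RTree X n α) : RTree X n α

namespace RTree

variable {X Y : Type} {n : ℕ} {α β : Type}

/-- The expected number of answered questions plus the expected value of `f` at the result. -/
def ecost : RTree X n α → (Fin n → X) → (α → ℝ≥0∞) → ℝ≥0∞
  | .ret a, _, f => f a
  | .ask i q next, v, f => ecost (next (q (v i))) v f + 1
  | .coin N next, v, f => (∑ c, ecost (next c) v f) / ((N + 1 : ℕ) : ℝ≥0∞)

/-- Sequential composition. -/
def bind : RTree X n α → (α → RTree X n β) → RTree X n β
  | .ret a, g => g a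
  | .ask i q next, g => .ask i q fun b => (next b).bind g
  | .coin N next, g => .coin N fun c => (next c).bind g

theorem ecost_bind (t : RTree X n α) (g : α → RTree X n β) (v : Fin n → X) (f : β → ℝ≥0∞) :
    (t.bind g).ecost v f = t.ecost v fun a => (g a).ecost v f := by
  induction t with
  | ret a => rfl
  | ask i q next ih => simp only [bind, ecost, ih]
  | coin N next ih => simp only [bind, ecost, ih]

/-- All results of `t` on `v` satisfy `Q`, and the expected number of answers is at most `c`. -/
def Spec (t : RTree X n α) (v : Fin n → X) (Q : α → Prop) (c : ℝ≥0∞) : Prop :=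
  ∀ (f : α → ℝ≥0∞) (C : ℝ≥0∞), (∀ a, Q a → f a ≤ C) → t.ecost v f ≤ c + C

theorem Spec.mono {t : RTree X n α} {v : Fin n → X} {Q Q' : α → Prop} {c c' : ℝ≥0∞}
    (h : t.Spec v Q c) (hQ : ∀ a, Q a → Q' a) (hc : c ≤ c') : t.Spec v Q' c' := fun f C hf =>
  (h f C fun a ha => hf a (hQ a ha)).trans (add_le_add_left hc _)

theorem spec_ret {a : α} {v : Fin n → X} {Q : α → Prop} (h : Q a) {c : ℝ≥0∞} :
    (RTree.ret a : RTree X n α).Spec v Q c := fun _ _ hf => (hf a h).trans le_add_self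

theorem Spec.ask {i : Fin n} {q : X → Bool} {next : Bool → RTree X n α} {v : Fin n → X}
    {Q : α → Prop} {c : ℝ≥0∞} (h : (next (q (v i))).Spec v Q c) :
    (RTree.ask i q next).Spec v Q (c + 1) := fun f C hf => by
  have := h f C hf
  calc (RTree.ask i q next).ecost v f = (next (q (v i))).ecost v f + 1 := rfl
    _ ≤ c + C + 1 := by gcongr
    _ = c + 1 + C := by ring

/-- The remaining cost of `g a` is used as the function `f` for `t`. Quantifying over all `f` in
`Spec` couples correctness with expected cost, so that both compose in a single step. -/
theorem Spec.bind {t : RTree X n α} {g : α → RTree X n β} {v : Fin n → X} {Q : α → Prop}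
    {Q' : β → Prop} {c c' : ℝ≥0∞} (h : t.Spec v Q c) (h' : ∀ a, Q a → (g a).Spec v Q' c') :
    (t.bind g).Spec v Q' (c + c') := fun f C hf => by
  rw [ecost_bind, add_assoc]
  exact h _ _ fun a ha => h' a ha f C hf

/-- A uniformly distributed public coin with values in an arbitrary finite type. -/
def coinOver {ι : Type} [Fintype ι] [Nonempty ι] (next : ι → RTree X n α) : RTree X n α :=
  .coin (Fintype.card ι - 1) fun c => next ((Fintype.equivFin ι).symm
    (Fin.cast (Nat.sub_add_cancel Fintype.card_pos) c))

theorem ecost_coinOver {ι : Type} [Fintype ι] [Nonempty ι] (next : ι → RTree X n α)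
    (v : Fin n → X) (f : α → ℝ≥0∞) :
    (coinOver next).ecost v f = (∑ x, (next x).ecost v f) / (Fintype.card ι : ℝ≥0∞) := by
  have h : Fintype.card ι - 1 + 1 = Fintype.card ι := Nat.sub_add_cancel Fintype.card_pos
  have h' : ((Fintype.card ι - 1 + 1 : ℕ) : ℝ≥0∞) = (Fintype.card ι : ℝ≥0∞) := by rw [h]
  change (∑ c, _) / ((Fintype.card ι - 1 + 1 : ℕ) : ℝ≥0∞) = _
  rw [h']
  congr 1
  refine Fintype.sum_equiv ((finCongr h).trans (Fintype.equivFin ι).symm) _ _ fun c => rfl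

theorem Spec.coinOver {ι : Type} [Fintype ι] [Nonempty ι] {next : ι → RTree X n α}
    {v : Fin n → X} {Q : α → Prop} {c : ι → ℝ≥0∞} (h : ∀ x, (next x).Spec v Q (c x)) :
    (coinOver next).Spec v Q ((∑ x, c x) / (Fintype.card ι : ℝ≥0∞)) := fun f C hf => by
  rw [ecost_coinOver]
  have h0 : (Fintype.card ι : ℝ≥0∞) ≠ 0 := by simp
  have h1 : (Fintype.card ι : ℝ≥0∞) ≠ ⊤ := by simp
  have : ∑ x, (next x).ecost v f ≤ ∑ x, (c x + C) := Finset.sum_le_sum fun x _ => h x f C hf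
  refine (ENNReal.div_le_div_right this _).trans ?_
  rw [Finset.sum_add_distrib, ENNReal.add_div]
  gcongr
  rw [Finset.sum_const, Finset.card_univ, nsmul_eq_mul, mul_comm, mul_div_assoc,
    ENNReal.div_self h0 h1, mul_one]

theorem Spec.coinOver_ofReal {ι : Type} [Fintype ι] [Nonempty ι] {next : ι → RTree X n α}
    {v : Fin n → X} {Q : α → Prop} {c : ι → ℝ} (hc : ∀ x, 0 ≤ c x)
    (h : ∀ x, (next x).Spec v Q (ENNReal.ofReal (c x))) :
    (RTree.coinOver next).Spec v Q (ENNReal.ofReal (Finset.expect Finset.univ c)) := by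
  refine (Spec.coinOver h).mono (fun _ h => h) (le_of_eq ?_)
  rw [Fintype.expect_eq_sum_div_card, ENNReal.ofReal_div_of_pos (by exact_mod_cast Fintype.card_pos),
    ENNReal.ofReal_sum_of_nonneg fun x _ => hc x, ENNReal.ofReal_natCast]

/-- Changing the private information along a map. -/
def pullback (φ : Y → X) : RTree X n α → RTree Y n α
  | .ret a => .ret a
  | .ask i q next => .ask i (fun y => q (φ y)) fun b => (next b).pullback φ
  | .coin N next => .coin N fun c => (next c).pullback φ

theorem ecost_pullback (φ : Y → X) (t : RTree X n α) (v : Fin n → Y) (f : α → ℝ≥0∞) :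
    (t.pullback φ).ecost v f = t.ecost (fun i => φ (v i)) f := by
  induction t with
  | ret a => rfl
  | ask i q next ih => simp only [pullback, ecost, ih]
  | coin N next ih => simp only [pullback, ecost, ih]

/-- An agent announces a number below `2 ^ b` by `b` bits. -/
theorem exists_askNat (i : Fin n) : ∀ (b : ℕ) (ρ : X → ℕ), (∀ x, ρ x < 2 ^ b) →
    ∃ t : RTree X n ℕ, ∀ v, t.Spec v (fun a => a = ρ (v i)) b
  | 0, ρ, h => ⟨.ret 0, fun v => spec_ret (by have := h (v i); simp at this; omega)⟩
  | b + 1, ρ, h => by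
    obtain ⟨t, ht⟩ := exists_askNat i b (fun x => ρ x / 2) fun x => by
      have := h x; rw [pow_succ] at this; omega
    refine ⟨t.bind fun a => .ask i (fun x => decide (ρ x % 2 = 1))
      fun c => .ret (2 * a + if c then 1 else 0), fun v => ?_⟩
    have : ((b + 1 : ℕ) : ℝ≥0∞) = b + (0 + 1) := by push_cast; ring
    rw [this]
    refine (ht v).bind fun a ha => Spec.ask (spec_ret ?_)
    subst ha
    have := Nat.mod_two_eq_zero_or_one (ρ (v i))
    simp only [decide_eq_true_eq]
    split_ifs <;> omega

/-- Averages over a coordinate of a product. -/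
theorem sum_pi_eval {ι : Type} [Fintype ι] [DecidableEq ι] {Ω : ι → Type} [∀ c, Fintype (Ω c)]
    [∀ c, Nonempty (Ω c)] (c : ι) (g : Ω c → ℝ≥0∞) :
    (∑ ω : (∀ c, Ω c), g (ω c)) / (Fintype.card (∀ c, Ω c) : ℝ≥0∞) =
      (∑ x, g x) / (Fintype.card (Ω c) : ℝ≥0∞) := by
  have h1 : ∑ ω : (∀ c, Ω c), g (ω c) =
      ∑ p : Ω c × (∀ j : {j // j ≠ c}, Ω j), g p.1 :=
    Fintype.sum_equiv (Equiv.piSplitAt c Ω) _ _ fun ω => rfl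
  rw [h1, Fintype.card_congr (Equiv.piSplitAt c Ω), Fintype.sum_prod_type, Fintype.card_prod]
  simp only [Finset.sum_const, Finset.card_univ, nsmul_eq_mul]
  rw [← Finset.mul_sum, Nat.cast_mul, mul_comm (Fintype.card (Ω c) : ℝ≥0∞)]
  exact ENNReal.mul_div_mul_left _ _ (Nat.cast_ne_zero.2 Fintype.card_ne_zero)
    (ENNReal.natCast_ne_top _)

theorem avg_const {Ω : Type} [Fintype Ω] [Nonempty Ω] (a : ℝ≥0∞) :
    (∑ _ω : Ω, a) / (Fintype.card Ω : ℝ≥0∞) = a := by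
  rw [Finset.sum_const, Finset.card_univ, nsmul_eq_mul, mul_comm, mul_div_assoc,
    ENNReal.div_self (by simp) (by simp), mul_one]

/-- A tree with coins is a uniformly distributed deterministic protocol. -/
theorem exists_protocols {m : ℕ} (t : RTree (Valuation m) n (Allocation n m)) :
    ∃ (Ω : Type) (_ : Fintype Ω) (_ : Nonempty Ω) (p : Ω → Protocol n m), ∀ v f,
      (∑ ω, (((p ω).cost v : ℝ≥0∞) + f ((p ω).outcome v))) / (Fintype.card Ω : ℝ≥0∞)
        = t.ecost v f := by
  induction t with
  | ret a =>
    refine ⟨Unit, inferInstance, inferInstance, fun _ => .done a, fun v f => ?_⟩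
    simp [ecost, Protocol.cost, Protocol.outcome]
  | ask i q next ih =>
    choose Ω h1 h2 p hp using ih
    -- All coins are tossed in advance, independently for the two answers. Only the coordinate of
    -- the actual answer matters, and `sum_pi_eval` averages out the other one.
    refine ⟨∀ b, Ω b, inferInstance, inferInstance, fun ω => .ask i q fun b => p b (ω b),
      fun v f => ?_⟩
    simp only [ecost, Protocol.cost, Protocol.outcome]
    rw [← hp]
    have := sum_pi_eval (Ω := Ω) (q (v i)) fun x =>
      (((p (q (v i)) x).cost v : ℝ≥0∞) + f ((p (q (v i)) x).outcome v))
    rw [← this, ← avg_const (Ω := ∀ b, Ω b) 1, ← ENNReal.add_div, ← Finset.sum_add_distrib]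
    congr 1
    refine Finset.sum_congr rfl fun ω _ => ?_
    push_cast
    ring
  | coin N next ih =>
    choose Ω h1 h2 p hp using ih
    refine ⟨Fin (N + 1) × ∀ c, Ω c, inferInstance, inferInstance, fun ω => p ω.1 (ω.2 ω.1),
      fun v f => ?_⟩
    rw [Fintype.sum_prod_type, Fintype.card_prod]
    simp only [ecost, ← hp, Fintype.card_fin]
    simp_rw [← sum_pi_eval (Ω := Ω) _ fun x => (((p _ x).cost v : ℝ≥0∞) + f ((p _ x).outcome v))]
    simp only [div_eq_mul_inv, ← Finset.sum_mul]
    rw [mul_assoc, Nat.cast_mul, ENNReal.mul_inv (by simp) (by simp),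
      mul_comm ((Fintype.card (∀ c, Ω c) : ℝ≥0∞)⁻¹)]

end RTree

/-- A query tree that always finds MMS allocations bounds the communication complexity. -/
theorem rcc_le {n m : ℕ} {X : Type} (enc : Valuation m → X) (C : Set (Instance n m))
    (t : RTree X n (Allocation n m)) (c : ℝ≥0∞) (hc : c ≠ ⊤)
    (h : ∀ v ∈ C, t.Spec (fun i => enc (v i)) (IsMMSAllocation v) c) : rcc C ≤ c := by
  classical
  obtain ⟨Ω, h1, h2, p, hp⟩ := (t.pullback enc).exists_protocols
  let μ : @Measure Ω ⊤ := @PMF.toMeasure Ω ⊤ (PMF.uniformOfFintype Ω)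
  let P : RandomizedProtocol n m :=
    { Ω := Ω
      mΩ := ⊤
      μ := μ
      prob := @PMF.toMeasure.isProbabilityMeasure Ω ⊤ _
      protocol := p
      measurable_cost := fun v => measurable_from_top }
  have hcomp : P.ComputesMMS C := by
    intro v hv ω
    by_contra hbad
    -- With an infinite penalty for wrong allocations, a single wrong outcome, which has positive
    -- probability, would make the expectation infinite.
    have h3 := h v hv (fun A => if IsMMSAllocation v A then 0 else ⊤) 0 (fun A hA => by simp [hA])
    rw [← RTree.ecost_pullback, ← hp] at h3
    have h4 : (∑ ω, (((p ω).cost v : ℝ≥0∞) +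
        if IsMMSAllocation v ((p ω).outcome v) then 0 else ⊤)) = ⊤ := by
      rw [ENNReal.sum_eq_top]
      refine ⟨ω, Finset.mem_univ _, ?_⟩
      have : ¬ IsMMSAllocation v ((p ω).outcome v) := hbad
      simp [this]
    rw [h4, ENNReal.top_div_of_ne_top (by simp), add_zero] at h3
    exact hc (top_le_iff.mp h3)
  refine (iInf₂_le P hcomp).trans (iSup₂_le fun v hv => ?_)
  have h3 := h v hv (fun _ => 0) 0 (fun _ _ => le_rfl)
  rw [← RTree.ecost_pullback, ← hp, add_zero] at h3
  refine le_trans (le_of_eq ?_) h3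
  show ∫⁻ ω, ((p ω).cost v : ℝ≥0∞) ∂μ = _
  let _ : MeasurableSpace Ω := ⊤
  rw [lintegral_fintype, div_eq_mul_inv, Finset.sum_mul]
  refine Finset.sum_congr rfl fun ω _ => ?_
  rw [add_zero]
  congr 1
  show (PMF.uniformOfFintype Ω).toMeasure {ω} = _
  rw [PMF.toMeasure_apply_singleton _ _ (MeasurableSet.singleton _), PMF.uniformOfFintype_apply]

/-! ### The counting lower bound. -/

theorem mul_log_split {s t κ : ℝ} (hs : 0 ≤ s) (ht : 0 ≤ t) (hκ : 0 < κ) :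
    (s + t) * Real.log ((s + t) / κ) ≤
      s * Real.log (s / κ) + t * Real.log (t / κ) + (s + t) * Real.log 2 := by
  -- This is `log y ≤ y - 1` for `y = (s + t) / (2x)`. The right hand sides for `x = s` and `x = t`
  -- cancel, so one answer gains at most one bit of information.
  have key : ∀ x : ℝ, 0 ≤ x → x ≤ s + t →
      x * (Real.log ((s + t) / κ) - Real.log (x / κ) - Real.log 2) ≤ (s + t) / 2 - x := by
    intro x hx hxs
    rcases hx.eq_or_lt with rfl | hx
    · simp; linarith
    · have hst : 0 < s + t := hx.trans_le hxs
      have h1 : Real.log ((s + t) / κ) - Real.log (x / κ) - Real.log 2 =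
          Real.log ((s + t) / (2 * x)) := by
        rw [Real.log_div hst.ne' hκ.ne', Real.log_div hx.ne' hκ.ne',
          Real.log_div hst.ne' (by positivity), Real.log_mul two_ne_zero hx.ne']
        ring
      rw [h1]
      have h2 := Real.log_le_sub_one_of_pos (x := (s + t) / (2 * x)) (by positivity)
      calc _ ≤ x * ((s + t) / (2 * x) - 1) := by gcongr
        _ = _ := by field_simp
  have h1 := key s hs (by linarith)
  have h2 := key t ht (by linarith)
  nlinarith

/-- If every allocation is right for few instances, many bits are needed on average. -/
theorem Protocol.card_mul_log_le {n m : ℕ} {ι : Type} (p : Protocol n m) (w : ι → Instance n m)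
    (good : ι → Allocation n m → Prop) {κ : ℝ} (hκ : 0 < κ) (S : Finset ι)
    (hgood : ∀ T ∈ S, good T (p.outcome (w T)))
    (hcard : ∀ (A : Allocation n m) (S' : Finset ι), S' ⊆ S → (∀ T ∈ S', good T A) →
      (S'.card : ℝ) ≤ κ) :
    (S.card : ℝ) * Real.log (S.card / κ) ≤ (∑ T ∈ S, ((p.cost (w T) : ℕ) : ℝ)) * Real.log 2 := by
  classical
  induction p generalizing S with
  | done A =>
    -- At a leaf one allocation serves all of `S`, so `S` has at most `κ` elements and the left hand
    -- side is not positive.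
    have h1 := hcard A S le_rfl fun T hT => hgood T hT
    have h2 : Real.log (S.card / κ) ≤ 0 :=
      Real.log_nonpos (by positivity) ((div_le_one hκ).2 h1)
    simp only [cost, Nat.cast_zero, Finset.sum_const_zero, zero_mul]
    exact mul_nonpos_of_nonneg_of_nonpos (by positivity) h2
  | ask i q next ih =>
    have hS : ∀ b, (∀ T ∈ S.filter (fun T => q (w T i) = b), good T ((next b).outcome (w T))) := by
      intro b T hT
      obtain ⟨h1, h2⟩ := Finset.mem_filter.1 hT
      have := hgood T h1
      simp only [outcome, h2] at this
      exact this
    have h0 := ih true (S.filter fun T => q (w T i) = true) (hS true)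
      fun A S' h => hcard A S' (h.trans (Finset.filter_subset _ _))
    have h1 := ih false (S.filter fun T => q (w T i) = false) (hS false)
      fun A S' h => hcard A S' (h.trans (Finset.filter_subset _ _))
    have hf : S.filter (fun T => q (w T i) = false) = S.filter (fun T => ¬ q (w T i) = true) := by
      simp
    rw [hf] at h1
    have hc := Finset.card_filter_add_card_filter_not (s := S) (fun T => q (w T i) = true)
    have hsum := Finset.sum_filter_add_sum_filter_not S (fun T => q (w T i) = true)
      (fun T => (((ask i q next).cost (w T) : ℕ) : ℝ))
    have e0 : ∑ T ∈ S with q (w T i) = true, (((ask i q next).cost (w T) : ℕ) : ℝ) =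
        ∑ T ∈ S with q (w T i) = true, (((next true).cost (w T) : ℕ) : ℝ) +
          (S.filter fun T => q (w T i) = true).card := by
      rw [Finset.card_eq_sum_ones, Nat.cast_sum, ← Finset.sum_add_distrib]
      refine Finset.sum_congr rfl fun T hT => ?_
      simp [cost, (Finset.mem_filter.1 hT).2]
    have e1 : ∑ T ∈ S with ¬ q (w T i) = true, (((ask i q next).cost (w T) : ℕ) : ℝ) =
        ∑ T ∈ S with ¬ q (w T i) = true, (((next false).cost (w T) : ℕ) : ℝ) +
          (S.filter fun T => ¬ q (w T i) = true).card := by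
      rw [Finset.card_eq_sum_ones, Nat.cast_sum, ← Finset.sum_add_distrib]
      refine Finset.sum_congr rfl fun T hT => ?_
      have := (Finset.mem_filter.1 hT).2
      simp only [Bool.not_eq_true] at this
      simp [cost, this]
    -- The question adds one bit for every element of `S`, which pays for the term `(s + t) log 2`
    -- lost by splitting `S`.
    have := mul_log_split (s := (S.filter fun T => q (w T i) = true).card)
      (t := (S.filter fun T => ¬ q (w T i) = true).card) (by positivity) (by positivity) hκ
    have hc' : ((S.filter fun T => q (w T i) = true).card : ℝ) +
      (S.filter fun T => ¬ q (w T i) = true).card = S.card := by exact_mod_cast hc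
    rw [hc'] at this
    rw [← hsum, e0, e1]
    nlinarith [Real.log_pos one_lt_two]

/-- The averaging lower bound for randomized protocols. -/
theorem le_rcc {n m : ℕ} {ι : Type} (C : Set (Instance n m)) (w : ι → Instance n m)
    {κ : ℝ} (hκ : 0 < κ) (S : Finset ι) (hS : S.Nonempty) (hw : ∀ T ∈ S, w T ∈ C)
    (hcard : ∀ (A : Allocation n m) (S' : Finset ι), S' ⊆ S →
      (∀ T ∈ S', IsMMSAllocation (w T) A) → (S'.card : ℝ) ≤ κ) :
    ENNReal.ofReal (Real.log (S.card / κ) / Real.log 2) ≤ rcc C := by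
  refine le_iInf₂ fun P hP => ?_
  set x := Real.log (S.card / κ) / Real.log 2
  have hS0 : (S.card : ℝ≥0∞) ≠ 0 := by simpa using hS.ne_empty
  have hS1 : (S.card : ℝ≥0∞) ≠ ⊤ := by simp
  have h1 : (S.card : ℝ≥0∞) * ENNReal.ofReal x ≤ ∑ T ∈ S, P.expectedCost (w T) := by
    have hm : ∀ T ∈ S, Measurable fun ω => (((P.protocol ω).cost (w T) : ℕ) : ℝ≥0∞) := by
      intro T _
      exact (measurable_from_top (f := fun k : ℕ => (k : ℝ≥0∞))).comp (P.measurable_cost (w T))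
    unfold RandomizedProtocol.expectedCost
    rw [← lintegral_finsetSum S hm]
    -- The counting bound holds for every random string, hence in expectation; the worst instance
    -- costs at least the average over `S`.
    have h2 : ∀ ω, (S.card : ℝ≥0∞) * ENNReal.ofReal x ≤
        ∑ T ∈ S, (((P.protocol ω).cost (w T) : ℕ) : ℝ≥0∞) := by
      intro ω
      have h3 := (P.protocol ω).card_mul_log_le w (fun T => IsMMSAllocation (w T)) hκ S
        (fun T hT => hP _ (hw T hT) ω) hcard
      have h4 : (S.card : ℝ) * x ≤ ((∑ T ∈ S, (P.protocol ω).cost (w T) : ℕ) : ℝ) := by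
        push_cast
        have := Real.log_pos one_lt_two
        rw [mul_div_assoc', div_le_iff₀ this]
        exact h3
      rw [← Nat.cast_sum, ← ENNReal.ofReal_natCast, ← ENNReal.ofReal_mul (by positivity),
        ← ENNReal.ofReal_natCast (∑ T ∈ S, _)]
      exact ENNReal.ofReal_le_ofReal h4
    calc (S.card : ℝ≥0∞) * ENNReal.ofReal x
        = ∫⁻ _ω, (S.card : ℝ≥0∞) * ENNReal.ofReal x ∂P.μ := by simp
      _ ≤ _ := lintegral_mono h2
  have h2 : ∑ T ∈ S, P.expectedCost (w T) ≤ (S.card : ℝ≥0∞) * ⨆ v ∈ C, P.expectedCost v := by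
    rw [← nsmul_eq_mul]
    refine Finset.sum_le_card_nsmul _ _ _ fun T hT => ?_
    exact le_iSup₂ (f := fun v (_ : v ∈ C) => P.expectedCost v) (w T) (hw T hT)
  exact (ENNReal.mul_le_mul_iff_right hS0 hS1).1 (h1.trans h2)

theorem rcc_anti {n m : ℕ} {C C' : Set (Instance n m)} (h : C ⊆ C') : rcc C ≤ rcc C' := by
  refine le_iInf₂ fun P hP => ?_
  refine (iInf₂_le P fun v hv ω => hP v (h hv) ω).trans ?_
  exact iSup₂_le fun v hv => le_iSup₂ (f := fun v (_ : v ∈ C') => P.expectedCost v) v (h hv)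

theorem arcc_anti {n m : ℕ} {C C' : Set (Instance n m)} (h : C ⊆ C') : arcc C ≤ arcc C' :=
  ENNReal.div_le_div_right (rcc_anti h) _

theorem le_arcc {n m : ℕ} (hn : 0 < n) {C : Set (Instance n m)} {x y : ℝ} (hxy : n * x ≤ y)
    (h : ENNReal.ofReal y ≤ rcc C) : ENNReal.ofReal x ≤ arcc C := by
  unfold arcc
  rw [ENNReal.le_div_iff_mul_le (by simp [hn.ne']) (by simp), ← ENNReal.ofReal_natCast,
    ← ENNReal.ofReal_mul' (by positivity)]
  exact (ENNReal.ofReal_le_ofReal (by linarith)).trans h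

/-! ### Hidden sets that must be split evenly. -/

/-- A set of items can be distributed with prescribed numbers of items. -/
theorem exists_allocation_card {n m : ℕ} (T : Finset (Fin m)) (c : Fin n → ℕ)
    (hc : ∑ i, c i = T.card) (i₀ : Fin n) :
    ∃ P : Allocation n m, (∀ i, (T.filter fun e => P e = i).card = c i) ∧ ∀ e ∉ T, P e = i₀ := by
  classical
  have e : T ≃ Σ i, Fin (c i) := Fintype.equivOfCardEq (by simp [hc])
  refine ⟨fun x => if h : x ∈ T then (e ⟨x, h⟩).1 else i₀, fun i => ?_, fun x hx => by simp [hx]⟩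
  have h1 : (Finset.univ : Finset (Fin (c i))).card = c i := by simp
  rw [← h1]
  symm
  refine Finset.card_bij (fun y _ => ((e.symm ⟨i, y⟩ : T) : Fin m)) ?_ ?_ ?_
  · intro y _
    simp
  · intro y _ y' _ h
    have := e.symm.injective (Subtype.ext h)
    simpa using this
  · intro x hx'
    obtain ⟨hx, h⟩ := Finset.mem_filter.1 hx'
    simp only [dif_pos hx] at h
    clear hx'
    subst h
    exact ⟨(e ⟨x, hx⟩).2, Finset.mem_univ _, by simp⟩

theorem le_mms {n m : ℕ} [Nonempty (Fin n)] {v : Valuation m} {x : ℝ≥0} (P : Allocation n m)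
    (h : ∀ i, x ≤ v (bundle P i)) : x ≤ mms n v :=
  (le_ciInf h).trans (le_ciSup (f := fun P : Allocation n m => ⨅ i, v (bundle P i))
    (Set.finite_range _).bddAbove P)

/-- The first items. -/
def firstItems (m N : ℕ) : Finset (Fin m) := Finset.univ.filter fun e => e.1 < N

theorem card_firstItems {m N : ℕ} (h : N ≤ m) : (firstItems m N).card = N := by
  have : firstItems m N = Finset.univ.map (Fin.castLEEmb h) := by
    ext e
    simp only [firstItems, Finset.mem_filter, Finset.mem_univ, true_and, Finset.mem_map]
    exact ⟨fun h' => ⟨⟨e.1, h'⟩, rfl⟩, by rintro ⟨x, rfl⟩; exact x.2⟩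
  rw [this]; simp

theorem sum_card_inter_bundle {n m : ℕ} (A : Allocation n m) (T : Finset (Fin m)) :
    ∑ i, (T ∩ bundle A i).card = T.card := by
  classical
  rw [Finset.card_eq_sum_card_fiberwise (f := A) (t := Finset.univ) (fun _ _ => Finset.mem_univ _)]
  refine Finset.sum_congr rfl fun i _ => ?_
  congr 1
  ext e
  simp [bundle]

/-- The quotient `C(a,k) / 2^a` changes by the factor `(a+1) / (2(a+1-k))` from `a` to `a+1`, so it
is largest at `a = 2k`. The two inductions walk away from `2k` in both directions. Applied to every
bundle, this shows that equal bundles are the best case for an allocation. -/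
theorem choose_mul_four_pow_le (k : ℕ) (a : ℕ) : a.choose k * 4 ^ k ≤ k.centralBinom * 2 ^ a := by
  have hup : ∀ j, (2 * k + j).choose k ≤ k.centralBinom * 2 ^ j := by
    intro j
    induction j with
    | zero => simp [Nat.centralBinom]
    | succ j ih =>
      have h1 : (2 * k + j + 1).choose k * (2 * k + j + 1 - k) =
          (2 * k + j).choose k * (2 * k + j + 1) := by
        rw [← Nat.choose_mul_succ_eq]
      have h2 : 2 * k + j + 1 - k = k + j + 1 := by omega
      rw [h2] at h1
      have h3 : (2 * k + j + 1).choose k * (k + j + 1) ≤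
          (k.centralBinom * 2 ^ (j + 1)) * (k + j + 1) := by
        rw [h1, pow_succ]
        calc _ ≤ k.centralBinom * 2 ^ j * (2 * k + j + 1) := Nat.mul_le_mul_right _ ih
          _ ≤ k.centralBinom * 2 ^ j * (2 * (k + j + 1)) := Nat.mul_le_mul_left _ (by omega)
          _ = _ := by ring
      exact Nat.le_of_mul_le_mul_right h3 (by omega)
  have hdown : ∀ j, j ≤ k → (2 * k - j).choose k * 2 ^ j ≤ k.centralBinom := by
    intro j
    induction j with
    | zero => simp [Nat.centralBinom]
    | succ j ih =>
      intro hj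
      have ih := ih (by omega)
      have h1 : (2 * k - (j + 1) + 1).choose k * (2 * k - (j + 1) + 1 - k) =
          (2 * k - (j + 1)).choose k * (2 * k - (j + 1) + 1) := by
        rw [← Nat.choose_mul_succ_eq]
      have h2 : 2 * k - (j + 1) + 1 = 2 * k - j := by omega
      rw [h2] at h1
      have h3 : (2 * k - j - k) = k - j := by omega
      rw [h3] at h1
      have h4 : ((2 * k - (j + 1)).choose k * 2 ^ (j + 1)) * (2 * k - j) ≤
          k.centralBinom * (2 * k - j) := by
        calc _ = ((2 * k - (j + 1)).choose k * (2 * k - j)) * 2 ^ j * 2 := by rw [pow_succ]; ring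
          _ = ((2 * k - j).choose k * 2 ^ j) * (2 * (k - j)) := by rw [← h1]; ring
          _ ≤ k.centralBinom * (2 * (k - j)) := Nat.mul_le_mul_right _ ih
          _ ≤ _ := Nat.mul_le_mul_left _ (by omega)
      exact Nat.le_of_mul_le_mul_right h4 (by omega)
  rcases le_total (2 * k) a with h | h
  · obtain ⟨j, rfl⟩ := Nat.exists_eq_add_of_le h
    have := hup j
    calc _ ≤ k.centralBinom * 2 ^ j * 4 ^ k := Nat.mul_le_mul_right _ this
      _ = _ := by rw [pow_add, pow_mul]; norm_num; ring
  · rcases lt_or_ge a k with h' | h'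
    · rw [Nat.choose_eq_zero_of_lt h']; simp
    · obtain ⟨j, hj⟩ := Nat.exists_eq_add_of_le h
      have h5 := hdown j (by omega)
      have h6 : 2 * k - j = a := by omega
      rw [h6] at h5
      calc a.choose k * 4 ^ k = a.choose k * (2 ^ j * 2 ^ a) := by
            rw [← pow_add, show (4 : ℕ) = 2 ^ 2 by norm_num, ← pow_mul, hj, add_comm]
        _ = (a.choose k * 2 ^ j) * 2 ^ a := by ring
        _ ≤ _ := Nat.mul_le_mul_right _ h5

/-- This and `centralBinom_sq_le` are explicit forms of `C(2k,k) ~ 4^k / √(πk)`, squared to avoid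
roots: here with `4` in place of `π`, there with `3k + 1` in place of `πk`. Both follow from the
recursion of the central binomial coefficients. -/
theorem sixteen_pow_le (N : ℕ) : 16 ^ N ≤ 4 * N * N.centralBinom ^ 2 ∨ N = 0 := by
  induction N with
  | zero => right; rfl
  | succ N ih =>
    left
    rcases ih with ih | rfl
    · have h := Nat.succ_mul_centralBinom_succ N
      have h2 : (N + 1) ^ 2 * (N + 1).centralBinom ^ 2 =
          4 * (2 * N + 1) ^ 2 * N.centralBinom ^ 2 := by
        rw [← mul_pow, h]; ring
      have h3 : 16 ^ (N + 1) * (N + 1) ≤ 4 * (N + 1) * (N + 1).centralBinom ^ 2 * (N + 1) := by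
        calc 16 ^ (N + 1) * (N + 1) = 16 * (N + 1) * 16 ^ N := by ring
          _ ≤ 16 * (N + 1) * (4 * N * N.centralBinom ^ 2) := Nat.mul_le_mul_left _ ih
          _ ≤ 4 * (4 * (2 * N + 1) ^ 2 * N.centralBinom ^ 2) := by
            nlinarith [Nat.zero_le (N.centralBinom ^ 2)]
          _ = 4 * ((N + 1) ^ 2 * (N + 1).centralBinom ^ 2) := by rw [h2]
          _ = _ := by ring
      exact Nat.le_of_mul_le_mul_right h3 (by omega)
    · simp [Nat.centralBinom]

theorem centralBinom_sq_le (k : ℕ) : (3 * k + 1) * k.centralBinom ^ 2 ≤ 16 ^ k := by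
  induction k with
  | zero => simp
  | succ k ih =>
    have h := Nat.succ_mul_centralBinom_succ k
    have h2 : (k + 1) ^ 2 * (k + 1).centralBinom ^ 2 =
        4 * (2 * k + 1) ^ 2 * k.centralBinom ^ 2 := by
      rw [← mul_pow, h]; ring
    have h3 : (3 * (k + 1) + 1) * (k + 1).centralBinom ^ 2 * (k + 1) ^ 2 ≤
        16 ^ (k + 1) * (k + 1) ^ 2 := by
      calc _ = (3 * k + 4) * ((k + 1) ^ 2 * (k + 1).centralBinom ^ 2) := by ring
        _ = (3 * k + 4) * (4 * (2 * k + 1) ^ 2) * k.centralBinom ^ 2 := by rw [h2]; ring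
        _ ≤ 16 * (k + 1) ^ 2 * (3 * k + 1) * k.centralBinom ^ 2 := by
          refine Nat.mul_le_mul_right _ ?_
          nlinarith
        _ = 16 * (k + 1) ^ 2 * ((3 * k + 1) * k.centralBinom ^ 2) := by ring
        _ ≤ 16 * (k + 1) ^ 2 * 16 ^ k := Nat.mul_le_mul_left _ ih
        _ = _ := by ring
    exact Nat.le_of_mul_le_mul_right h3 (by positivity)

/-- There are many sets compared to the number of sets that are split evenly by a partition. -/
theorem pow_mul_le_centralBinom_sq {k n : ℕ} (hk : 1 ≤ k) (hn : 2 ≤ n) :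
    ((9 * k + 3 : ℝ) / 8) ^ (n - 1) * ((k.centralBinom : ℝ) ^ n) ^ 2 ≤
      ((k * n).centralBinom : ℝ) ^ 2 := by
  have h1 : (16 : ℝ) ^ (k * n) ≤ 4 * (k * n) * ((k * n).centralBinom : ℝ) ^ 2 := by
    rcases sixteen_pow_le (k * n) with h | h
    · exact_mod_cast h
    · have : 0 < k * n := by positivity
      omega
  have h2 : (3 * k + 1 : ℝ) * (k.centralBinom : ℝ) ^ 2 ≤ 16 ^ k := by
    exact_mod_cast centralBinom_sq_le k
  have h3 : (3 * k + 1 : ℝ) ^ n * ((k.centralBinom : ℝ) ^ n) ^ 2 ≤ 16 ^ (k * n) := by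
    rw [pow_mul, ← pow_mul, mul_comm n 2, pow_mul, ← mul_pow]
    gcongr
  have hk' : (1 : ℝ) ≤ k := by exact_mod_cast hk
  -- The base is `3/8 · (3k + 1)`. The factor `3/8` absorbs `4kn` already for `n = 2`, and the base
  -- still exceeds `1` for `k = 1`, which is needed for unit demand.
  have h4 : ((9 * k + 3 : ℝ) / 8) ^ (n - 1) * (4 * (k * n)) ≤ (3 * k + 1) ^ n := by
    obtain ⟨j, rfl⟩ := Nat.exists_eq_add_of_le hn
    have : 2 + j - 1 = j + 1 := by omega
    rw [this]
    clear h1 h3 hn this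
    induction j with
    | zero => norm_num; nlinarith
    | succ j ih =>
      have e : 2 + (j + 1) = (2 + j) + 1 := by omega
      rw [e, pow_succ, pow_succ (3 * (k : ℝ) + 1)]
      have hp : (0 : ℝ) ≤ ((9 * k + 3 : ℝ) / 8) ^ (j + 1) := by positivity
      calc ((9 * k + 3 : ℝ) / 8) ^ (j + 1) * ((9 * k + 3) / 8) * (4 * (k * ((2 + j + 1 : ℕ) : ℝ)))
          = ((9 * k + 3 : ℝ) / 8) ^ (j + 1) * (4 * (k * ((9 * k + 3) / 8 * (2 + j + 1)))) := by
            push_cast; ring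
        _ ≤ ((9 * k + 3 : ℝ) / 8) ^ (j + 1) * (4 * (k * ((3 * k + 1) * (2 + j)))) := by
            gcongr ?_ * (4 * (k * ?_))
            have hj : (0 : ℝ) ≤ j := by positivity
            nlinarith
        _ = (((9 * k + 3 : ℝ) / 8) ^ (j + 1) * (4 * (k * ((2 + j : ℕ) : ℝ)))) * (3 * k + 1) := by
            push_cast; ring
        _ ≤ _ := by gcongr
  have hpos : (0 : ℝ) < 4 * (k * n) := by
    have : (2 : ℝ) ≤ n := by exact_mod_cast hn
    positivity
  refine le_of_mul_le_mul_right ?_ hpos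
  calc _ = ((9 * k + 3 : ℝ) / 8) ^ (n - 1) * (4 * (k * n)) * ((k.centralBinom : ℝ) ^ n) ^ 2 := by
        ring
    _ ≤ (3 * k + 1) ^ n * ((k.centralBinom : ℝ) ^ n) ^ 2 := by gcongr
    _ ≤ 16 ^ (k * n) := h3
    _ ≤ _ := h1
    _ = _ := by ring

theorem log_ratio_ge {k n : ℕ} (hk : 1 ≤ k) (hn : 2 ≤ n) :
    (n : ℝ) / 4 * Real.log ((9 * k + 3 : ℝ) / 8) ≤
      Real.log (((k * n).centralBinom : ℝ) / (k.centralBinom : ℝ) ^ n) := by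
  have hk' : (1 : ℝ) ≤ k := by exact_mod_cast hk
  have hn' : (2 : ℝ) ≤ n := by exact_mod_cast hn
  have hc : (0 : ℝ) < (k.centralBinom : ℝ) ^ n := by
    have := Nat.centralBinom_pos k
    positivity
  have hc' : (0 : ℝ) < (k * n).centralBinom := by exact_mod_cast Nat.centralBinom_pos _
  have h1 : ((9 * k + 3 : ℝ) / 8) ^ (n - 1) ≤
      (((k * n).centralBinom : ℝ) / (k.centralBinom : ℝ) ^ n) ^ 2 := by
    rw [div_pow ((k * n).centralBinom : ℝ), le_div_iff₀ (by positivity)]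
    exact pow_mul_le_centralBinom_sq hk hn
  have h2 := Real.log_le_log (by positivity) h1
  rw [Real.log_pow, Real.log_pow, Nat.cast_sub (by omega)] at h2
  have h3 : 0 ≤ Real.log ((9 * k + 3 : ℝ) / 8) := Real.log_nonneg (by linarith)
  push_cast at h2
  nlinarith

/-- An allocation splits few sets of items evenly. -/
theorem card_even_split_le {n m k : ℕ} (hN : 2 * (k * n) ≤ m) (A : Allocation n m)
    (S' : Finset (Finset (Fin m)))
    (hsub : S' ⊆ (firstItems m (2 * (k * n))).powersetCard (k * n))
    (h : ∀ T ∈ S', ∀ i, k ≤ (T ∩ bundle A i).card) : S'.card ≤ k.centralBinom ^ n := by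
  classical
  set F := firstItems m (2 * (k * n))
  have hF : F.card = 2 * (k * n) := card_firstItems hN
  -- Only `kn` items are hidden, so `n` bundles with at least `k` of them contain exactly `k` each.
  have heq : ∀ T ∈ S', ∀ i, (T ∩ bundle A i).card = k := by
    intro T hT i
    have h1 := sum_card_inter_bundle A T
    rw [(Finset.mem_powersetCard.1 (hsub hT)).2] at h1
    by_contra hne
    have h2 : ∑ i : Fin n, k < ∑ i, (T ∩ bundle A i).card :=
      Finset.sum_lt_sum (fun i _ => h T hT i)
        ⟨i, Finset.mem_univ _, lt_of_le_of_ne (h T hT i) (Ne.symm hne)⟩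
    rw [h1] at h2
    simp [mul_comm] at h2
  have h1 : S'.card ≤ (Fintype.piFinset fun i => (F ∩ bundle A i).powersetCard k).card := by
    refine Finset.card_le_card_of_injOn (fun T i => T ∩ bundle A i) ?_ ?_
    · intro T hT
      simp only [Finset.mem_coe, Fintype.mem_piFinset, Finset.mem_powersetCard]
      intro i
      exact ⟨Finset.inter_subset_inter_right (Finset.mem_powersetCard.1 (hsub hT)).1, heq T hT i⟩
    · intro T _ T' _ hTT
      ext e
      have := congrFun hTT (A e)
      have := Finset.ext_iff.1 this e
      simpa [bundle] using this
  rw [Fintype.card_piFinset] at h1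
  simp only [Finset.card_powersetCard] at h1
  have h2 : (∏ i, ((F ∩ bundle A i).card.choose k)) * (4 ^ k) ^ n ≤
      k.centralBinom ^ n * (4 ^ k) ^ n := by
    have e1 : ((4 : ℕ) ^ k) ^ n = ∏ _i : Fin n, 4 ^ k := by simp
    -- The bundles partition the `2kn` items of `F`, so the powers of two multiply to `4^(kn)` and
    -- cancel.
    calc _ = ∏ i, ((F ∩ bundle A i).card.choose k * 4 ^ k) := by
          rw [Finset.prod_mul_distrib, ← e1]
      _ ≤ ∏ i, (k.centralBinom * 2 ^ (F ∩ bundle A i).card) :=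
          Finset.prod_le_prod' fun i _ => choose_mul_four_pow_le k _
      _ = k.centralBinom ^ n * 2 ^ (∑ i, (F ∩ bundle A i).card) := by
          rw [Finset.prod_mul_distrib, Finset.prod_pow_eq_pow_sum]; simp
      _ = _ := by
          rw [sum_card_inter_bundle, hF, pow_mul, pow_mul]; norm_num
  exact h1.trans (Nat.le_of_mul_le_mul_right h2 (by positivity))

/-- The additive valuation with two values. -/
def additiveVal {m : ℕ} (a b : ℝ≥0) (T : Finset (Fin m)) : Valuation m :=
  fun U => ∑ e ∈ U, if e ∈ T then a else b

theorem additiveVal_eq {m : ℕ} (a b : ℝ≥0) (T U : Finset (Fin m)) :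
    additiveVal a b T U = (T ∩ U).card * a + (U \ T).card * b := by
  unfold additiveVal
  rw [Finset.sum_ite, Finset.sum_const, Finset.sum_const, nsmul_eq_mul, nsmul_eq_mul]
  congr 4
  · ext e; simp [and_comm]
  · ext e; simp

theorem isTwoValuedWith_additiveVal {m : ℕ} (a b : ℝ≥0) (T : Finset (Fin m)) :
    IsTwoValuedWith a b (additiveVal a b T) := by
  refine ⟨fun S => by simp [additiveVal], fun e => ?_⟩
  simp only [additiveVal, Finset.sum_singleton]
  split_ifs <;> simp

/-- The unit demand valuation of a set of good items. -/
def unitVal {m : ℕ} (T : Finset (Fin m)) : Valuation m :=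
  fun U => U.sup fun e => if e ∈ T then 1 else 0

theorem isUnitDemand_unitVal {m : ℕ} (T : Finset (Fin m)) : IsUnitDemand (unitVal T) := by
  intro S; simp [unitVal]

theorem one_le_unitVal_iff {m : ℕ} (T U : Finset (Fin m)) :
    1 ≤ unitVal T U ↔ 1 ≤ (T ∩ U).card := by
  unfold unitVal
  rw [Finset.one_le_card, Finset.le_sup_iff (by simp)]
  constructor
  · rintro ⟨e, he, h⟩
    by_cases heT : e ∈ T
    · exact ⟨e, Finset.mem_inter.2 ⟨heT, he⟩⟩
    · simp [heT] at h
  · rintro ⟨e, he⟩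
    exact ⟨e, (Finset.mem_inter.1 he).2, by simp [(Finset.mem_inter.1 he).1]⟩

theorem card_inter_bundle_eq {n m : ℕ} (T : Finset (Fin m)) (P : Allocation n m) (i : Fin n) :
    T ∩ bundle P i = T.filter fun e => P e = i := by
  ext e; simp [bundle]

/-- A hidden set of `kn` items can be divided into `n` parts of size `k`, so the maximin share is at
least `k`. Of the valuation only the threshold in `hw` matters; thus unit demand (`k = 1`) and
binary valuations are treated together. -/
theorem le_rcc_of_even_split {n m k : ℕ} (hk : 1 ≤ k) (hn : 2 ≤ n) (hN : 2 * (k * n) ≤ m)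
    (C : Set (Instance n m)) (w : Finset (Fin m) → Valuation m) (hC : ∀ T, (fun _ => w T) ∈ C)
    (hw : ∀ T U, (k : ℝ≥0) ≤ w T U ↔ k ≤ (T ∩ U).card) :
    ENNReal.ofReal ((n : ℝ) / 4 * Real.log ((9 * k + 3 : ℝ) / 8) / Real.log 2) ≤ rcc C := by
  have : Nonempty (Fin n) := ⟨⟨0, by omega⟩⟩
  set S := (firstItems m (2 * (k * n))).powersetCard (k * n)
  have hcard : S.card = (k * n).centralBinom := by
    rw [Finset.card_powersetCard, card_firstItems hN, Nat.centralBinom]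
  have hκ : (0 : ℝ) < (k.centralBinom : ℝ) ^ n := by
    have := Nat.centralBinom_pos k
    positivity
  refine le_trans (ENNReal.ofReal_le_ofReal ?_) (le_rcc C (fun T _ => w T) hκ S ?_ ?_ ?_)
  · have := log_ratio_ge hk hn
    rw [hcard]
    have := Real.log_pos one_lt_two
    gcongr
  · rw [← Finset.card_pos, hcard]; exact Nat.centralBinom_pos _
  · exact fun T _ => hC T
  · intro A S' hS' hA
    have : S'.card ≤ k.centralBinom ^ n := by
      refine card_even_split_le hN A S' hS' fun T hT i => ?_
      have hTc := (Finset.mem_powersetCard.1 (hS' hT)).2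
      obtain ⟨P, hP, -⟩ := exists_allocation_card T (fun _ => k) (by simp [hTc, mul_comm])
        (⟨0, by omega⟩ : Fin n)
      rw [← hw]
      refine (le_mms P fun j => ?_).trans (hA T hT i)
      rw [hw, card_inter_bundle_eq, hP]
    exact_mod_cast this

theorem unitDemand_lower {n m : ℕ} (hn : 2 ≤ n) (hm : 2 * n ≤ m) :
    ENNReal.ofReal (Real.log (3 / 2) / Real.log 2 / 4) ≤
      arcc (unitDemandInstances n m ∩ identicalInstances n m) := by
  have h := le_rcc_of_even_split (k := 1) le_rfl hn (by omega)
    (unitDemandInstances n m ∩ identicalInstances n m) unitVal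
    (fun T => ⟨fun _ => isUnitDemand_unitVal T, fun _ _ => rfl⟩)
    (fun T U => by rw [Nat.cast_one]; exact one_le_unitVal_iff T U)
  refine le_arcc (by omega) (le_of_eq ?_) h
  norm_num
  ring

theorem binary_lower {n m : ℕ} (hn : 2 ≤ n) (hm : 2 * n ≤ m) :
    ENNReal.ofReal (1 / 16 * Real.logb 2 ((m : ℝ) / n)) ≤
      arcc (binaryInstances n m ∩ identicalInstances n m) := by
  set k := m / (2 * n)
  have hk : 1 ≤ k := (Nat.one_le_div_iff (by omega)).2 hm
  have hkm : 2 * (k * n) ≤ m := by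
    have := Nat.div_mul_le_self m (2 * n)
    calc 2 * (k * n) = k * (2 * n) := by ring
      _ ≤ m := this
  have hmk : m < (k + 1) * (2 * n) := by
    rw [mul_comm]; exact Nat.lt_mul_div_succ m (by omega)
  have h := le_rcc_of_even_split hk hn hkm
    (binaryInstances n m ∩ identicalInstances n m) (additiveVal 1 0)
    (fun T => ⟨fun _ => ⟨(isTwoValuedWith_additiveVal 1 0 T).1,
      fun e => ((isTwoValuedWith_additiveVal 1 0 T).2 e).symm⟩, fun _ _ => rfl⟩)
    (fun T U => by rw [additiveVal_eq]; simp)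
  refine le_arcc (by omega) ?_ h
  have hn' : (2 : ℝ) ≤ n := by exact_mod_cast hn
  have hk' : (1 : ℝ) ≤ k := by exact_mod_cast hk
  -- Since `m/n ≤ 2(k+1)`, a fixed power of `(9k+3)/8` suffices; the fourth one works from `k = 1`
  -- on. Together with the factor `1/4` of `log_ratio_ge` this gives `1/16`.
  have h1 : (m : ℝ) / n ≤ ((9 * k + 3 : ℝ) / 8) ^ 4 := by
    rw [div_le_iff₀ (by linarith)]
    have h2 : (m : ℝ) ≤ (k + 1) * (2 * n) := by exact_mod_cast hmk.le
    refine h2.trans ?_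
    have h3 : (2 * k + 2 : ℝ) ≤ ((9 * k + 3 : ℝ) / 8) ^ 4 := by
      set x := (9 * k + 3 : ℝ) / 8 with hx
      have hkx : (k : ℝ) = (8 * x - 3) / 9 := by rw [hx]; ring
      have hx1 : 3 / 2 ≤ x := by rw [hx]; linarith
      have hx3 : (27 / 8 : ℝ) ≤ x ^ 3 := by
        have : (3 / 2 : ℝ) ^ 3 ≤ x ^ 3 := by gcongr
        norm_num at this ⊢; exact this
      rw [hkx]
      nlinarith
    nlinarith
  have hm0 : (0 : ℝ) < (m : ℝ) / n := by
    have : (0 : ℝ) < m := by exact_mod_cast (by omega : 0 < m)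
    positivity
  have h2 := Real.log_le_log hm0 h1
  rw [Real.log_pow] at h2
  have hl := Real.log_pos one_lt_two
  rw [Real.logb, ← mul_assoc, mul_div_assoc']
  refine div_le_div_of_nonneg_right ?_ hl.le
  push_cast at h2
  nlinarith

/-! ### The lower bound for two values. -/

theorem choose_le_choose_of_le_of_add_le {N r j : ℕ} (hrj : r ≤ j) (hj : j + r ≤ N) :
    N.choose r ≤ N.choose j := by
  have key : ∀ j, r ≤ j → 2 * j ≤ N → N.choose r ≤ N.choose j := by
    intro j hj
    induction j, hj using Nat.le_induction with
    | base => simp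
    | succ j _ ih =>
      intro h
      exact (ih (by omega)).trans (Nat.choose_le_succ_of_lt_half_left (by omega))
  rcases le_total (2 * j) N with h | h
  · exact key j hrj h
  · rw [← Nat.choose_symm (show j ≤ N by omega)]
    exact key _ (by omega) (by omega)

/-- Vandermonde's identity for `2kn = (kn - k) + (kn + k)`: the second factor `C(kn+k, kn-1-t)` of
every term is at least `C(kn+k, k-1)`, because `kn-1-t` lies between `k-1` and its mirror image. The
first factors add up to the power of two. -/
theorem choose_mul_two_pow_le {k n : ℕ} (hk : 1 ≤ k) (hn : 1 ≤ n) :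
    (k * n + k).choose (k - 1) * 2 ^ (k * n - k) ≤ (2 * (k * n)).choose (k * n - 1) := by
  have hkn : k ≤ k * n := Nat.le_mul_of_pos_right _ hn
  have e : 2 * (k * n) = (k * n - k) + (k * n + k) := by omega
  rw [e, Nat.add_choose_eq (k * n - k) (k * n + k), ← Nat.sum_range_choose, Finset.mul_sum,
    Finset.Nat.sum_antidiagonal_eq_sum_range_succ_mk]
  refine (Finset.sum_le_sum fun t ht => ?_).trans (Finset.sum_le_sum_of_subset
    (show Finset.range (k * n - k + 1) ⊆ Finset.range (k * n - 1 + 1) by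
      apply Finset.range_mono; omega))
  have ht := Finset.mem_range.1 ht
  rw [mul_comm]
  exact Nat.mul_le_mul_left _ (choose_le_choose_of_le_of_add_le (by omega) (by omega))

-- The hidden set consists of `kn - 1` items of value `a`; all items of value `b` together are worth
-- at most `a`. A partition in which one part has `k - 1` valuable items and all cheap ones, and the
-- other parts have `k` valuable items, bounds the maximin share from below. Some agent receives at
-- most `k - 1` valuable items; by that bound she has exactly `k - 1` of them and all cheap items.
-- Her bundle then contains `kn + k` of the `2kn` items of `F`, more than half, so she is the same
-- agent for all hidden sets that the allocation serves, and such a set is determined by its `k - 1`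
-- items in her bundle.
set_option maxHeartbeats 1600000 in
theorem twoValued_lower {n m : ℕ} (hn : 2 ≤ n) (hm : 2 * n ≤ m) {a b : ℝ≥0} (hb : 0 < b)
    (hab : b ≤ a / (m : ℝ≥0)) :
    ENNReal.ofReal (1 / 8 * ((m : ℝ) / n)) ≤
      arcc (twoValuedInstancesWith a b n m ∩ identicalInstances n m) := by
  classical
  set k := m / (2 * n)
  have hk : 1 ≤ k := (Nat.one_le_div_iff (by omega)).2 hm
  have hN : 2 * (k * n) ≤ m := by
    have := Nat.div_mul_le_self m (2 * n)
    calc 2 * (k * n) = k * (2 * n) := by ring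
      _ ≤ m := this
  have hmk : m < (k + 1) * (2 * n) := by
    rw [mul_comm]; exact Nat.lt_mul_div_succ m (by omega)
  have hkn : 2 * k ≤ k * n := by rw [mul_comm]; exact Nat.mul_le_mul_left _ hn
  have hm0 : (0 : ℝ≥0) < m := by exact_mod_cast (by omega : 0 < m)
  have hmb : (m : ℝ≥0) * b ≤ a := by
    rw [mul_comm]; exact (le_div_iff₀ hm0).1 hab
  have ha : 0 < a := lt_of_lt_of_le (by positivity) hmb
  have : Nonempty (Fin n) := ⟨⟨0, by omega⟩⟩
  set F := firstItems m (2 * (k * n))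
  have hF : F.card = 2 * (k * n) := card_firstItems hN
  set S := F.powersetCard (k * n - 1)
  have hcard : S.card = (2 * (k * n)).choose (k * n - 1) := by
    rw [Finset.card_powersetCard, hF]
  have hκ : 0 < (k * n + k).choose (k - 1) := Nat.choose_pos (by omega)
  have hle := choose_mul_two_pow_le hk (show 1 ≤ n by omega)
  have hmain : ENNReal.ofReal (Real.log (S.card / ((k * n + k).choose (k - 1) : ℝ)) / Real.log 2)
      ≤ rcc (twoValuedInstancesWith a b n m ∩ identicalInstances n m) := by
    refine le_rcc _ (fun T _ => additiveVal a b T) (by exact_mod_cast hκ) S ?_ ?_ ?_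
    · rw [← Finset.card_pos, hcard]; exact Nat.choose_pos (by omega)
    · exact fun T _ => ⟨fun _ => isTwoValuedWith_additiveVal a b T, fun _ _ => rfl⟩
    · intro A S' hS' hA
      have hT : ∀ T ∈ S', ∃ i, F \ T ⊆ bundle A i ∧ (T ∩ bundle A i).card = k - 1 := by
        intro T hT
        have hTc := (Finset.mem_powersetCard.1 (hS' hT)).2
        let i₀ : Fin n := ⟨0, by omega⟩
        obtain ⟨P, hP, hP0⟩ := exists_allocation_card T (fun i => if i = i₀ then k - 1 else k) (by
          have : ∑ i : Fin n, (if i = i₀ then k - 1 else k) + 1 = k * n := by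
            rw [← Finset.add_sum_erase _ _ (Finset.mem_univ i₀),
              Finset.sum_congr rfl (g := fun _ => k)
                (fun i hi => if_neg (Finset.ne_of_mem_erase hi))]
            simp only [if_true, Finset.sum_const, smul_eq_mul]
            rw [Finset.card_erase_of_mem (Finset.mem_univ _), Finset.card_univ, Fintype.card_fin]
            obtain ⟨n', rfl⟩ := Nat.exists_eq_add_of_le hn
            have : 2 + n' - 1 = n' + 1 := by omega
            rw [this]
            have : k - 1 + 1 = k := by omega
            calc k - 1 + (n' + 1) * k + 1 = (k - 1 + 1) + (n' + 1) * k := by ring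
              _ = k * (2 + n') := by rw [this]; ring
          rw [hTc]; omega) i₀
        have hmms : ((k - 1 : ℕ) : ℝ≥0) * a + (Finset.univ \ T).card * b ≤
            mms n (additiveVal a b T) := by
          refine le_mms P fun j => ?_
          rw [additiveVal_eq, card_inter_bundle_eq, hP]
          by_cases hj : j = i₀
          · rw [if_pos hj]
            have : Finset.univ \ T ⊆ bundle P j \ T := by
              intro e he
              have he' : e ∉ T := (Finset.mem_sdiff.1 he).2
              simp [bundle, he', hP0 e he', hj]
            gcongr
          · rw [if_neg hj]
            have h1 : ((Finset.univ \ T).card : ℝ≥0) * b ≤ a := by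
              refine le_trans ?_ hmb
              gcongr
              exact (Finset.card_le_univ _).trans (by simp)
            calc ((k - 1 : ℕ) : ℝ≥0) * a + (Finset.univ \ T).card * b
                ≤ ((k - 1 : ℕ) : ℝ≥0) * a + a := by gcongr
              _ = ((k - 1 + 1 : ℕ) : ℝ≥0) * a := by push_cast; ring
              _ = k * a := by congr 2; omega
              _ ≤ _ := le_self_add
        have hsum := sum_card_inter_bundle A T
        obtain ⟨i, hi⟩ : ∃ i, (T ∩ bundle A i).card ≤ k - 1 := by
          by_contra hcon
          push Not at hcon
          have : ∑ i : Fin n, k ≤ ∑ i, (T ∩ bundle A i).card :=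
            Finset.sum_le_sum fun i _ => by have := hcon i; omega
          rw [hsum, hTc] at this
          simp only [Finset.sum_const, Finset.card_univ, Fintype.card_fin, smul_eq_mul] at this
          rw [mul_comm] at this
          omega
        have h3 := hmms.trans (hA T hT i)
        change _ ≤ additiveVal a b T (bundle A i) at h3
        rw [additiveVal_eq] at h3
        have hsm : (bundle A i \ T).card ≤ (Finset.univ \ T).card :=
          Finset.card_le_card (Finset.sdiff_subset_sdiff (Finset.subset_univ _) le_rfl)
        have hi' : (T ∩ bundle A i).card = k - 1 := by
          by_contra hne
          have hlt : (T ∩ bundle A i).card < k - 1 := by omega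
          have : ((T ∩ bundle A i).card : ℝ≥0) * a + (bundle A i \ T).card * b <
              ((k - 1 : ℕ) : ℝ≥0) * a + (Finset.univ \ T).card * b := by
            refine add_lt_add_of_lt_of_le ?_ (by gcongr)
            gcongr
          exact absurd h3 (not_le.2 this)
        refine ⟨i, ?_, hi'⟩
        rw [hi'] at h3
        have h4 := le_of_add_le_add_left h3
        have h5 : (Finset.univ \ T).card ≤ (bundle A i \ T).card := by
          exact_mod_cast le_of_mul_le_mul_right h4 hb
        have h6 := Finset.eq_of_subset_of_card_le
          (Finset.sdiff_subset_sdiff (Finset.subset_univ (bundle A i)) (le_refl T)) h5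
        intro e he
        have : e ∈ Finset.univ \ T := by simp [(Finset.mem_sdiff.1 he).2]
        rw [← h6] at this
        exact (Finset.mem_sdiff.1 this).1
      have hB : ∀ T ∈ S', ∀ i, F \ T ⊆ bundle A i → (T ∩ bundle A i).card = k - 1 →
          (F ∩ bundle A i).card = k * n + k := by
        intro T hT i h1 h2
        obtain ⟨hTF, hTc⟩ := Finset.mem_powersetCard.1 (hS' hT)
        have e1 : F ∩ bundle A i = (F \ T) ∪ (T ∩ bundle A i) := by
          ext e
          have := @hTF e
          have := @h1 e
          simp only [Finset.mem_inter, Finset.mem_union, Finset.mem_sdiff] at *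
          tauto
        rw [e1, Finset.card_union_of_disjoint, Finset.card_sdiff_of_subset hTF, hF, hTc, h2]
        · omega
        · rw [Finset.disjoint_left]
          intro e he he'
          exact (Finset.mem_sdiff.1 he).2 (Finset.mem_inter.1 he').1
      rcases S'.eq_empty_or_nonempty with rfl | ⟨T₀, hT₀⟩
      · simp
      obtain ⟨i, hi1, hi2⟩ := hT T₀ hT₀
      have hBi := hB T₀ hT₀ i hi1 hi2
      have huniq : ∀ T ∈ S', F \ T ⊆ bundle A i ∧ (T ∩ bundle A i).card = k - 1 := by
        intro T hT'
        obtain ⟨j, hj1, hj2⟩ := hT T hT'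
        have hBj := hB T hT' j hj1 hj2
        by_cases hij : j = i
        · subst hij; exact ⟨hj1, hj2⟩
        · exfalso
          have hs := sum_card_inter_bundle A F
          have : ∑ l ∈ ({i, j} : Finset (Fin n)), (F ∩ bundle A l).card ≤
              ∑ l, (F ∩ bundle A l).card :=
            Finset.sum_le_sum_of_subset (Finset.subset_univ _)
          rw [Finset.sum_pair (Ne.symm hij), hs, hF, hBi, hBj] at this
          omega
      have : S'.card ≤ ((F ∩ bundle A i).powersetCard (k - 1)).card := by
        refine Finset.card_le_card_of_injOn (fun T => T ∩ bundle A i) ?_ ?_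
        · intro T hT'
          simp only [Finset.mem_coe, Finset.mem_powersetCard]
          exact ⟨Finset.inter_subset_inter_right (Finset.mem_powersetCard.1 (hS' hT')).1,
            (huniq T hT').2⟩
        · intro T hT1 T' hT2 hTT
          ext e
          have h1 := Finset.ext_iff.1 hTT e
          have h2 := @(huniq T hT1).1 e
          have h3 := @(huniq T' hT2).1 e
          have h4 := @(Finset.mem_powersetCard.1 (hS' hT1)).1 e
          have h5 := @(Finset.mem_powersetCard.1 (hS' hT2)).1 e
          simp only [Finset.mem_inter, Finset.mem_sdiff] at h1 h2 h3
          tauto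
      rw [Finset.card_powersetCard, hBi] at this
      exact_mod_cast this
  refine le_arcc (by omega) ?_ hmain
  have hl := Real.log_pos one_lt_two
  rw [le_div_iff₀ hl, hcard]
  have h1 : (2 : ℝ) ^ (k * n - k) ≤
      ((2 * (k * n)).choose (k * n - 1) : ℝ) / ((k * n + k).choose (k - 1) : ℝ) := by
    rw [le_div_iff₀ (by exact_mod_cast hκ), mul_comm]
    exact_mod_cast hle
  have h2 := Real.log_le_log (by positivity) h1
  rw [Real.log_pow] at h2
  refine le_trans ?_ h2
  gcongr
  rw [Nat.cast_sub (by omega)]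
  -- The exponent `kn - k` is at least `kn/2` because of `n ≥ 2`, and `m ≤ 2(k+1)n ≤ 4kn`; this
  -- explains `1/8`.
  have h3 : (m : ℝ) ≤ (k + 1) * (2 * n) := by exact_mod_cast hmk.le
  have hn' : (2 : ℝ) ≤ n := by exact_mod_cast hn
  have hk' : (1 : ℝ) ≤ k := by exact_mod_cast hk
  have : (n : ℝ) * (1 / 8 * (m / n)) = m / 8 := by field_simp
  rw [this]
  push_cast
  nlinarith

/-! ### Naming and cutting with public randomness. -/

theorem two_mul_pow_le_pow {a g M : ℕ} (hg : 0 < g) (h : a + g ≤ g * M) :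
    2 * a ^ M ≤ (a + g) ^ M := by
  rcases Nat.eq_zero_or_pos M with rfl | hM
  · simp at h; omega
  rcases Nat.eq_zero_or_pos a with rfl | ha
  · simp [hM.ne']
  have ha' : (0 : ℝ) < a := by exact_mod_cast ha
  -- Bernoulli's inequality: `M` independent draws, each hitting with probability `g/(a+g) ≥ 1/M`,
  -- all miss with probability at most `1/2`.
  have h1 := one_add_mul_le_pow (a := (g : ℝ) / a) (by
    have : (0 : ℝ) ≤ (g : ℝ) / a := by positivity
    linarith) M
  have h2 : (1 : ℝ) ≤ M * ((g : ℝ) / a) := by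
    rw [mul_div_assoc', le_div_iff₀ ha', one_mul]
    have : (a : ℝ) + g ≤ g * M := by exact_mod_cast h
    have : (0 : ℝ) ≤ g := by positivity
    linarith
  have h3 : ((a : ℝ) + g) ^ M = a ^ M * (1 + (g : ℝ) / a) ^ M := by
    rw [← mul_pow]; congr 1; field_simp
  have h4 : (2 : ℝ) * a ^ M ≤ (a + g) ^ M := by
    rw [h3]
    have : (0 : ℝ) < (a : ℝ) ^ M := by positivity
    nlinarith
  exact_mod_cast h4

/-- Resampling one coordinate of a uniformly distributed function. -/
theorem expect_update {J I : Type} [Fintype J] [DecidableEq J] [Fintype I] (f : (J → I) → ℝ)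
    (r : J) :
    (Finset.univ.expect fun X : J → I => Finset.univ.expect fun x : I => f (Function.update X r x)) =
      Finset.univ.expect f := by
  rcases isEmpty_or_nonempty I with hI | hI
  · have : IsEmpty (J → I) := ⟨fun X => hI.elim (X r)⟩
    simp
  -- Exchanging the coordinate `r` with the fresh sample is an involution.
  let e : (J → I) × I ≃ (J → I) × I :=
    { toFun := fun p => (Function.update p.1 r p.2, p.1 r)
      invFun := fun p => (Function.update p.1 r p.2, p.1 r)
      left_inv := fun p => by simp
      right_inv := fun p => by simp }
  have h1 : ∑ p : (J → I) × I, f (Function.update p.1 r p.2) = ∑ p : (J → I) × I, f p.1 :=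
    Fintype.sum_equiv e _ _ fun p => rfl
  rw [Fintype.sum_prod_type, Fintype.sum_prod_type] at h1
  simp only [Fintype.expect_eq_sum_div_card]
  rw [← Finset.sum_div, h1]
  have : (Fintype.card I : ℝ) ≠ 0 := by positivity
  simp only [Finset.sum_const, Finset.card_univ, nsmul_eq_mul, ← Finset.mul_sum]
  field_simp

theorem expect_indicator_le {Ω : Type} [Fintype Ω] [Nonempty Ω] (P : Ω → Prop)
    [DecidablePred P] {q : ℝ} (h : ((Finset.univ.filter P).card : ℝ) ≤ q * Fintype.card Ω) :
    (Finset.univ.expect fun ω => if P ω then (1 : ℝ) else 0) ≤ q := by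
  rw [Fintype.expect_eq_sum_div_card, Finset.sum_boole, div_le_iff₀ (by positivity)]
  exact h

/-- Flipping the colour of one of two fixed items of `D` maps the colourings that do not separate
`D` injectively to colourings that do. -/
theorem two_mul_card_not_separating_le {m : ℕ} {D : Finset (Fin m)} (hD : 2 ≤ D.card)
    (inst : DecidablePred fun s : Fin m → Bool => ¬ ∀ b, ∃ e ∈ D, s e = b) :
    2 * (Finset.univ.filter fun s : Fin m → Bool => ¬ ∀ b, ∃ e ∈ D, s e = b).card ≤
      Fintype.card (Fin m → Bool) := by
  classical
  obtain ⟨e, he, e', he', hne⟩ := Finset.one_lt_card.1 hD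
  set P : (Fin m → Bool) → Prop := fun s => ∀ b, ∃ e ∈ D, s e = b
  have h1 : (Finset.univ.filter fun s => ¬ P s).card ≤ (Finset.univ.filter P).card := by
    refine Finset.card_le_card_of_injOn (fun s => Function.update s e (!s e)) ?_ ?_
    · intro s hs
      have hs : ¬ P s := (Finset.mem_filter.1 (Finset.mem_coe.1 hs)).2
      have hs' : s e' = s e := by
        by_contra hc
        refine hs fun b => ?_
        by_cases hb : s e = b
        · exact ⟨e, he, hb⟩
        · exact ⟨e', he', (by decide : ∀ x y z : Bool, x ≠ y → y ≠ z → x = z) _ _ _ hc hb⟩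
      refine Finset.mem_coe.2 (Finset.mem_filter.2 ⟨Finset.mem_univ _, fun b => ?_⟩)
      by_cases hb : s e = b
      · exact ⟨e', he', by simp only [Function.update_of_ne hne.symm, hs', hb]⟩
      · refine ⟨e, he, ?_⟩
        simp only [Function.update_self]
        exact (by decide : ∀ x z : Bool, x ≠ z → (!x) = z) _ _ hb
    · intro s _ s' _ h
      funext x
      have h2 := congrFun h x
      by_cases hx : x = e
      · subst hx
        simpa only [Function.update_self, Bool.not_inj_iff] using h2
      · simpa only [Function.update_of_ne hx] using h2
  have h2 := Finset.card_filter_add_card_filter_not (s := (Finset.univ : Finset (Fin m → Bool))) P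
  rw [Finset.card_univ] at h2
  have h3 : (Finset.univ.filter fun s : Fin m → Bool => ¬ ∀ b, ∃ e ∈ D, s e = b).card =
    (Finset.univ.filter fun s => ¬ P s).card := by congr
  omega

namespace RTree

variable {X : Type} {n : ℕ} {α : Type}

/-- An agent announces an element of a finite type. -/
theorem exists_announce {Λ : Type} [Fintype Λ] [Nonempty Λ] (i : Fin n) {b : ℕ}
    (hb : Fintype.card Λ ≤ 2 ^ b) (f : X → Λ) :
    ∃ t : RTree X n Λ, ∀ v, t.Spec v (fun a => a = f (v i)) b := by
  classical
  obtain ⟨t, ht⟩ := exists_askNat i b (fun x => (Fintype.equivFin Λ (f x)).1) fun x =>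
    (Fin.is_lt _).trans_le hb
  refine ⟨t.bind fun a => .ret (if h : a < Fintype.card Λ then (Fintype.equivFin Λ).symm ⟨a, h⟩
    else Classical.arbitrary Λ), fun v => ?_⟩
  rw [← add_zero (b : ℝ≥0∞)]
  refine (ht v).bind fun a ha => spec_ret ?_
  subst ha
  simp

/-- An agent announces an element with a property. -/
theorem exists_announce_mem {Λ : Type} [Fintype Λ] [Nonempty Λ] (i : Fin n) {b : ℕ}
    (hb : Fintype.card Λ ≤ 2 ^ b) (G : X → Λ → Prop) :
    ∃ t : RTree X n Λ, ∀ v, (∃ a, G (v i) a) → t.Spec v (G (v i)) b := by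
  obtain ⟨t, ht⟩ := exists_announce i hb fun x => Classical.epsilon (G x)
  exact ⟨t, fun v hv => (ht v).mono (fun a ha => ha ▸ Classical.epsilon_spec hv) le_rfl⟩

open Classical in
/-- A public coin proposes a result; if an agent accepts it, one continues with it, and otherwise
with a default tree. -/
theorem exists_propose {Ω : Type} [Fintype Ω] [Nonempty Ω] (i : Fin n) (acc : X → Ω → Prop)
    (s : Ω → RTree X n α) (t : RTree X n α) : ∃ t' : RTree X n α, ∀ (v : Fin n → X)
      (Q : α → Prop) (a b q : ℝ), 0 ≤ a → a ≤ b →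
      ((Finset.univ.filter fun ω => ¬ acc (v i) ω).card : ℝ) ≤ q * Fintype.card Ω →
      (∀ ω, acc (v i) ω → (s ω).Spec v Q (ENNReal.ofReal a)) → t.Spec v Q (ENNReal.ofReal b) →
      t'.Spec v Q (ENNReal.ofReal (1 + a + (b - a) * q)) := by
  refine ⟨RTree.coinOver fun ω => .ask i (fun x => decide (acc x ω)) fun c => if c then s ω else t,
    fun v Q a b q ha hab h1 h2 h3 => ?_⟩
  have h4 := Spec.coinOver_ofReal (Q := Q) (v := v) (next := fun ω => .ask i
    (fun x => decide (acc x ω)) fun c => if c then s ω else t)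
    (c := fun ω => (a + 1) + (b - a) * if ¬ acc (v i) ω then 1 else 0)
    (fun ω => by
      have : 0 ≤ b - a := by linarith
      positivity)
    (fun ω => by
      by_cases h : acc (v i) ω
      · simp only [h, not_true_eq_false, if_false, mul_zero, add_zero]
        rw [ENNReal.ofReal_add ha zero_le_one, ENNReal.ofReal_one]
        refine Spec.ask ?_
        simpa [h] using h2 ω h
      · simp only [h, not_false_eq_true, if_true, mul_one]
        have : a + 1 + (b - a) = b + 1 := by ring
        rw [this, ENNReal.ofReal_add (by linarith) zero_le_one, ENNReal.ofReal_one]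
        refine Spec.ask ?_
        simpa [h] using h3)
  refine h4.mono (fun _ h => h) (ENNReal.ofReal_le_ofReal ?_)
  rw [Finset.expect_add_distrib, Fintype.expect_const, ← Finset.mul_expect]
  have := expect_indicator_le (fun ω => ¬ acc (v i) ω) h1
  nlinarith

/-- An agent names a member of a large set by few bits. -/
theorem exists_name {Λ : Type} [Fintype Λ] [Nonempty Λ] (i : Fin n) (G : X → Finset Λ) :
    ∃ t : RTree X n Λ, ∀ (v : Fin n → X) (r : ℕ), (G (v i)).Nonempty →
      Fintype.card Λ ≤ (G (v i)).card * 2 ^ r →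
      t.Spec v (fun a => a ∈ G (v i)) (ENNReal.ofReal (2 * r + 3)) := by
  classical
  set N := Nat.clog 2 (Fintype.card Λ)
  have hN : Fintype.card Λ ≤ 2 ^ N := Nat.le_pow_clog (by norm_num) _
  -- The density `2^(-r)` of the set is not known to the protocol. In stage `t`, a public coin draws
  -- `2^t` candidates; the agent says whether one of them is in her set, and names it by `t` bits if
  -- so. Otherwise stage `t + 1` follows. A stage below `r` is charged one bit, and a later one
  -- fails with probability at most `1/2`; the stated cost solves this recursion. In the last stage
  -- `N` she simply names an element.
  have key : ∀ s t : ℕ, t + s = N → ∃ T : RTree X n Λ, ∀ (v : Fin n → X) (r : ℕ),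
      (G (v i)).Nonempty → Fintype.card Λ ≤ (G (v i)).card * 2 ^ r →
      T.Spec v (fun a => a ∈ G (v i)) (ENNReal.ofReal ((max t r + (r - t) + 3 : ℕ) : ℝ)) := by
    intro s
    induction s with
    | zero =>
      intro t ht
      obtain ⟨T, hT⟩ := exists_announce_mem i hN fun x a => a ∈ G x
      refine ⟨T, fun v r h1 h2 => (hT v h1).mono (fun _ h => h) ?_⟩
      rw [ENNReal.ofReal_natCast]
      exact_mod_cast (by omega : N ≤ max t r + (r - t) + 3)
    | succ s ih =>
      intro t ht
      obtain ⟨T, hT⟩ := ih (t + 1) (by omega)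
      have h0 : ∀ f : Fin (2 ^ t) → Λ, ∃ S : RTree X n Λ, ∀ v, (∃ c, f c ∈ G (v i)) →
          S.Spec v (fun a => a ∈ G (v i)) (ENNReal.ofReal t) := by
        intro f
        obtain ⟨S, hS⟩ := exists_announce_mem (Λ := Fin (2 ^ t)) i (b := t) (by simp)
          fun x c => f c ∈ G x
        refine ⟨S.bind fun c => .ret (f c), fun v hv => ?_⟩
        rw [ENNReal.ofReal_natCast, ← add_zero (t : ℝ≥0∞)]
        exact (hS v hv).bind fun c hc => spec_ret hc
      choose S hS using h0
      obtain ⟨T', hT'⟩ := exists_propose i (fun x (f : Fin (2 ^ t) → Λ) => ∃ c, f c ∈ G x) S T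
      refine ⟨T', fun v r h1 h2 => ?_⟩
      have h3 := hT' v (fun a => a ∈ G (v i))
      have h4 := hT v r h1 h2
      by_cases hr : t < r
      · refine (h3 t _ 1 (by positivity) ?_ ?_ (fun f hf => hS f v hf) h4).mono (fun _ h => h)
          (ENNReal.ofReal_le_ofReal ?_)
        · exact_mod_cast (by omega : t ≤ max (t + 1) r + (r - (t + 1)) + 3)
        · rw [one_mul]; exact_mod_cast Finset.card_le_univ _
        · have : max t r + (r - t) + 3 = max (t + 1) r + (r - (t + 1)) + 3 + 1 := by omega
          rw [this]; push_cast; linarith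
      · refine (h3 t _ (1 / 2) (by positivity) ?_ ?_ (fun f hf => hS f v hf) h4).mono
          (fun _ h => h) (ENNReal.ofReal_le_ofReal ?_)
        · exact_mod_cast (by omega : t ≤ max (t + 1) r + (r - (t + 1)) + 3)
        · have e1 : ∀ inst : DecidablePred fun f : Fin (2 ^ t) → Λ => ¬ ∃ c, f c ∈ G (v i),
              @Finset.filter _ _ inst Finset.univ = Fintype.piFinset fun _ => (G (v i))ᶜ := by
            intro inst; ext f; simp
          have e2 := Finset.card_compl_add_card (G (v i))
          have h5 := two_mul_pow_le_pow (a := ((G (v i))ᶜ).card) (M := 2 ^ t)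
            (Finset.card_pos.2 h1) (by
              rw [e2]
              exact h2.trans (Nat.mul_le_mul_left _ (Nat.pow_le_pow_right (by norm_num)
                (by omega))))
          rw [e2] at h5
          rw [e1, Fintype.card_piFinset_const, Fintype.card_fun, Fintype.card_fin]
          have h6 : (2 : ℝ) * ((((G (v i))ᶜ).card ^ 2 ^ t : ℕ) : ℝ) ≤
            ((Fintype.card Λ ^ 2 ^ t : ℕ) : ℝ) := by exact_mod_cast h5
          linarith
        · have e1 : max t r + (r - t) + 3 = t + 3 := by omega
          have e2 : max (t + 1) r + (r - (t + 1)) + 3 = t + 4 := by omega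
          rw [e1, e2]; push_cast; linarith
  obtain ⟨T, hT⟩ := key N 0 (by omega)
  refine ⟨T, fun v r h1 h2 => (hT v r h1 h2).mono (fun _ h => h) (ENNReal.ofReal_le_ofReal ?_)⟩
  have : max 0 r + (r - 0) + 3 = 2 * r + 3 := by omega
  rw [this]; push_cast; rfl

/-- A public coin separates two of an agent's items. -/
theorem exists_cut {m : ℕ} (i : Fin n) (D : X → Finset (Fin m)) :
    ∃ t : RTree X n (Fin m → Bool), ∀ v : Fin n → X, 2 ≤ (D (v i)).card →
      t.Spec v (fun s => ∀ b, ∃ e ∈ D (v i), s e = b) (ENNReal.ofReal 3) := by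
  classical
  set N := Nat.clog 2 (Fintype.card (Fin m → Bool))
  have hN : Fintype.card (Fin m → Bool) ≤ 2 ^ N := Nat.le_pow_clog (by norm_num) _
  have hex : ∀ D : Finset (Fin m), 2 ≤ D.card → ∃ s : Fin m → Bool, ∀ b, ∃ e ∈ D, s e = b := by
    intro D hD
    obtain ⟨e, he, e', he', hne⟩ := Finset.one_lt_card.1 hD
    refine ⟨fun x => decide (x = e), fun b => ?_⟩
    cases b
    · exact ⟨e', he', by simp [hne.symm]⟩
    · exact ⟨e, he, by simp⟩
  -- A random colouring separates with probability at least `1/2`, so another attempt turns a cost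
  -- bound `c` into `1 + c/2`, whose fixed point is `2`. After `N` failures the agent describes a
  -- colouring by `N` bits, which contributes `N / 2^N ≤ 1`.
  have key : ∀ f : ℕ, ∃ t : RTree X n (Fin m → Bool), ∀ v : Fin n → X, 2 ≤ (D (v i)).card →
      t.Spec v (fun s => ∀ b, ∃ e ∈ D (v i), s e = b) (ENNReal.ofReal (2 + N / 2 ^ f)) := by
    intro f
    induction f with
    | zero =>
      obtain ⟨t, ht⟩ := exists_announce_mem i hN fun x s => ∀ b, ∃ e ∈ D x, s e = b
      refine ⟨t, fun v hv => (ht v (hex _ hv)).mono (fun _ h => h) ?_⟩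
      rw [← ENNReal.ofReal_natCast]
      exact ENNReal.ofReal_le_ofReal (by simp)
    | succ f ih =>
      obtain ⟨t, ht⟩ := ih
      obtain ⟨t', ht'⟩ := exists_propose i (fun x (s : Fin m → Bool) => ∀ b, ∃ e ∈ D x, s e = b)
        (fun s => .ret s) t
      refine ⟨t', fun v hv => ?_⟩
      refine (ht' v _ 0 _ (1 / 2) le_rfl (by positivity) ?_ (fun s hs => spec_ret hs)
        (ht v hv)).mono (fun _ h => h) (ENNReal.ofReal_le_ofReal (by rw [pow_succ]; ring_nf; rfl))
      rw [one_div_mul_eq_div, le_div_iff₀ two_pos, mul_comm]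
      exact_mod_cast two_mul_card_not_separating_le hv _
  obtain ⟨t, ht⟩ := key N
  refine ⟨t, fun v hv => (ht v hv).mono (fun _ h => h) (ENNReal.ofReal_le_ofReal ?_)⟩
  have : (N : ℝ) ≤ 2 ^ N := by exact_mod_cast N.lt_two_pow_self.le
  have : (N : ℝ) / 2 ^ N ≤ 1 := by rw [div_le_one (by positivity)]; exact this
  linarith

end RTree

/-! ### The upper bound for unit demand valuations. -/

/-- Insertion of agents into a labelling of the items: a label is a bucket that nobody owns yet, or
the agent that owns the item. Labels refine the buckets, the agents below `j` own an item
that they like, and nobody else owns anything. -/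
structure IsLabelling {n m : ℕ} (v : Fin n → Finset (Fin m)) (h : Fin m → Fin n) (j : ℕ)
    (l : Fin m → Fin n ⊕ Fin n) : Prop where
  refines : ∀ x y, l x = l y → h x = h y
  owns : ∀ i : Fin n, i.1 < j → ∃ e ∈ v i, l e = .inr i
  lt : ∀ x i, l x = .inr i → i.1 < j

open Classical in
/-- The labels of items from which a new agent can take a part. -/
def splittable {n m : ℕ} (l : Fin m → Fin n ⊕ Fin n) (T : Finset (Fin m)) :
    Finset (Fin n ⊕ Fin n) :=
  Finset.univ.filter fun p =>
    Sum.elim (fun _ => 1) (fun _ => 2) p ≤ (T.filter fun e => l e = p).card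

/-- The number of pairs of items of `T` in the same bucket. -/
def collisions {n m : ℕ} (h : Fin m → Fin n) (T : Finset (Fin m)) : ℕ :=
  ((T ×ˢ T).filter fun p => h p.1 = h p.2).card

/-- Outside of the splittable labels there are at most `j` items of `T`: none with an unowned label,
and at most one for each of the at most `j` owners. The other `n - j` items have splittable labels,
and Cauchy-Schwarz compares their number with the number of pairs of equal labels, which are
collisions since labels refine buckets. -/
theorem sq_le_card_splittable_mul {n m : ℕ} {v : Fin n → Finset (Fin m)} {h : Fin m → Fin n}
    {j : ℕ} {l : Fin m → Fin n ⊕ Fin n} (hl : IsLabelling v h j l) (hj : j < n)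
    {T : Finset (Fin m)} (hT : T.card = n) :
    (n - j) ^ 2 ≤ (splittable l T).card * collisions h T := by
  classical
  set x : Fin n ⊕ Fin n → ℕ := fun p => (T.filter fun e => l e = p).card
  have h1 : ∑ p, x p = n := by
    exact (Finset.card_eq_sum_card_fiberwise
      fun e _ => Finset.mem_coe.2 (Finset.mem_univ (l e))).symm.trans hT
  have h2 : n - j ≤ ∑ p ∈ splittable l T, x p := by
    have h3 := Finset.sum_add_sum_compl (splittable l T) x
    have h4 : ∑ p ∈ (splittable l T)ᶜ, x p ≤ j := by
      calc ∑ p ∈ (splittable l T)ᶜ, x p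
          ≤ ∑ p ∈ (splittable l T)ᶜ, Sum.elim (fun _ => 0) (fun i : Fin n => if i.1 < j then 1 else 0) p := by
            refine Finset.sum_le_sum fun p hp => ?_
            have hp' : x p < Sum.elim (fun _ => 1) (fun _ => 2) p := by
              simpa [splittable] using hp
            rcases p with b | i
            · simpa using hp'
            · simp only [Sum.elim_inr] at hp' ⊢
              split_ifs with hi
              · omega
              · refine (Finset.card_eq_zero.2 (Finset.filter_eq_empty_iff.2 fun e _ he => ?_)).le
                exact hi (hl.lt e i he)
        _ ≤ ∑ p, Sum.elim (fun _ => 0) (fun i : Fin n => if i.1 < j then 1 else 0) p :=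
            Finset.sum_le_sum_of_subset (Finset.subset_univ _)
        _ = (Finset.univ.filter fun i : Fin n => i.1 < j).card := by
            rw [Fintype.sum_sum_type]; simp
        _ ≤ (Finset.range j).card := by
            refine Finset.card_le_card_of_injOn (fun i => i.1) ?_ fun i _ i' _ h => Fin.ext h
            intro i hi
            simpa using hi
        _ = j := Finset.card_range j
    omega
  have h5 : ∑ p, x p ^ 2 ≤ collisions h T := by
    have h6 : ∑ p, x p ^ 2 = ((T ×ˢ T).filter fun q => l q.1 = l q.2).card := by
      rw [Finset.card_eq_sum_card_fiberwise (f := fun q => l q.1)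
        (t := (Finset.univ : Finset (Fin n ⊕ Fin n))) fun q _ => Finset.mem_coe.2 (Finset.mem_univ _)]
      refine Finset.sum_congr rfl fun p _ => ?_
      rw [sq, ← Finset.card_product]
      congr 1
      ext ⟨a, b⟩
      simp only [Finset.mem_product, Finset.mem_filter]
      constructor
      · rintro ⟨⟨h1, h2⟩, h3, h4⟩; exact ⟨⟨⟨h1, h3⟩, h2.trans h4.symm⟩, h2⟩
      · rintro ⟨⟨⟨h1, h3⟩, h2⟩, h4⟩; exact ⟨⟨h1, h4⟩, h3, h2 ▸ h4⟩
    rw [h6]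
    refine Finset.card_le_card fun q hq => ?_
    obtain ⟨h7, h8⟩ := Finset.mem_filter.1 hq
    exact Finset.mem_filter.2 ⟨h7, hl.refines _ _ h8⟩
  calc (n - j) ^ 2 ≤ (∑ p ∈ splittable l T, x p) ^ 2 := Nat.pow_le_pow_left h2 2
    _ ≤ (splittable l T).card * ∑ p ∈ splittable l T, x p ^ 2 := sq_sum_le_card_mul_sum_sq
    _ ≤ (splittable l T).card * ∑ p, x p ^ 2 :=
        Nat.mul_le_mul_left _ (Finset.sum_le_sum_of_subset (Finset.subset_univ _))
    _ ≤ _ := Nat.mul_le_mul_left _ h5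

/-- This covers both kinds of insertion: taking a whole unowned label, and taking one side of a cut
of an owned label, where `hp` says that the owner keeps a liked item. -/
theorem IsLabelling.take {n m : ℕ} {v : Fin n → Finset (Fin m)} {h : Fin m → Fin n}
    {j : ℕ} {l : Fin m → Fin n ⊕ Fin n} (hl : IsLabelling v h j l) (hj : j < n)
    {P : Fin m → Prop} [DecidablePred P] {p : Fin n ⊕ Fin n} (hP : ∀ e, P e → l e = p)
    (hi : ∃ e ∈ v ⟨j, hj⟩, P e) (hp : ∀ i, p = .inr i → ∃ e ∈ v i, l e = p ∧ ¬ P e) :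
    IsLabelling v h (j + 1) fun e => if P e then .inr ⟨j, hj⟩ else l e where
  refines x y hxy := by
    have hlt : ∀ z, l z ≠ .inr ⟨j, hj⟩ := fun z hz => absurd (hl.lt z _ hz) (lt_irrefl j)
    by_cases hx : P x <;> by_cases hy : P y <;> simp only [hx, hy, if_true, if_false] at hxy
    · exact hl.refines _ _ ((hP x hx).trans (hP y hy).symm)
    · exact absurd hxy.symm (hlt y)
    · exact absurd hxy (hlt x)
    · exact hl.refines _ _ hxy
  owns i hij := by
    by_cases h1 : i.1 < j
    · by_cases h2 : p = .inr i
      · obtain ⟨e, he, h3, h4⟩ := hp i h2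
        exact ⟨e, he, by simp [h4, h3, h2]⟩
      · obtain ⟨e, he, h3⟩ := hl.owns i h1
        refine ⟨e, he, ?_⟩
        have : ¬ P e := fun h4 => h2 ((hP e h4).symm.trans h3)
        simp [this, h3]
    · have : i = ⟨j, hj⟩ := Fin.ext (by simp; omega)
      subst this
      obtain ⟨e, he, h3⟩ := hi
      exact ⟨e, he, by simp [h3]⟩
  lt x i hx := by
    by_cases h1 : P x
    · simp only [h1, if_true, Sum.inr.injEq] at hx
      subst hx; simp
    · simp only [h1, if_false] at hx
      exact (hl.lt x i hx).trans (Nat.lt_succ_self j)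

/-- The newcomer names one of her splittable labels. If it is unowned, she takes all of it. If it is
owned, she likes two of its items; a public cut separates them, the owner chooses a side on which
she likes an item, and the newcomer is satisfied with either of the sides. -/
theorem exists_insert {n m : ℕ} (h : Fin m → Fin n) {j : ℕ} (hj : j < n)
    (l : Fin m → Fin n ⊕ Fin n) :
    ∃ t : RTree (Finset (Fin m)) n (Fin m → Fin n ⊕ Fin n), ∀ (v : Fin n → Finset (Fin m)) (r : ℕ),
      IsLabelling v h j l → (splittable l (v ⟨j, hj⟩)).Nonempty →
      n + n ≤ (splittable l (v ⟨j, hj⟩)).card * 2 ^ r →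
      t.Spec v (IsLabelling v h (j + 1)) (ENNReal.ofReal (2 * r + 7)) := by
  classical
  set i : Fin n := ⟨j, hj⟩
  have : Nonempty (Fin n) := ⟨i⟩
  obtain ⟨t₁, ht₁⟩ := RTree.exists_name i (splittable l)
  have h1 : ∀ p, ∃ t : RTree (Finset (Fin m)) n (Fin m → Fin n ⊕ Fin n),
      ∀ v : Fin n → Finset (Fin m), IsLabelling v h j l → p ∈ splittable l (v i) →
      t.Spec v (IsLabelling v h (j + 1)) (ENNReal.ofReal 4) := by
    rintro (b | i')
    · refine ⟨.ret fun e => if l e = .inl b then .inr i else l e, fun v hl hp => RTree.spec_ret ?_⟩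
      refine hl.take hj (fun e he => he) ?_ (by simp)
      have hp' : 1 ≤ ((v i).filter fun e => l e = .inl b).card := by simpa [splittable] using hp
      obtain ⟨e, he⟩ := Finset.card_pos.1 hp'
      exact ⟨e, Finset.mem_filter.1 he⟩
    · obtain ⟨t₂, ht₂⟩ := RTree.exists_cut i fun T : Finset (Fin m) =>
        T.filter fun e => l e = .inr i'
      refine ⟨t₂.bind fun s => .ask i' (fun T => decide (∃ e ∈ T, l e = .inr i' ∧ s e = true))
        fun c => .ret fun e => if l e = .inr i' ∧ s e ≠ c then .inr i else l e, fun v hl hp => ?_⟩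
      have hp' : 2 ≤ ((v i).filter fun e => l e = .inr i').card := by simpa [splittable] using hp
      have e4 : ENNReal.ofReal 4 = ENNReal.ofReal 3 + (0 + 1) := by
        rw [zero_add, ← ENNReal.ofReal_one, ← ENNReal.ofReal_add (by norm_num) (by norm_num)]
        norm_num
      rw [e4]
      refine (ht₂ v hp').bind fun s hs => RTree.Spec.ask (RTree.spec_ret ?_)
      refine hl.take hj (p := .inr i') (fun e he => he.1) ?_ ?_
      · obtain ⟨e, he, h2⟩ := hs (!decide (∃ e ∈ v i', l e = .inr i' ∧ s e = true))
        obtain ⟨h3, h4⟩ := Finset.mem_filter.1 he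
        exact ⟨e, h3, h4, by rw [h2]; simp⟩
      · intro i'' hi''
        obtain rfl := Sum.inr_injective hi''
        by_cases hc : ∃ e ∈ v i', l e = .inr i' ∧ s e = true
        · obtain ⟨e, he, h2, h3⟩ := hc
          refine ⟨e, he, h2, ?_⟩
          have : decide (∃ e ∈ v i', l e = .inr i' ∧ s e = true) = true :=
            decide_eq_true ⟨e, he, h2, h3⟩
          rw [this, h3]; simp
        · obtain ⟨x, hx⟩ := Finset.card_pos.1 (two_pos.trans_le hp')
          have hx := hl.lt x i' (Finset.mem_filter.1 hx).2
          obtain ⟨e, he, h2⟩ := hl.owns i' hx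
          refine ⟨e, he, h2, ?_⟩
          rw [decide_eq_false hc]
          have : s e ≠ true := fun h3 => hc ⟨e, he, h2, h3⟩
          simp [this]
  choose t₂ ht₂ using h1
  refine ⟨t₁.bind t₂, fun v r hl hne hr => ?_⟩
  have e7 : ENNReal.ofReal (2 * r + 7) = ENNReal.ofReal (2 * r + 3) + ENNReal.ofReal 4 := by
    rw [← ENNReal.ofReal_add (by positivity) (by norm_num)]; congr 1; ring
  rw [e7]
  exact (ht₁ v r hne (by simpa using hr)).bind fun p hp => ht₂ p v hl hp

/-- The sum is `log₂(nⁿ / n!)`, and `nⁿ / n! ≤ eⁿ`. So although late agents have few labels to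
choose from, the average overhead is constant. -/
theorem sum_logb_div_le (n : ℕ) :
    ∑ j ∈ Finset.range n, Real.logb 2 ((n : ℝ) / (n - j : ℕ)) ≤ 2 * n := by
  have hl := Real.log_two_gt_d9
  rw [← Finset.sum_range_reflect]
  have h1 : ∑ j ∈ Finset.range n, Real.logb 2 ((n : ℝ) / (n - (n - 1 - j) : ℕ)) =
      Real.log ((n : ℝ) ^ n / n.factorial) / Real.log 2 := by
    have e : (n : ℝ) ^ n = ∏ _j ∈ Finset.range n, (n : ℝ) := by simp
    rw [← Finset.prod_range_add_one_eq_factorial, Nat.cast_prod, e, ← Finset.prod_div_distrib,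
      Real.log_prod, Finset.sum_div]
    · refine Finset.sum_congr rfl fun j hj => ?_
      have hj := Finset.mem_range.1 hj
      have : n - (n - 1 - j) = j + 1 := by omega
      rw [this, Real.logb]
    · intro j hj
      have hj := Finset.mem_range.1 hj
      have : (0 : ℝ) < n := by exact_mod_cast (by omega : 0 < n)
      positivity
  rw [h1, div_le_iff₀ (by linarith)]
  rcases Nat.eq_zero_or_pos n with rfl | hn
  · simp
  have hn' : (0 : ℝ) < n := by exact_mod_cast hn
  have h2 := Real.log_le_log (by positivity) (Real.pow_div_factorial_le_exp _ hn'.le n)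
  rw [Real.log_exp] at h2
  nlinarith

/-- With `S` collisions, agent `j` can use at least `(n-j)²/S` of the `2n` labels, so naming one
costs about `2 log₂(2nS/(n-j)²)` bits. The part `log₂(S/n)` is bounded linearly in `S/n`, so that
only the expected number of collisions over the random buckets is needed later. -/
theorem exists_labelling {n m : ℕ} (h : Fin m → Fin n) (k : ℕ) (hk : k ≤ n) :
    ∃ t : RTree (Finset (Fin m)) n (Fin m → Fin n ⊕ Fin n), ∀ v : Fin n → Finset (Fin m),
      (∀ i, (v i).card = n) → t.Spec v (IsLabelling v h k) (ENNReal.ofReal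
        (∑ j ∈ Finset.range k, (11 + 4 * (if hj : j < n then (collisions h (v ⟨j, hj⟩) : ℝ) else 0) / n
          + 4 * Real.logb 2 ((n : ℝ) / (n - j : ℕ))))) := by
  induction k with
  | zero =>
    exact ⟨.ret fun e => .inl (h e), fun v _ => RTree.spec_ret
      ⟨fun x y hxy => by simpa using hxy, fun i hi => by omega, fun x i hx => by simp at hx⟩⟩
  | succ k ih =>
    obtain ⟨t, ht⟩ := ih (by omega)
    have hk' : k < n := by omega
    choose t₂ ht₂ using exists_insert h hk'
    refine ⟨t.bind t₂, fun v hv => ?_⟩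
    have hn' : (0 : ℝ) < n := by exact_mod_cast (by omega : 0 < n)
    have hnk : (0 : ℝ) < (n - k : ℕ) := by exact_mod_cast (by omega : 0 < n - k)
    have hnk' : ((n - k : ℕ) : ℝ) ≤ n := by exact_mod_cast Nat.sub_le n k
    have hlog : ∀ j ∈ Finset.range n, 0 ≤ Real.logb 2 ((n : ℝ) / (n - j : ℕ)) := by
      intro j hj
      have hj := Finset.mem_range.1 hj
      refine Real.logb_nonneg one_lt_two ?_
      rw [one_le_div (by exact_mod_cast (by omega : 0 < n - j))]
      exact_mod_cast Nat.sub_le n j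
    rw [Finset.sum_range_succ, ENNReal.ofReal_add]
    · refine (ht v hv).bind fun l hl => ?_
      set S := collisions h (v ⟨k, hk'⟩)
      -- The diagonal pairs count as collisions; thus `S/n ≥ 1` and the logarithms below are
      -- nonnegative.
      have hS : n ≤ S := by
        rw [← hv ⟨k, hk'⟩, ← Finset.diag_card]
        refine Finset.card_le_card fun p hp => ?_
        obtain ⟨h1, h2⟩ := Finset.mem_diag.1 hp
        exact Finset.mem_filter.2 ⟨Finset.mem_product.2 ⟨h1, h2 ▸ h1⟩, by rw [h2]⟩
      have hS' : (n : ℝ) ≤ S := by exact_mod_cast hS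
      set q : ℝ := 2 * n * S / (n - k : ℕ) ^ 2
      set r := ⌈Real.logb 2 q⌉₊
      have hq1 : 1 ≤ q := by
        rw [one_le_div (by positivity)]
        nlinarith
      have hqr : q ≤ 2 ^ r := by
        rw [← Real.rpow_natCast, ← Real.logb_le_iff_le_rpow one_lt_two (by linarith)]
        exact Nat.le_ceil _
      have h1 := sq_le_card_splittable_mul hl hk' (hv ⟨k, hk'⟩)
      have h1' : ((n - k : ℕ) : ℝ) ^ 2 ≤ (splittable l (v ⟨k, hk'⟩)).card * S := by
        exact_mod_cast h1
      refine (ht₂ l v r hl ?_ ?_).mono (fun _ h => h) (ENNReal.ofReal_le_ofReal ?_)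
      · rw [← Finset.card_pos]
        have : 0 < (n - k) ^ 2 := Nat.pow_pos (by omega)
        exact Nat.pos_of_mul_pos_right (this.trans_le h1)
      · have hS0 : (0 : ℝ) < S := by linarith
        have : (n : ℝ) + n ≤ (splittable l (v ⟨k, hk'⟩)).card * 2 ^ r := by
          have h2 : 2 * (n : ℝ) * S ≤ 2 ^ r * (n - k : ℕ) ^ 2 := by
            rwa [div_le_iff₀ (by positivity)] at hqr
          refine le_of_mul_le_mul_right ?_ hS0
          have h3 : (0 : ℝ) < 2 ^ r := by positivity
          nlinarith
        exact_mod_cast this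
      · have h2 : (r : ℝ) < Real.logb 2 q + 1 := Nat.ceil_lt_add_one (Real.logb_nonneg one_lt_two hq1)
        have h3 : Real.logb 2 q = 1 + Real.logb 2 (S / n) + 2 * Real.logb 2 ((n : ℝ) / (n - k : ℕ)) := by
          have : q = 2 * ((S / n) * ((n : ℝ) / (n - k : ℕ)) ^ 2) := by
            simp only [q]; field_simp
          have hS0 : (0 : ℝ) < S := by linarith
          rw [this, Real.logb_mul (by norm_num) (by positivity), Real.logb_mul (by positivity)
            (by positivity), Real.logb_pow]
          simp
          ring
        have h4 : Real.logb 2 (S / n) ≤ 2 * (S / n) - 2 := by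
          have hl := Real.log_two_gt_d9
          have h5 := Real.log_le_sub_one_of_pos (x := (S : ℝ) / n) (by
            have : (0 : ℝ) < S := by linarith
            positivity)
          have h6 : 1 ≤ (S : ℝ) / n := by rw [one_le_div hn']; exact hS'
          rw [Real.logb, div_le_iff₀ (by linarith)]
          nlinarith
        rw [dif_pos hk', mul_div_assoc]
        linarith
    · refine Finset.sum_nonneg fun j hj => ?_
      have := hlog j (Finset.mem_range.2 (by have := Finset.mem_range.1 hj; omega))
      split_ifs <;> positivity
    · have := hlog k (Finset.mem_range.2 hk')
      rw [dif_pos hk']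
      positivity

/-- The `n` diagonal pairs always collide, every other pair with probability `1/n`. -/
theorem expect_collisions_le {n m : ℕ} (hn : 0 < n) {T : Finset (Fin m)} (hT : T.card = n) :
    (Finset.univ.expect fun h : Fin m → Fin n => (collisions h T : ℝ)) ≤ 2 * n := by
  classical
  have : Nonempty (Fin n) := ⟨⟨0, hn⟩⟩
  have hn' : (0 : ℝ) < n := by exact_mod_cast hn
  have h1 : ∀ h : Fin m → Fin n, (collisions h T : ℝ) =
      ∑ p ∈ T ×ˢ T, if h p.1 = h p.2 then (1 : ℝ) else 0 := by
    intro h; rw [collisions, Finset.sum_boole]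
  simp_rw [h1]
  rw [Finset.expect_sum_comm]
  have h2 : ∀ p ∈ T ×ˢ T, (Finset.univ.expect fun h : Fin m → Fin n =>
      if h p.1 = h p.2 then (1 : ℝ) else 0) ≤ (if p.1 = p.2 then 1 else 0) + 1 / n := by
    rintro ⟨x, y⟩ -
    by_cases hxy : x = y
    · subst hxy
      simp
    · rw [← expect_update _ x]
      simp only [Function.update_self, Function.update_of_ne (Ne.symm hxy), hxy, if_false]
      simp
  refine (Finset.sum_le_sum h2).trans ?_
  rw [Finset.sum_add_distrib, Finset.sum_boole, Finset.sum_const, Finset.card_product, hT]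
  have h3 : ((T ×ˢ T).filter fun p => p.1 = p.2).card = n := by
    rw [← hT, ← Finset.diag_card T]
    congr 1
    ext p
    simp only [Finset.mem_filter, Finset.mem_product, Finset.mem_diag]
    exact ⟨fun h => ⟨h.1.1, h.2⟩, fun h => ⟨⟨h.1, h.2 ▸ h.1⟩, h.2⟩⟩
  rw [h3, nsmul_eq_mul]
  push_cast
  have : (n : ℝ) * n * (1 / n) = n := by field_simp
  rw [this]; linarith

/-- The private information used for unit demand valuations: `n` items that are worth the maximin
share. -/
def shareItems (n : ℕ) {m : ℕ} (v : Valuation m) : Finset (Fin m) :=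
  Classical.epsilon fun T => T.card = n ∧ ∀ e ∈ T, mms n v ≤ v {e}

/-- An optimal partition provides one such item in each bundle; if the maximin share is `0`, any `n`
items do. -/
theorem shareItems_spec {n m : ℕ} (hn : 0 < n) (hm : n ≤ m) {v : Valuation m}
    (hv : IsUnitDemand v) :
    (shareItems n v).card = n ∧ ∀ e ∈ shareItems n v, mms n v ≤ v {e} := by
  classical
  refine Classical.epsilon_spec (p := fun T : Finset (Fin m) => T.card = n ∧ ∀ e ∈ T, mms n v ≤ v {e}) ?_
  have : Nonempty (Fin n) := ⟨⟨0, hn⟩⟩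
  by_cases h0 : mms n v = 0
  · exact ⟨firstItems m n, card_firstItems hm, fun e _ => by rw [h0]; exact zero_le⟩
  · obtain ⟨P, hP⟩ := exists_eq_ciSup_of_finite (f := fun P : Allocation n m => ⨅ i, v (bundle P i))
    have h1 : ∀ i, ∃ e ∈ bundle P i, mms n v ≤ v {e} := by
      intro i
      have h2 : mms n v ≤ v (bundle P i) := by
        have : mms n v = ⨅ i, v (bundle P i) := hP.symm
        rw [this]
        exact ciInf_le (Set.finite_range _).bddBelow i
      have h3 : (bundle P i).Nonempty := by
        rw [Finset.nonempty_iff_ne_empty]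
        intro h4
        rw [h4, hv ∅] at h2
        exact h0 (le_antisymm (by simpa using h2) zero_le)
      obtain ⟨e, he, h4⟩ := Finset.exists_mem_eq_sup _ h3 fun e => v {e}
      rw [hv, h4] at h2
      exact ⟨e, he, h2⟩
    choose f hf hf' using h1
    refine ⟨Finset.univ.image f, ?_, ?_⟩
    · rw [Finset.card_image_of_injective, Finset.card_univ, Fintype.card_fin]
      intro i j hij
      have h2 := (Finset.mem_filter.1 (hf i)).2
      have h3 := (Finset.mem_filter.1 (hf j)).2
      rw [← h2, ← h3, hij]
    · intro e he
      obtain ⟨i, -, rfl⟩ := Finset.mem_image.1 he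
      exact hf' i

/-- The constant is `11 + 4·2 + 4·2`: the fixed cost of an insertion, the collisions and the
logarithms. -/
theorem unitDemand_upper {n m : ℕ} (hn : 1 ≤ n) (hm : 2 * n ≤ m) :
    arcc (unitDemandInstances n m) ≤ ENNReal.ofReal 27 := by
  classical
  have hn' : (0 : ℝ) < n := by exact_mod_cast hn
  have : Nonempty (Fin n) := ⟨⟨0, hn⟩⟩
  choose t ht using fun h : Fin m → Fin n => exists_labelling h n le_rfl
  have key : rcc (unitDemandInstances n m) ≤ ENNReal.ofReal (27 * n) := by
    refine rcc_le (shareItems n) _ (RTree.coinOver fun h => (t h).bind fun l =>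
      .ret fun e => Sum.elim id id (l e)) _ ENNReal.ofReal_ne_top fun v hv => ?_
    have h1 := fun i => shareItems_spec hn (by omega) (hv i)
    refine (RTree.Spec.coinOver_ofReal (Q := IsMMSAllocation v) (c := fun h => ∑ j ∈ Finset.range n,
      (11 + 4 * (if hj : j < n then (collisions h (shareItems n (v ⟨j, hj⟩)) : ℝ) else 0) / n
          + 4 * Real.logb 2 ((n : ℝ) / (n - j : ℕ)))) (fun h => ?_) fun h => ?_).mono
      (fun _ h => h) (ENNReal.ofReal_le_ofReal ?_)
    · refine Finset.sum_nonneg fun j hj => ?_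
      have hj := Finset.mem_range.1 hj
      have : 0 ≤ Real.logb 2 ((n : ℝ) / (n - j : ℕ)) := by
        refine Real.logb_nonneg one_lt_two ?_
        rw [one_le_div (by exact_mod_cast (by omega : 0 < n - j))]
        exact_mod_cast Nat.sub_le n j
      split_ifs <;> positivity
    · rw [← add_zero (ENNReal.ofReal _)]
      refine (ht h (fun i => shareItems n (v i)) fun i => (h1 i).1).bind fun l hl =>
        RTree.spec_ret fun i => ?_
      obtain ⟨e, he, h2⟩ := hl.owns i i.2
      refine ((h1 i).2 e he).trans ?_
      rw [hv i (bundle _ i)]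
      exact Finset.le_sup (f := fun e => v i {e})
        (Finset.mem_filter.2 ⟨Finset.mem_univ _, by simp [h2]⟩)
    · rw [Finset.expect_sum_comm]
      have h2 : ∀ j ∈ Finset.range n, (Finset.univ.expect fun h : Fin m → Fin n =>
          (11 + 4 * (if hj : j < n then (collisions h (shareItems n (v ⟨j, hj⟩)) : ℝ) else 0) / n
          + 4 * Real.logb 2 ((n : ℝ) / (n - j : ℕ)))) ≤
          19 + 4 * Real.logb 2 ((n : ℝ) / (n - j : ℕ)) := by
        intro j hj
        have hj := Finset.mem_range.1 hj
        simp only [hj, dif_pos]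
        rw [Finset.expect_add_distrib, Finset.expect_add_distrib, Fintype.expect_const,
          Fintype.expect_const, ← Finset.expect_div, ← Finset.mul_expect]
        have h3 := expect_collisions_le hn (h1 ⟨j, hj⟩).1
        have : 4 * (Finset.univ.expect fun h : Fin m → Fin n =>
            (collisions h (shareItems n (v ⟨j, hj⟩)) : ℝ)) / n ≤ 8 := by
          rw [div_le_iff₀ hn']; linarith
        linarith
      refine (Finset.sum_le_sum h2).trans ?_
      rw [Finset.sum_add_distrib, ← Finset.mul_sum]
      have := sum_logb_div_le n
      simp only [Finset.sum_const, Finset.card_range, nsmul_eq_mul]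
      linarith
  unfold arcc
  refine ENNReal.div_le_of_le_mul (key.trans (le_of_eq ?_))
  rw [ENNReal.ofReal_mul (by norm_num), ENNReal.ofReal_natCast]

/-! ### Quickselect and the halving procedure. -/

namespace RTree

variable {X : Type} {n : ℕ} {α : Type}

/-- All agents of a set answer a question. -/
theorem exists_askAll (V : Finset (Fin n)) (q : Fin n → X → Prop) [∀ i x, Decidable (q i x)] :
    ∃ t : RTree X n (Finset (Fin n)), ∀ v : Fin n → X,
      t.Spec v (fun S => S = V.filter fun i => q i (v i)) (V.card : ℝ≥0∞) := by
  induction V using Finset.induction_on with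
  | empty => exact ⟨.ret ∅, fun v => spec_ret (by simp)⟩
  | insert i V hi ih =>
    obtain ⟨t, ht⟩ := ih
    refine ⟨t.bind fun S => .ask i (fun x => decide (q i x)) fun b =>
      .ret (if b then insert i S else S), fun v => ?_⟩
    rw [Finset.card_insert_of_notMem hi]
    have : ((V.card + 1 : ℕ) : ℝ≥0∞) = V.card + (0 + 1) := by push_cast; ring
    rw [this]
    refine (ht v).bind fun S hS => Spec.ask (spec_ret ?_)
    subst hS
    rw [Finset.filter_insert]
    by_cases h : q i (v i) <;> simp [h]

end RTree

/-- By asymmetry at most half of the pairs within `S` are related; the pairs from `S` to its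
complement are counted trivially. -/
theorem two_mul_sum_card_filter_le {ι : Type} (S V : Finset ι) (hS : S ⊆ V) (r : ι → ι → Prop)
    [DecidableRel r] (hr : ∀ x y, r x y → ¬ r y x) :
    2 * ∑ x ∈ S, ((V.filter fun y => r x y).card : ℝ) ≤ 2 * S.card * V.card - S.card ^ 2 := by
  classical
  have h1 : ∀ x ∈ S, (V.filter fun y => r x y).card ≤
      (S.filter fun y => r x y).card + (V \ S).card := by
    intro x _
    refine (Finset.card_le_card (t := (S.filter fun y => r x y) ∪ (V \ S)) ?_).trans
      (Finset.card_union_le _ _)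
    intro y hy
    have := Finset.mem_filter.1 hy
    by_cases h : y ∈ S
    · exact Finset.mem_union_left _ (Finset.mem_filter.2 ⟨h, this.2⟩)
    · exact Finset.mem_union_right _ (Finset.mem_sdiff.2 ⟨this.1, h⟩)
  have h2 := Finset.sum_le_sum h1
  rw [Finset.sum_add_distrib, Finset.sum_const, smul_eq_mul, Finset.card_sdiff_of_subset hS] at h2
  have h3 : 2 * ∑ x ∈ S, (S.filter fun y => r x y).card ≤ S.card ^ 2 := by
    have e1 : ∑ x ∈ S, (S.filter fun y => r x y).card =
        ((S ×ˢ S).filter fun p => r p.1 p.2).card := by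
      simp only [Finset.card_filter, Finset.sum_product]
    have e2 : ((S ×ˢ S).filter fun p => r p.1 p.2).card =
        ((S ×ˢ S).filter fun p => r p.2 p.1).card := by
      refine Finset.card_bij (fun p _ => p.swap) ?_ (fun _ _ _ _ h => Prod.swap_injective h) ?_
      · rintro ⟨x, y⟩ h
        simp only [Finset.mem_filter, Finset.mem_product, Prod.swap] at h ⊢
        tauto
      · rintro ⟨x, y⟩ h
        refine ⟨(y, x), ?_, rfl⟩
        simp only [Finset.mem_filter, Finset.mem_product] at h ⊢
        tauto
    have e3 : ((S ×ˢ S).filter fun p => r p.1 p.2).card +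
        ((S ×ˢ S).filter fun p => r p.2 p.1).card ≤ (S ×ˢ S).card := by
      rw [← Finset.card_union_of_disjoint]
      · exact Finset.card_le_card (Finset.union_subset (Finset.filter_subset _ _)
          (Finset.filter_subset _ _))
      · rw [Finset.disjoint_filter]
        exact fun p _ h => hr _ _ h
    rw [Finset.card_product] at e3
    rw [e1, sq]
    omega
  have h4 := Finset.card_le_card hS
  have h5 : ((∑ x ∈ S, (V.filter fun y => r x y).card : ℕ) : ℝ) ≤
      ((∑ x ∈ S, (S.filter fun y => r x y).card : ℕ) : ℝ) + S.card * (V.card - S.card) := by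
    rw [← Nat.cast_sub h4]; exact_mod_cast h2
  have h6 : 2 * ((∑ x ∈ S, (S.filter fun y => r x y).card : ℕ) : ℝ) ≤ (S.card : ℝ) ^ 2 := by
    exact_mod_cast h3
  push_cast at h5 h6
  nlinarith

/-- The number of elements that remain to be searched after quickselect for rank `a` compared
all elements with the pivot `π`. -/
def searchSize {ι : Type} (V : Finset ι) (x : ι → ℕ) (a : ℕ) (π : ι) : ℕ :=
  if a < (V.filter fun i => x i < x π).card then (V.filter fun i => x i < x π).card
  else if (V.filter fun i => x i ≤ x π).card < a then (V.filter fun i => x π < x i).card else 0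

/-- Let `h` pivots be too high and `l` too low, so `h + l ≤ |V|`. The preceding estimate bounds the
sum by `(h+l)|V| - (h²+l²)/2`, which is at most `3/4 |V|²`, with equality for `h = l = |V|/2`. -/
theorem sum_searchSize_le {ι : Type} (V : Finset ι) (x : ι → ℕ) (a : ℕ) :
    ∑ π ∈ V, (searchSize V x a π : ℝ) ≤ 3 / 4 * (V.card : ℝ) ^ 2 := by
  classical
  set H := V.filter fun π => a < (V.filter fun i => x i < x π).card
  set L := V.filter fun π => (V.filter fun i => x i ≤ x π).card < a
  have h1 := two_mul_sum_card_filter_le H V (Finset.filter_subset _ _) (fun π i => x i < x π)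
    fun _ _ h h' => absurd (h.trans h') (lt_irrefl _)
  have h2 := two_mul_sum_card_filter_le L V (Finset.filter_subset _ _) (fun π i => x π < x i)
    fun _ _ h h' => absurd (h.trans h') (lt_irrefl _)
  have h3 : H.card + L.card ≤ V.card := by
    rw [← Finset.card_union_of_disjoint]
    · exact Finset.card_le_card (Finset.union_subset (Finset.filter_subset _ _)
        (Finset.filter_subset _ _))
    · rw [Finset.disjoint_filter]
      intro π _ h4 h5
      have : (V.filter fun i => x i < x π).card ≤ (V.filter fun i => x i ≤ x π).card :=
        Finset.card_le_card (Finset.monotone_filter_right _ fun i _ h => le_of_lt h)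
      omega
  have h4 : ∑ π ∈ V, (searchSize V x a π : ℝ) ≤
      ∑ π ∈ H, ((V.filter fun i => x i < x π).card : ℝ) +
      ∑ π ∈ L, ((V.filter fun i => x π < x i).card : ℝ) := by
    rw [Finset.sum_filter, Finset.sum_filter, ← Finset.sum_add_distrib]
    refine Finset.sum_le_sum fun π _ => ?_
    unfold searchSize
    split_ifs <;> simp
  have h5 : (H.card : ℝ) + L.card ≤ V.card := by exact_mod_cast h3
  have h6 : (0 : ℝ) ≤ H.card := by positivity
  have h7 : (0 : ℝ) ≤ L.card := by positivity
  nlinarith [sq_nonneg ((H.card : ℝ) - L.card), sq_nonneg ((H.card : ℝ) + L.card - V.card)]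

/-- Quickselect: the agents find a threshold of a prescribed rank. -/
theorem exists_select {X : Type} {n : ℕ} (x : X → ℕ) {B : ℕ} (hx : ∀ T, x T < 2 ^ B) :
    ∀ (u : ℕ) (V : Finset (Fin n)), V.card = u → ∀ a ≤ u, 0 < u →
    ∃ t : RTree X n (ℕ × Finset (Fin n)), ∀ v : Fin n → X,
      t.Spec v (fun r => r.2 ⊆ V ∧ r.2.card = a ∧ (∀ i ∈ r.2, x (v i) ≤ r.1) ∧
        ∀ i ∈ V, i ∉ r.2 → r.1 ≤ x (v i)) (ENNReal.ofReal (8 * u + 8 * B * √u)) := by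
  classical
  intro u
  induction u using Nat.strong_induction_on with
  | _ u ih =>
  intro V hV a ha hu
  have hVne : V.Nonempty := Finset.card_pos.1 (by omega)
  have : Nonempty V := hVne.to_subtype
  have hrec : ∀ (W : Finset (Fin n)) (c : ℕ), ∃ t : RTree X n (ℕ × Finset (Fin n)),
      W.card < u → c ≤ W.card → 0 < W.card → ∀ v : Fin n → X,
      t.Spec v (fun r => r.2 ⊆ W ∧ r.2.card = c ∧ (∀ i ∈ r.2, x (v i) ≤ r.1) ∧
        ∀ i ∈ W, i ∉ r.2 → r.1 ≤ x (v i)) (ENNReal.ofReal (8 * W.card + 8 * B * √W.card)) := by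
    intro W c
    by_cases h : W.card < u ∧ c ≤ W.card ∧ 0 < W.card
    · obtain ⟨t, ht⟩ := ih W.card h.1 W rfl c h.2.1 h.2.2
      exact ⟨t, fun _ _ _ => ht⟩
    · exact ⟨.ret (0, ∅), fun h1 h2 h3 => absurd ⟨h1, h2, h3⟩ h⟩
  choose rec hrec using hrec
  have hann : ∀ π : Fin n, ∃ t : RTree X n ℕ, ∀ v : Fin n → X,
    t.Spec v (fun p => p = x (v π)) B := fun π => RTree.exists_askNat π B x hx
  choose ann hann using hann
  have hlt : ∀ p : ℕ, ∃ t : RTree X n (Finset (Fin n)), ∀ v : Fin n → X,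
    t.Spec v (fun S => S = V.filter fun i => x (v i) < p) (V.card : ℝ≥0∞) :=
    fun p => RTree.exists_askAll V fun _ T => x T < p
  choose lt hlt using hlt
  have hle : ∀ p : ℕ, ∃ t : RTree X n (Finset (Fin n)), ∀ v : Fin n → X,
    t.Spec v (fun S => S = V.filter fun i => x (v i) ≤ p) (V.card : ℝ≥0∞) :=
    fun p => RTree.exists_askAll V fun _ T => x T ≤ p
  choose le hle using hle
  have hmid : ∀ L E : Finset (Fin n), ∃ S : Finset (Fin n), L ⊆ E → L.card ≤ a → a ≤ E.card →
      L ⊆ S ∧ S ⊆ E ∧ S.card = a := by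
    intro L E
    by_cases h : L ⊆ E ∧ L.card ≤ a ∧ a ≤ E.card
    · obtain ⟨S, h1, h2, h3⟩ := Finset.exists_subsuperset_card_eq h.1 h.2.1 h.2.2
      exact ⟨S, fun _ _ _ => ⟨h1, h2, h3⟩⟩
    · exact ⟨∅, fun h1 h2 h3 => absurd ⟨h1, h2, h3⟩ h⟩
  choose mid hmid using hmid
  -- A random pivot announces her value; the others compare with it twice, so that `L` are the
  -- agents strictly below and `E` those at most equal. The search continues in `L`, in the
  -- complement of `E`, or ends with the pivot's value.
  refine ⟨RTree.coinOver fun π : V => (ann π).bind fun p => (lt p).bind fun L => (le p).bind fun E =>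
    if a < L.card then rec L a else if E.card < a then
      (rec (V \ E) (a - E.card)).bind fun r => .ret (r.1, E ∪ r.2)
    else .ret (p, mid L E), fun v => ?_⟩
  set s : V → ℕ := fun π => searchSize V (fun i => x (v i)) a π
  have hspec := RTree.Spec.coinOver_ofReal (v := v) (Q := fun r : ℕ × Finset (Fin n) =>
      r.2 ⊆ V ∧ r.2.card = a ∧ (∀ i ∈ r.2, x (v i) ≤ r.1) ∧ ∀ i ∈ V, i ∉ r.2 → r.1 ≤ x (v i))
    (next := fun π : V => (ann π).bind fun p => (lt p).bind fun L => (le p).bind fun E =>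
      if a < L.card then rec L a else if E.card < a then
        (rec (V \ E) (a - E.card)).bind fun r => .ret (r.1, E ∪ r.2)
      else .ret (p, mid L E))
    (c := fun π => B + (u + (u + (8 * s π + 8 * B * √(s π))))) (fun π => by positivity)
    (fun π => by
      rw [ENNReal.ofReal_add (by positivity) (by positivity), ENNReal.ofReal_natCast]
      refine (hann π v).bind fun p hp => ?_
      rw [ENNReal.ofReal_add (by positivity) (by positivity), ENNReal.ofReal_natCast, ← hV]
      refine (hlt p v).bind fun L hL => ?_
      rw [ENNReal.ofReal_add (by positivity) (by positivity), ENNReal.ofReal_natCast]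
      refine (hle p v).bind fun E hE => ?_
      have hπL : π.1 ∉ L := by rw [hL, Finset.mem_filter, hp]; simp
      have hπE : π.1 ∈ E := by rw [hE, Finset.mem_filter, hp]; exact ⟨π.2, le_rfl⟩
      have hLV : L ⊆ V := by rw [hL]; exact Finset.filter_subset _ _
      have hEV : E ⊆ V := by rw [hE]; exact Finset.filter_subset _ _
      have hEL : V \ E = V.filter fun i => x (v π) < x (v i) := by
        rw [hE, hp]; ext i; simp only [Finset.mem_sdiff, Finset.mem_filter]
        constructor
        · rintro ⟨h1, h2⟩; exact ⟨h1, by by_contra h3; exact h2 ⟨h1, by omega⟩⟩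
        · rintro ⟨h1, h2⟩; exact ⟨h1, fun h3 => by omega⟩
      have hLE : L ⊆ E := by
        rw [hL, hE]; exact Finset.monotone_filter_right _ fun i _ h => le_of_lt h
      by_cases h1 : a < L.card
      · have hs : s π = L.card := by
          simp only [s, searchSize]
          rw [hL, hp] at h1
          rw [if_pos h1, hL, hp]
        rw [if_pos h1, hs]
        refine (hrec L a (hV ▸ Finset.card_lt_card ⟨hLV, fun h => hπL (h π.2)⟩) h1.le (by omega) v).mono
          ?_ le_rfl
        rintro ⟨p', S⟩ ⟨h2, h3, h4, h5⟩
        refine ⟨h2.trans hLV, h3, h4, fun i hi hiS => ?_⟩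
        by_cases hiL : i ∈ L
        · exact h5 i hiL hiS
        · obtain ⟨j, hj, hjS⟩ := Finset.exists_mem_notMem_of_card_lt_card (h3.trans_lt h1)
          have h6 := h5 j hj hjS
          rw [hL, Finset.mem_filter] at hj hiL
          have : p ≤ x (v i) := by by_contra h7; exact hiL ⟨hi, by omega⟩
          exact h6.trans (hj.2.le.trans this)
      · by_cases h2 : E.card < a
        · have hs : s π = (V \ E).card := by
            simp only [s, searchSize]
            rw [hL, hp] at h1
            rw [hE, hp] at h2
            rw [if_neg h1, if_pos h2, hEL]
          rw [if_neg h1, if_pos h2, hs, ← add_zero (ENNReal.ofReal _)]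
          have h0 := Finset.card_sdiff_of_subset hEV
          refine (hrec (V \ E) (a - E.card) ?_ ?_ ?_ v).bind ?_
          · have : 0 < E.card := Finset.card_pos.2 ⟨_, hπE⟩
            omega
          · omega
          · omega
          · rintro ⟨p', S⟩ ⟨h3, h4, h5, h6⟩
            simp only at h3 h4 h5 h6
            have hd : Disjoint E S := by
              rw [Finset.disjoint_left]
              exact fun i hi hiS => (Finset.mem_sdiff.1 (h3 hiS)).2 hi
            refine RTree.spec_ret ⟨Finset.union_subset hEV (h3.trans Finset.sdiff_subset), ?_, ?_, ?_⟩
            · simp only [Finset.card_union_of_disjoint hd]; omega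
            · intro i hi
              rcases Finset.mem_union.1 hi with h7 | h7
              · obtain ⟨j, hj⟩ := Finset.card_pos.1 (show 0 < S.card by omega)
                have h8 := h3 hj
                rw [hEL, Finset.mem_filter, ← hp] at h8
                rw [hE, Finset.mem_filter] at h7
                exact h7.2.trans (h8.2.le.trans (h5 j hj))
              · exact h5 i h7
            · intro i hi hiS
              simp only [Finset.mem_union, not_or] at hiS
              exact h6 i (Finset.mem_sdiff.2 ⟨hi, hiS.1⟩) hiS.2
        · rw [if_neg h1, if_neg h2]
          obtain ⟨h3, h4, h5⟩ := hmid L E hLE (by omega) (by omega)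
          refine RTree.spec_ret ⟨h4.trans hEV, h5, fun i hi => ?_, fun i hi hiS => ?_⟩
          · have := h4 hi
            rw [hE, Finset.mem_filter] at this
            exact this.2
          · by_contra h6
            refine hiS (h3 ?_)
            rw [hL, Finset.mem_filter]
            exact ⟨hi, by simpa using h6⟩)
  refine hspec.mono (fun _ h => h) (ENNReal.ofReal_le_ofReal ?_)
  have hu' : (0 : ℝ) < u := by exact_mod_cast hu
  have hcard : Fintype.card V = u := by rw [Fintype.card_coe, hV]
  have hsum : ∑ π : V, (s π : ℝ) ≤ 3 / 4 * (u : ℝ) ^ 2 := by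
    have := sum_searchSize_le V (fun i => x (v i)) a
    rw [← Finset.sum_coe_sort, hV] at this
    exact this
  -- Cauchy-Schwarz and the factor `3/4` give `√(3/4) < 0.87`. A pivot's `B` bits are charged to
  -- `8B√u`, since `8 · 0.87 + 1 ≤ 8`; the `2u` comparison bits are charged to `8u`, since `8 · 3/4
  -- + 2 = 8`.
  have hsqrt : ∑ π : V, √(s π : ℝ) ≤ 0.87 * u * √u := by
    refine (pow_le_pow_iff_left₀ (Finset.sum_nonneg fun _ _ => Real.sqrt_nonneg _) (by positivity)
      two_ne_zero).1 (sq_sum_le_card_mul_sum_sq.trans ?_)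
    simp only [Real.sq_sqrt (Nat.cast_nonneg _), Finset.card_univ, hcard]
    rw [mul_pow, mul_pow, Real.sq_sqrt hu'.le]
    have : (u : ℝ) * ∑ π : V, (s π : ℝ) ≤ u * (3 / 4 * (u : ℝ) ^ 2) := by gcongr
    have : (0 : ℝ) < u ^ 3 := by positivity
    nlinarith
  rw [Fintype.expect_eq_sum_div_card, hcard, div_le_iff₀ hu']
  simp only [Finset.sum_add_distrib, ← Finset.mul_sum, Finset.sum_const, Finset.card_univ, hcard,
    nsmul_eq_mul]
  have h1 : 1 ≤ √(u : ℝ) := Real.one_le_sqrt.2 (by exact_mod_cast hu)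
  have hB : (0 : ℝ) ≤ B := by positivity
  have h2 : 8 * (B : ℝ) * ∑ π : V, √(s π : ℝ) ≤ 8 * B * (0.87 * u * √u) := by gcongr
  have h3 : (B : ℝ) * u ≤ B * u * √u := le_mul_of_one_le_right (by positivity) h1
  nlinarith

/-- Every agent of `V` has `|V|` shares of liked items in `R`. -/
def HasShares {n m : ℕ} (k : Finset (Fin m) → ℕ) (R : Finset (Fin m)) (V : Finset (Fin n))
    (v : Fin n → Finset (Fin m)) : Prop :=
  ∀ i ∈ V, V.card * k (v i) ≤ (v i ∩ R).card

/-- Every agent of `V` receives a share of liked items of `R`. -/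
def GivesShares {n m : ℕ} (k : Finset (Fin m) → ℕ) (R : Finset (Fin m)) (V : Finset (Fin n))
    (v : Fin n → Finset (Fin m)) (A : Fin m → Fin n) : Prop :=
  ∀ i ∈ V, k (v i) ≤ ((v i ∩ R).filter fun e => A e = i).card

/-- For nearly equal parts `a + b = u`, the geometric mean `√(ab)` is at least `0.45u`, the worst
case being `u = 3`; this is then squared. -/
theorem sqrt_half_add_sqrt_half_le {u : ℕ} (hu : 2 ≤ u) :
    1.36 * √(u : ℝ) ≤ √((u / 2 : ℕ) : ℝ) + √((u - u / 2 : ℕ) : ℝ) := by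
  set a := u / 2
  obtain ⟨b, hb⟩ : ∃ b, u - a = b := ⟨_, rfl⟩
  have hab : (u : ℝ) = a + b := by exact_mod_cast (by omega : u = a + b)
  have hb' : b = a ∨ b = a + 1 := by omega
  have ha : (1 : ℝ) ≤ a := by exact_mod_cast (by omega : 1 ≤ a)
  rw [hb]
  have h1 : 0.45 * (u : ℝ) ≤ √(a : ℝ) * √(b : ℝ) := by
    rw [← Real.sqrt_mul (by positivity)]
    refine Real.le_sqrt_of_sq_le ?_
    rw [hab]
    rcases hb' with h | h <;> rw [h] <;> push_cast <;> nlinarith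
  refine (pow_le_pow_iff_left₀ (by positivity) (by positivity) two_ne_zero).1 ?_
  rw [mul_pow, add_sq, Real.sq_sqrt (by positivity), Real.sq_sqrt (by positivity),
    Real.sq_sqrt (by positivity)]
  nlinarith

open Classical in
/-- The first item position up to which the items of `T` in `R` have a prescribed number. -/
def cutPosition {m : ℕ} (R : Finset (Fin m)) (c : ℕ) (T : Finset (Fin m)) : ℕ :=
  if h : ∃ p, c ≤ ((T ∩ R).filter fun e => e.1 < p).card then Nat.find h else 0

theorem cutPosition_le {m : ℕ} (R : Finset (Fin m)) (c : ℕ) (T : Finset (Fin m)) :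
    cutPosition R c T ≤ m := by
  unfold cutPosition
  split_ifs with h
  · refine Nat.find_min' h ((Nat.find_spec h).trans (Finset.card_le_card ?_))
    exact Finset.monotone_filter_right _ fun e _ _ => e.2
  · exact Nat.zero_le m

theorem le_card_of_cutPosition_le {m : ℕ} {R : Finset (Fin m)} {c : ℕ} {T : Finset (Fin m)}
    (hc : c ≤ (T ∩ R).card) {p : ℕ} (hp : cutPosition R c T ≤ p) :
    c ≤ ((T ∩ R).filter fun e => e.1 < p).card := by
  have h : ∃ p, c ≤ ((T ∩ R).filter fun e => e.1 < p).card :=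
    ⟨m, by rwa [Finset.filter_true_of_mem fun e _ => e.2]⟩
  rw [cutPosition, dif_pos h] at hp
  exact (Nat.find_spec h).trans (Finset.card_le_card
    (Finset.monotone_filter_right _ fun e _ h' => lt_of_lt_of_le h' hp))

theorem card_le_of_le_cutPosition {m : ℕ} {R : Finset (Fin m)} {c : ℕ} {T : Finset (Fin m)}
    (hc : c ≤ (T ∩ R).card) {p : ℕ} (hp : p ≤ cutPosition R c T) :
    ((T ∩ R).filter fun e => e.1 < p).card ≤ c := by
  classical
  have h : ∃ p, c ≤ ((T ∩ R).filter fun e => e.1 < p).card :=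
    ⟨m, by rwa [Finset.filter_true_of_mem fun e _ => e.2]⟩
  rw [cutPosition, dif_pos h] at hp
  rcases p with _ | p
  · simp
  · have h1 := Nat.find_min h (show p < Nat.find h by omega)
    have h2 : ((T ∩ R).filter fun e => e.1 < p + 1) ⊆
        ((T ∩ R).filter fun e => e.1 < p) ∪ Finset.univ.filter fun e : Fin m => e.1 = p := by
      intro e he
      simp only [Finset.mem_filter, Finset.mem_union, Finset.mem_univ, true_and] at he ⊢
      by_cases h3 : e.1 = p
      · exact Or.inr h3
      · exact Or.inl ⟨he.1, by omega⟩
    have h3 : (Finset.univ.filter fun e : Fin m => e.1 = p).card ≤ 1 :=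
      Finset.card_le_one.2 fun a ha b hb => Fin.ext
        ((Finset.mem_filter.1 ha).2.trans (Finset.mem_filter.1 hb).2.symm)
    have h4 := (Finset.card_le_card h2).trans (Finset.card_union_le _ _)
    omega

theorem clog_half_add_one {u : ℕ} (hu : 2 ≤ u) : Nat.clog 2 (u - u / 2) + 1 = Nat.clog 2 u := by
  have : u - u / 2 = (u + 2 - 1) / 2 := by omega
  rw [this, Nat.clog_of_two_le (by norm_num) hu]

/-- The halving procedure of Even and Paz, with quickselect for finding the cuts. -/
theorem exists_evenPaz {n m : ℕ} [Nonempty (Fin n)] (k : Finset (Fin m) → ℕ) {B : ℕ}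
    (hB : m < 2 ^ B) :
    ∀ (u : ℕ) (R : Finset (Fin m)) (V : Finset (Fin n)), V.card = u →
    ∃ t : RTree (Finset (Fin m)) n (Fin m → Fin n), ∀ v, HasShares k R V v →
      t.Spec v (GivesShares k R V v)
        (ENNReal.ofReal (23 * B * (u - √u) + 8 * u * Nat.clog 2 u)) := by
  classical
  intro u
  induction u using Nat.strong_induction_on with
  | _ u ih =>
  intro R V hV
  rcases Nat.lt_or_ge u 2 with hu | hu
  · rcases Nat.eq_zero_or_pos u with rfl | hu0
    · refine ⟨.ret fun _ => Classical.arbitrary _, fun v _ => RTree.spec_ret fun i hi => ?_⟩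
      rw [Finset.card_eq_zero.1 hV] at hi
      exact absurd hi (Finset.notMem_empty i)
    · obtain ⟨j, rfl⟩ := Finset.card_eq_one.1 (show V.card = 1 by omega)
      refine ⟨.ret fun _ => j, fun v hv => RTree.spec_ret fun i hi => ?_⟩
      have := hv i hi
      rw [Finset.mem_singleton] at hi
      subst hi
      simpa using this
  set a := u / 2 with ha
  obtain ⟨b, hb⟩ : ∃ b, u - a = b := ⟨_, rfl⟩
  -- Every agent marks the position up to which she sees `a` shares. A threshold of rank `a`
  -- separates `a` agents with early marks, who share the items before it, from the others, who see
  -- at most `a` shares before it and keep enough behind it.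
  set x : Finset (Fin m) → ℕ := fun T => cutPosition R (a * k T) T
  obtain ⟨t₁, ht₁⟩ := exists_select (n := n) x (fun T => (cutPosition_le R _ T).trans_lt hB) u V hV a
    (by omega) (by omega)
  have hrec : ∀ (c : ℕ) (R' : Finset (Fin m)) (W : Finset (Fin n)), ∃ t : RTree (Finset (Fin m)) n
      (Fin m → Fin n), c < u → W.card = c → ∀ v, HasShares k R' W v → t.Spec v (GivesShares k R' W v)
        (ENNReal.ofReal (23 * B * (c - √c) + 8 * c * Nat.clog 2 c)) := by
    intro c R' W
    by_cases h : c < u ∧ W.card = c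
    · obtain ⟨t, ht⟩ := ih c h.1 R' W h.2
      exact ⟨t, fun _ _ => ht⟩
    · exact ⟨.ret fun _ => Classical.arbitrary _, fun h1 h2 => absurd ⟨h1, h2⟩ h⟩
  choose rec hrec using hrec
  set L : ℕ → Finset (Fin m) := fun p => R.filter fun e => e.1 < p
  refine ⟨t₁.bind fun r => (rec a (L r.1) r.2).bind fun A₁ =>
    (rec b (R \ L r.1) (V \ r.2)).bind fun A₂ => .ret fun e => if e ∈ L r.1 then A₁ e else A₂ e,
    fun v hv => ?_⟩
  have hsq : ∀ c : ℕ, 0 ≤ (c : ℝ) - √c := by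
    intro c
    rcases Nat.eq_zero_or_pos c with rfl | hc
    · simp
    · have : 1 ≤ √(c : ℝ) := Real.one_le_sqrt.2 (by exact_mod_cast hc)
      have h2 := Real.sq_sqrt (Nat.cast_nonneg (α := ℝ) c)
      nlinarith
  -- The negative root terms pay for quickselect: the halves release at least `23 · 0.36 · B√u ≥
  -- 8B√u`, and one level of `Nat.clog` releases `8u`. So the number of levels does not multiply
  -- `B`.
  have hle : (8 * u + 8 * B * √(u : ℝ)) + ((23 * B * (a - √(a : ℝ)) + 8 * a * Nat.clog 2 a) +
      ((23 * B * (b - √(b : ℝ)) + 8 * b * Nat.clog 2 b) + 0)) ≤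
      23 * B * (u - √(u : ℝ)) + 8 * u * Nat.clog 2 u := by
    have h1 := sqrt_half_add_sqrt_half_le hu
    rw [← ha, hb] at h1
    have h2 := clog_half_add_one hu
    rw [← ha, hb] at h2
    have h3 : Nat.clog 2 a ≤ Nat.clog 2 b := Nat.clog_mono_right 2 (by omega)
    have h4 : (u : ℝ) = a + b := by exact_mod_cast (by omega : u = a + b)
    have h3' : (Nat.clog 2 a : ℝ) ≤ Nat.clog 2 b := by exact_mod_cast h3
    have h2' : (Nat.clog 2 u : ℝ) = Nat.clog 2 b + 1 := by exact_mod_cast h2.symm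
    have h5 : (a : ℝ) * Nat.clog 2 a ≤ a * Nat.clog 2 b := by gcongr
    have h6 : (B : ℝ) * (1.36 * √(u : ℝ)) ≤ B * (√(a : ℝ) + √(b : ℝ)) := by gcongr
    have h7 : 0 ≤ (B : ℝ) * √(u : ℝ) := by positivity
    have h8 : (B : ℝ) * u = B * a + B * b := by rw [h4]; ring
    have h9 : (u : ℝ) * Nat.clog 2 u = a * Nat.clog 2 b + b * Nat.clog 2 b + u := by
      rw [h2', h4]; ring
    nlinarith
  refine RTree.Spec.mono (Q := GivesShares k R V v) ?_ (fun _ h => h) (ENNReal.ofReal_le_ofReal hle)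
  have n1 : ∀ c : ℕ, 0 ≤ 23 * B * ((c : ℝ) - √c) + 8 * c * Nat.clog 2 c := fun c => by
    have := hsq c; positivity
  have n1a := n1 a
  have n1b := n1 b
  rw [ENNReal.ofReal_add (by positivity) (by positivity)]
  refine (ht₁ v).bind ?_
  rintro ⟨p, S⟩ ⟨h1, h2, h3, h4⟩
  simp only at h1 h2 h3 h4
  have hLR : L p ⊆ R := Finset.filter_subset _ _
  have hcount : ∀ T : Finset (Fin m), T ∩ L p = (T ∩ R).filter fun e => e.1 < p := by
    intro T; ext e; simp only [L, Finset.mem_inter, Finset.mem_filter]; tauto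
  have hcount' : ∀ T : Finset (Fin m), (T ∩ (R \ L p)).card + (T ∩ L p).card = (T ∩ R).card := by
    intro T
    rw [← Finset.card_union_of_disjoint]
    · congr 1
      ext e
      have := @hLR e
      simp only [Finset.mem_inter, Finset.mem_union, Finset.mem_sdiff]
      tauto
    · exact Finset.disjoint_of_subset_left Finset.inter_subset_right
        (Finset.disjoint_of_subset_right Finset.inter_subset_right Finset.sdiff_disjoint)
  have hak : ∀ i ∈ V, a * k (v i) ≤ (v i ∩ R).card := fun i hi =>
    (Nat.mul_le_mul_right _ (by omega)).trans (hv i hi)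
  rw [ENNReal.ofReal_add (by positivity) (by positivity)]
  refine (hrec a (L p) S (by omega) h2 v fun i hi => ?_).bind fun A₁ hA₁ => ?_
  · rw [h2, hcount]
    exact le_card_of_cutPosition_le (hak i (h1 hi)) (h3 i hi)
  rw [ENNReal.ofReal_add (by positivity) le_rfl, ENNReal.ofReal_zero]
  have hVS : (V \ S).card = b := by rw [Finset.card_sdiff_of_subset h1]; omega
  refine (hrec b (R \ L p) (V \ S) (by omega) hVS v fun i hi => ?_).bind
    fun A₂ hA₂ => RTree.spec_ret fun i hi => ?_
  · obtain ⟨hi, hiS⟩ := Finset.mem_sdiff.1 hi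
    have h5 := card_le_of_le_cutPosition (hak i hi) (h4 i hi hiS)
    rw [← hcount] at h5
    have h6 := hcount' (v i)
    have h7 := hv i hi
    rw [hV, (by omega : u = a + b), add_mul] at h7
    rw [hVS]
    omega
  · by_cases hiS : i ∈ S
    · refine (hA₁ i hiS).trans (Finset.card_le_card fun e he => ?_)
      simp only [Finset.mem_filter, Finset.mem_inter] at he ⊢
      exact ⟨⟨he.1.1, hLR he.1.2⟩, by rw [if_pos he.1.2, he.2]⟩
    · refine (hA₂ i (Finset.mem_sdiff.2 ⟨hi, hiS⟩)).trans (Finset.card_le_card fun e he => ?_)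
      simp only [Finset.mem_filter, Finset.mem_inter, Finset.mem_sdiff] at he ⊢
      exact ⟨⟨he.1.1, he.1.2.1⟩, by rw [if_neg he.1.2.2, he.2]⟩

open scoped BigOperators

set_option linter.unusedSectionVars false

/-! ### Sampling without replacement. -/

section Permutations

variable {I J : Type} [Fintype I] [DecidableEq I] [Fintype J] [DecidableEq J]

theorem expect_comp_perm (g : (J → I) → ℝ) (σ : Equiv.Perm I) :
    (𝔼 X : J → I, g (σ ∘ X)) = 𝔼 X : J → I, g X :=
  Fintype.expect_equiv (Equiv.arrowCongr (Equiv.refl J) σ) _ _ fun X => by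
    congr 1

/-- Two injective samples differ by a permutation of the population, which a uniformly distributed
permutation absorbs. -/
theorem expect_perm_comp_of_injective (g : (J → I) → ℝ) (ι : J ↪ I) {X : J → I}
    (hX : Function.Injective X) :
    (𝔼 σ : Equiv.Perm I, g (σ ∘ X)) = 𝔼 σ : Equiv.Perm I, g (σ ∘ ι) := by
  classical
  let e : {x // x ∈ Set.range ι} ≃ {x // x ∈ Set.range X} :=
    (Equiv.ofInjective ι ι.injective).symm.trans (Equiv.ofInjective X hX)
  let τ : Equiv.Perm I := e.extendSubtype
  have hτ : X = τ ∘ ι := by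
    funext j
    have h1 : τ (ι j) = e ⟨ι j, j, rfl⟩ := e.extendSubtype_apply_of_mem _ ⟨j, rfl⟩
    rw [Function.comp_apply, h1]
    simp only [e, Equiv.trans_apply]
    have : (Equiv.ofInjective ι ι.injective).symm ⟨ι j, j, rfl⟩ = j :=
      Equiv.ofInjective_symm_apply ι.injective j
    rw [this]; rfl
  rw [hτ]
  exact Fintype.expect_equiv (Equiv.mulRight τ) _ _ fun σ => rfl

/-- The birthday bound: a union bound over pairs of positions. -/
theorem expect_not_injective_le :
    (𝔼 X : J → I, if Function.Injective X then (0 : ℝ) else 1) ≤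
      (Fintype.card J : ℝ) ^ 2 / Fintype.card I := by
  classical
  rcases isEmpty_or_nonempty I with hI | hI
  · rcases isEmpty_or_nonempty J with hJ | hJ
    · have : ∀ X : J → I, Function.Injective X := fun X a => hJ.elim a
      simp [this]
    · have : IsEmpty (J → I) := ⟨fun X => hI.elim (X hJ.some)⟩
      simp
  have h1 : ∀ X : J → I, (if Function.Injective X then (0 : ℝ) else 1) ≤
      ∑ p ∈ Finset.univ.filter (fun p : J × J => p.1 ≠ p.2), if X p.1 = X p.2 then (1 : ℝ) else 0 := by
    intro X
    split_ifs with h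
    · exact Finset.sum_nonneg fun _ _ => by split_ifs <;> norm_num
    · simp only [Function.Injective, not_forall] at h
      obtain ⟨a, b, h2, h3⟩ := h
      have := Finset.single_le_sum (f := fun p : J × J => if X p.1 = X p.2 then (1 : ℝ) else 0)
        (s := Finset.univ.filter (fun p : J × J => p.1 ≠ p.2))
        (fun _ _ => by split_ifs <;> norm_num) (Finset.mem_filter.2 ⟨Finset.mem_univ (a, b), h3⟩)
      simpa [h2] using this
  refine (Finset.expect_le_expect fun X _ => h1 X).trans ?_
  rw [Finset.expect_sum_comm]
  have h2 : ∀ p ∈ Finset.univ.filter (fun p : J × J => p.1 ≠ p.2),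
      (𝔼 X : J → I, if X p.1 = X p.2 then (1 : ℝ) else 0) = 1 / Fintype.card I := by
    rintro ⟨a, b⟩ hp
    have hab : a ≠ b := (Finset.mem_filter.1 hp).2
    rw [← expect_update _ a]
    simp only [Function.update_self, Function.update_of_ne hab.symm]
    simp
  rw [Finset.sum_congr rfl h2, Finset.sum_const, nsmul_eq_mul, mul_one_div]
  gcongr
  rw [sq]
  refine le_trans (Nat.cast_le.2 (Finset.card_le_univ _)) ?_
  rw [Fintype.card_prod]; push_cast; rfl

theorem abs_expect_le {Ω : Type} [Fintype Ω] [Nonempty Ω] {f : Ω → ℝ} {M : ℝ}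
    (h : ∀ x, |f x| ≤ M) : |𝔼 x, f x| ≤ M := by
  refine abs_le.2 ⟨?_, ?_⟩
  · rw [← Fintype.expect_const (ι := Ω) (-M)]
    exact Finset.expect_le_expect fun x _ => (abs_le.1 (h x)).1
  · rw [← Fintype.expect_const (ι := Ω) M]
    exact Finset.expect_le_expect fun x _ => (abs_le.1 (h x)).2

/-- Sampling without replacement is similar to sampling with replacement. -/
theorem abs_expect_perm_sub_le (g : (J → I) → ℝ) {M : ℝ} (hg : ∀ X, |g X| ≤ M) (ι : J ↪ I) :
    |(𝔼 σ : Equiv.Perm I, g (σ ∘ ι)) - 𝔼 X : J → I, g X| ≤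
      2 * M * ((Fintype.card J : ℝ) ^ 2 / Fintype.card I) := by
  classical
  have : Nonempty (J → I) := ⟨ι⟩
  have hM : 0 ≤ M := (abs_nonneg _).trans (hg ι)
  set c := 𝔼 σ : Equiv.Perm I, g (σ ∘ ι)
  -- Independent samples keep their law under a further random permutation. After averaging over it,
  -- only samples with repetitions can deviate from `c`.
  have h1 : (𝔼 X : J → I, g X) = 𝔼 X : J → I, 𝔼 σ : Equiv.Perm I, g (σ ∘ X) := by
    rw [Finset.expect_comm]
    simp_rw [expect_comp_perm]
    rw [Fintype.expect_const]
  have h2 : c - (𝔼 X : J → I, g X) = 𝔼 X : J → I, (c - 𝔼 σ : Equiv.Perm I, g (σ ∘ X)) := by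
    rw [h1, Finset.expect_sub_distrib, Fintype.expect_const]
  rw [h2]
  refine (Finset.abs_expect_le _ _).trans ?_
  have h3 : ∀ X : J → I, |c - 𝔼 σ : Equiv.Perm I, g (σ ∘ X)| ≤
      2 * M * if Function.Injective X then (0 : ℝ) else 1 := by
    intro X
    split_ifs with h
    · rw [expect_perm_comp_of_injective g ι h, sub_self]; simp
    · have h4 : |c| ≤ M := abs_expect_le fun σ => hg _
      have h5 : |𝔼 σ : Equiv.Perm I, g (σ ∘ X)| ≤ M := abs_expect_le fun σ => hg _
      have := abs_sub c (𝔼 σ : Equiv.Perm I, g (σ ∘ X))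
      linarith
  refine (Finset.expect_le_expect fun X _ => h3 X).trans ?_
  rw [← Finset.mul_expect]
  exact mul_le_mul_of_nonneg_left expect_not_injective_le (by linarith)

end Permutations

/-! ### Stopping times and Wald's identity in a block of independent items. -/

section Blocks

variable {ℓ d : ℕ} {I A : Type} [Fintype I] [DecidableEq I]

/-- The item at a position of a block belongs to `T`. -/
def Hits (X : Fin ℓ → I) (T : Finset I) (p : ℕ) : Prop := ∃ h : p < ℓ, X ⟨p, h⟩ ∈ T

instance (X : Fin ℓ → I) (T : Finset I) : DecidablePred (Hits X T) :=
  fun _ => Classical.propDecidable _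

/-- The number of items of `T` between two positions of a block. -/
def cnt (X : Fin ℓ → I) (T : Finset I) (s r : ℕ) : ℕ := ((Finset.Ico s r).filter (Hits X T)).card

theorem cnt_mono_right (X : Fin ℓ → I) (T : Finset I) (s : ℕ) {r r' : ℕ} (h : r ≤ r') :
    cnt X T s r ≤ cnt X T s r' :=
  Finset.card_le_card (Finset.filter_subset_filter _ (Finset.Ico_subset_Ico_right h))

theorem cnt_succ_le (X : Fin ℓ → I) (T : Finset I) (s r : ℕ) :
    cnt X T s (r + 1) ≤ cnt X T s r + 1 := by
  have : (Finset.Ico s (r + 1)).filter (Hits X T) ⊆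
      insert r ((Finset.Ico s r).filter (Hits X T)) := by
    intro p hp
    simp only [Finset.mem_filter, Finset.mem_Ico, Finset.mem_insert] at hp ⊢
    by_cases h : p = r
    · exact Or.inl h
    · exact Or.inr ⟨⟨hp.1.1, by omega⟩, hp.2⟩
  exact (Finset.card_le_card this).trans (Finset.card_insert_le _ _)

theorem cnt_eq_zero (X : Fin ℓ → I) (T : Finset I) {s r : ℕ} (h : r ≤ s) : cnt X T s r = 0 := by
  simp [cnt, Finset.Ico_eq_empty_of_le h]

theorem cnt_add (X : Fin ℓ → I) (T : Finset I) {s r q : ℕ} (h : s ≤ r) (h' : r ≤ q) :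
    cnt X T s q = cnt X T s r + cnt X T r q := by
  rw [cnt, ← Finset.Ico_union_Ico_eq_Ico h h', Finset.filter_union, Finset.card_union_of_disjoint]
  · rfl
  · exact Finset.disjoint_filter_filter (Finset.Ico_disjoint_Ico_consecutive s r q)

theorem cnt_congr {X X' : Fin ℓ → I} (T : Finset I) {s r : ℕ}
    (h : ∀ q : Fin ℓ, q.1 < r → X q = X' q) : cnt X T s r = cnt X' T s r := by
  unfold cnt
  congr 1
  refine Finset.filter_congr fun p hp => ?_
  have hp := (Finset.mem_Ico.1 hp).2
  exact exists_congr fun h1 => by rw [h ⟨p, h1⟩ hp]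

theorem cnt_eq_card (X : Fin ℓ → I) (T : Finset I) (s r : ℕ) :
    cnt X T s r = (Finset.univ.filter fun q : Fin ℓ => (s ≤ q.1 ∧ q.1 < r) ∧ X q ∈ T).card := by
  symm
  refine Finset.card_bij (fun q _ => q.1) ?_ (fun _ _ _ _ h => Fin.ext h) ?_
  · intro q hq
    have hq := (Finset.mem_filter.1 hq).2
    exact Finset.mem_filter.2 ⟨Finset.mem_Ico.2 hq.1, q.2, hq.2⟩
  · intro p hp
    obtain ⟨h1, h2, h3⟩ := Finset.mem_filter.1 hp
    exact ⟨⟨p, h2⟩, Finset.mem_filter.2 ⟨Finset.mem_univ _, Finset.mem_Ico.1 h1, h3⟩, rfl⟩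

theorem cnt_eq_sum (X : Fin ℓ → I) (T : Finset I) (s r : ℕ) :
    (cnt X T s r : ℝ) = ∑ q : Fin ℓ, (if s ≤ q.1 ∧ q.1 < r then (1 : ℝ) else 0) *
      if X q ∈ T then 1 else 0 := by
  rw [cnt_eq_card, ← Finset.sum_boole]
  refine Finset.sum_congr rfl fun q _ => ?_
  by_cases h2 : s ≤ q.1 ∧ q.1 < r <;> by_cases h3 : X q ∈ T <;> simp [h2, h3]

theorem cnt_univ (X : Fin ℓ → I) {s r : ℕ} (hr : r ≤ ℓ) : cnt X Finset.univ s r = r - s := by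
  rw [cnt, Finset.filter_true_of_mem, Nat.card_Ico]
  intro p hp
  have := (Finset.mem_Ico.1 hp).2
  exact ⟨by omega, Finset.mem_univ _⟩

theorem cnt_le (X : Fin ℓ → I) (T : Finset I) (s r : ℕ) : cnt X T s r ≤ ℓ := by
  calc cnt X T s r ≤ (Finset.range ℓ).card := Finset.card_le_card fun p hp => by
        obtain ⟨h, -⟩ := (Finset.mem_filter.1 hp).2
        exact Finset.mem_range.2 h
    _ = ℓ := Finset.card_range ℓ

open Classical in
/-- The first position at which `k` items of `T` were seen from position `s` on, and `ℓ + 1` if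
there is none. -/
def arrival (X : Fin ℓ → I) (T : Finset I) (k s : ℕ) : ℕ :=
  Nat.find (⟨ℓ + 1, Or.inl (Nat.lt_succ_self ℓ)⟩ : ∃ r, ℓ < r ∨ k ≤ cnt X T s r)

theorem lt_arrival_iff {X : Fin ℓ → I} {T : Finset I} {k s r : ℕ} :
    r < arrival X T k s ↔ r ≤ ℓ ∧ cnt X T s r < k := by
  classical
  rw [arrival, Nat.lt_find_iff]
  constructor
  · intro h
    have := h r le_rfl
    push Not at this
    exact this
  · rintro ⟨h1, h2⟩ q hq
    push Not
    exact ⟨hq.trans h1, (cnt_mono_right X T s hq).trans_lt h2⟩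

theorem arrival_le (X : Fin ℓ → I) (T : Finset I) (k s : ℕ) : arrival X T k s ≤ ℓ + 1 := by
  by_contra h
  have := (lt_arrival_iff.1 (not_le.1 h)).1
  omega

theorem le_arrival (X : Fin ℓ → I) (T : Finset I) {k s : ℕ} (hk : 1 ≤ k) (hs : s ≤ ℓ + 1) :
    s ≤ arrival X T k s := by
  by_contra h
  have h1 : ¬ (arrival X T k s < arrival X T k s) := lt_irrefl _
  rw [lt_arrival_iff, cnt_eq_zero X T (by omega)] at h1
  omega

theorem cnt_arrival_le (X : Fin ℓ → I) (T : Finset I) {k s r : ℕ} (hk : 1 ≤ k)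
    (hr : r ≤ arrival X T k s) : cnt X T s r ≤ k := by
  rcases r with _ | r
  · rw [cnt_eq_zero X T (Nat.zero_le s)]; omega
  · have h1 := (lt_arrival_iff.1 (show r < arrival X T k s by omega)).2
    have := cnt_succ_le X T s r
    omega

theorem le_cnt_arrival {X : Fin ℓ → I} {T : Finset I} {k s : ℕ} (h : arrival X T k s ≤ ℓ) :
    k ≤ cnt X T s (arrival X T k s) := by
  by_contra h1
  exact lt_irrefl _ (lt_arrival_iff.2 ⟨h, not_le.1 h1⟩)

/-- Stopping times of the exploration of a block. -/
def IsStopping (S : (Fin ℓ → I) → ℕ) : Prop :=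
  ∀ X X' r, (∀ q : Fin ℓ, q.1 < r → X q = X' q) → S X ≤ r → S X' = S X

theorem isStopping_const (c : ℕ) : IsStopping (fun _ : Fin ℓ → I => c) := fun _ _ _ _ _ => rfl

theorem IsStopping.le_iff {S : (Fin ℓ → I) → ℕ} (hS : IsStopping S) {X X' : Fin ℓ → I} {r : ℕ}
    (h : ∀ q : Fin ℓ, q.1 < r → X q = X' q) : S X ≤ r ↔ S X' ≤ r :=
  ⟨fun h1 => (hS X X' r h h1).trans_le h1,
    fun h1 => (hS X' X r (fun q hq => (h q hq).symm) h1).trans_le h1⟩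

theorem IsStopping.min {S S' : (Fin ℓ → I) → ℕ} (hS : IsStopping S) (hS' : IsStopping S') :
    IsStopping fun X => min (S X) (S' X) := by
  intro X X' r h h1
  simp only at h1 ⊢
  have e1 := hS.le_iff h
  have e2 := hS'.le_iff h
  have f1 := hS X X' r h
  have f2 := hS' X X' r h
  rcases le_or_gt (S X) r with a | a <;> rcases le_or_gt (S' X) r with b | b
  · rw [f1 a, f2 b]
  · have : ¬ S' X' ≤ r := fun h2 => by have := e2.2 h2; omega
    rw [f1 a, min_eq_left (by omega), min_eq_left (by omega)]
  · have : ¬ S X' ≤ r := fun h2 => by have := e1.2 h2; omega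
    rw [f2 b, min_eq_right (by omega), min_eq_right (by omega)]
  · have := min_le_iff.1 h1; omega

theorem IsStopping.arrival {S : (Fin ℓ → I) → ℕ} (hS : IsStopping S) (T : Finset I) {k : ℕ}
    (hk : 1 ≤ k) (hle : ∀ X, S X ≤ ℓ + 1) : IsStopping fun X => arrival X T k (S X) := by
  intro X X' r h h1
  have h2 : S X ≤ r := (le_arrival X T hk (hle X)).trans h1
  have h3 := hS X X' r h h2
  have h4 : ∀ q ≤ r, (q < FairAllocation.arrival X' T k (S X') ↔ q < FairAllocation.arrival X T k (S X)) := by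
    intro q hq
    rw [lt_arrival_iff, lt_arrival_iff, h3, cnt_congr T fun p hp => h p (lt_of_lt_of_le hp hq)]
  simp only at h1 ⊢
  have h5 := h4 _ h1
  have h6 : FairAllocation.arrival X' T k (S X') ≤ FairAllocation.arrival X T k (S X) := by
    by_contra h7; exact lt_irrefl _ (h5.1 (not_le.1 h7))
  by_contra h7
  have := (h4 _ (h6.trans h1)).2 (by omega)
  exact lt_irrefl _ this

/-- Whether a stopping time is at most `r` depends only on items before position `r`. Hence the
event that position `r` lies between two stopping times does not depend on the item there. -/
theorem IsStopping.le_update {S : (Fin ℓ → I) → ℕ} (hS : IsStopping S) (X : Fin ℓ → I)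
    {r q : Fin ℓ} (h : r ≤ q) (x : I) : S (Function.update X q x) ≤ r.1 ↔ S X ≤ r.1 :=
  hS.le_iff fun p hp => Function.update_of_ne (fun h1 => by
    subst h1; exact absurd hp (not_lt.2 h)) _ _

/-- Wald's identity for the exploration of a block. -/
theorem wald (T : Finset I) (φ : Fin ℓ → (Fin ℓ → I) → ℝ)
    (hφ : ∀ q X x, φ q (Function.update X q x) = φ q X) :
    (𝔼 X : Fin ℓ → I, ∑ q, φ q X * if X q ∈ T then (1 : ℝ) else 0) =
      (T.card / Fintype.card I : ℝ) * 𝔼 X : Fin ℓ → I, ∑ q, φ q X := by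
  classical
  rw [Finset.expect_sum_comm, Finset.expect_sum_comm, Finset.mul_sum]
  refine Finset.sum_congr rfl fun q _ => ?_
  -- Since `φ q` ignores the item at position `q`, this item can be resampled, and then it hits `T`
  -- with the density of `T`.
  rw [← expect_update _ q, Finset.mul_expect]
  refine Finset.expect_congr rfl fun X _ => ?_
  simp only [hφ, Function.update_self]
  rw [← Finset.mul_expect, mul_comm]
  congr 1
  rw [Fintype.expect_eq_sum_div_card, Finset.sum_boole]
  simp

theorem expect_cnt {S S' : (Fin ℓ → I) → ℕ} (hS : IsStopping S) (hS' : IsStopping S')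
    (T : Finset I) : (𝔼 X : Fin ℓ → I, (cnt X T (S X) (S' X) : ℝ)) =
      (T.card / Fintype.card I : ℝ) * 𝔼 X : Fin ℓ → I, (cnt X Finset.univ (S X) (S' X) : ℝ) := by
  have h := wald T (fun q X => if S X ≤ q.1 ∧ q.1 < S' X then (1 : ℝ) else 0) fun q X x => by
    have h1 := hS.le_update X (le_refl q) x
    have h2 := hS'.le_update X (le_refl q) x
    exact if_congr (and_congr h1 (not_le.symm.trans ((not_congr h2).trans not_le))) rfl rfl
  simp_rw [cnt_eq_sum]
  rw [h]
  simp

end Blocks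

/-! ### Races of two agents and the resulting windows. -/

section Exploration

variable {ℓ d : ℕ} {I A : Type} [Fintype I] [DecidableEq I] [Fintype A] [DecidableEq A]

/-- The positions at which the windows of a block start: in window `j`, the two agents `Y (j, true)`
and `Y (j, false)` compete for being the first one who sees her share. -/
def winStart (T : A → Finset I) (k : A → ℕ) (X : Fin ℓ → I) (Y : Fin d × Bool → A) : ℕ → ℕ
  | 0 => 0
  | j + 1 => if h : j < d then
      min (arrival X (T (Y (⟨j, h⟩, true))) (k (Y (⟨j, h⟩, true))) (winStart T k X Y j))
        (arrival X (T (Y (⟨j, h⟩, false))) (k (Y (⟨j, h⟩, false))) (winStart T k X Y j))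
    else ℓ + 1

/-- Every agent likes a multiple of `|A|` items. -/
structure Exact (T : A → Finset I) (k : A → ℕ) : Prop where
  pos : ∀ a, 1 ≤ k a
  card : ∀ a, (T a).card = Fintype.card A * k a

section

variable {T : A → Finset I} {k : A → ℕ}

theorem winStart_succ (X : Fin ℓ → I) (Y : Fin d × Bool → A) (j : Fin d) :
    winStart T k X Y (j + 1) =
      min (arrival X (T (Y (j, true))) (k (Y (j, true))) (winStart T k X Y j))
        (arrival X (T (Y (j, false))) (k (Y (j, false))) (winStart T k X Y j)) := by
  rw [winStart, dif_pos j.2]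

theorem winStart_le (X : Fin ℓ → I) (Y : Fin d × Bool → A) (j : ℕ) :
    winStart T k X Y j ≤ ℓ + 1 := by
  rcases j with _ | j
  · exact Nat.zero_le _
  · rw [winStart]
    split_ifs
    · exact (min_le_left _ _).trans (arrival_le _ _ _ _)
    · exact le_rfl

theorem winStart_le_succ (h : Exact T k) (X : Fin ℓ → I) (Y : Fin d × Bool → A) (j : ℕ) :
    winStart T k X Y j ≤ winStart T k X Y (j + 1) := by
  rw [winStart]
  split_ifs
  · exact le_min (le_arrival _ _ (h.pos _) (winStart_le _ _ _)) (le_arrival _ _ (h.pos _) (winStart_le _ _ _))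
  · exact winStart_le _ _ _

theorem winStart_mono (h : Exact T k) (X : Fin ℓ → I) (Y : Fin d × Bool → A) :
    Monotone (winStart T k X Y) := monotone_nat_of_le_succ (winStart_le_succ h X Y)

theorem isStopping_winStart (h : Exact T k) (Y : Fin d × Bool → A) (j : ℕ) :
    IsStopping fun X : Fin ℓ → I => winStart T k X Y j := by
  induction j with
  | zero => exact isStopping_const 0
  | succ j ih =>
    by_cases hj : j < d
    · have := (ih.arrival (T (Y (⟨j, hj⟩, true))) (h.pos (Y (⟨j, hj⟩, true))) fun X => winStart_le X Y j).min
        (ih.arrival (T (Y (⟨j, hj⟩, false))) (h.pos (Y (⟨j, hj⟩, false))) fun X => winStart_le X Y j)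
      simpa only [winStart, dif_pos hj] using this
    · simpa only [winStart, dif_neg hj] using isStopping_const (ℓ + 1)

theorem winStart_update (X : Fin ℓ → I) (Y : Fin d × Bool → A) (p : Fin d × Bool) (a : A)
    {j : ℕ} (hj : j ≤ p.1.1) : winStart T k X (Function.update Y p a) j = winStart T k X Y j := by
  induction j with
  | zero => rfl
  | succ j ih =>
    have hne : ∀ (h : j < d) (b : Bool), ((⟨j, h⟩ : Fin d), b) ≠ p := by
      rintro h b rfl
      simp at hj
    rw [winStart, winStart]
    simp only [Function.update_of_ne (hne _ _), ih (by omega)]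

/-- The average number of items per agent. -/
def itemRatio (I A : Type) [Fintype I] [Fintype A] : ℝ := Fintype.card I / Fintype.card A

theorem Exact.card_pos (h : Exact T k) (a : A) : 0 < Fintype.card I := by
  have h1 := h.card a
  have h2 : 0 < Fintype.card A := Fintype.card_pos_iff.2 ⟨a⟩
  have h3 := Finset.card_le_univ (T a)
  have := Nat.mul_pos h2 (h.pos a)
  omega

theorem Exact.le_itemRatio (h : Exact T k) (a : A) : (k a : ℝ) ≤ itemRatio I A := by
  have h2 : (0 : ℝ) < Fintype.card A := by exact_mod_cast Fintype.card_pos_iff.2 ⟨a⟩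
  rw [itemRatio, le_div_iff₀ h2]
  have h3 := Finset.card_le_univ (T a)
  rw [h.card] at h3
  rw [mul_comm]
  exact_mod_cast h3

theorem Exact.one_le_itemRatio (h : Exact T k) (a : A) : 1 ≤ itemRatio I A :=
  le_trans (by exact_mod_cast h.pos a) (h.le_itemRatio a)

/-- This identity is the reason for requiring exact counts: the waiting times of all agents are
measured on the same scale `itemRatio I A`, whatever their shares are. -/
theorem Exact.density (h : Exact T k) (a : A) :
    ((T a).card / Fintype.card I : ℝ) = k a / itemRatio I A := by
  have h1 : (0 : ℝ) < Fintype.card I := by exact_mod_cast h.card_pos a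
  have h2 : (0 : ℝ) < Fintype.card A := by exact_mod_cast Fintype.card_pos_iff.2 ⟨a⟩
  rw [h.card, itemRatio]
  push_cast
  field_simp

/-- Two agents compete from a stopping time on. -/
theorem expect_race_le (h : Exact T k) (a b : A) {S : (Fin ℓ → I) → ℕ} (hS : IsStopping S)
    (hle : ∀ X, S X ≤ ℓ + 1) :
    (𝔼 X : Fin ℓ → I, (cnt X Finset.univ (S X)
      (min (arrival X (T a) (k a) (S X)) (arrival X (T b) (k b) (S X))) : ℝ)) ≤
    itemRatio I A * (𝔼 X : Fin ℓ → I, if S X ≤ ℓ then (1 : ℝ) else 0) -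
      𝔼 X : Fin ℓ → I, if arrival X (T b) (k b) (S X) < arrival X (T a) (k a) (S X) then (1 : ℝ) else 0 := by
  have h1 := expect_cnt hS ((hS.arrival (T a) (h.pos a) hle).min (hS.arrival (T b) (h.pos b) hle)) (T a)
  rw [h.density] at h1
  -- During the race agent `a` sees at most `k a` liked items, at most `k a - 1` if `b` is strictly
  -- faster, and none if the race starts behind the block. Wald's identity divides this by the
  -- density `k a / itemRatio`; the factor `itemRatio / k a ≥ 1` of the last probability is dropped.
  have h2 : (𝔼 X : Fin ℓ → I, (cnt X (T a) (S X)
      (min (arrival X (T a) (k a) (S X)) (arrival X (T b) (k b) (S X))) : ℝ)) ≤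
      𝔼 X : Fin ℓ → I, ((k a : ℝ) * (if S X ≤ ℓ then (1 : ℝ) else 0) -
        if arrival X (T b) (k b) (S X) < arrival X (T a) (k a) (S X) then (1 : ℝ) else 0) := by
    refine Finset.expect_le_expect fun X _ => ?_
    have hka := h.pos a
    have hkb := h.pos b
    have h3 := cnt_arrival_le X (T a) (s := S X) hka
      (min_le_left (arrival X (T a) (k a) (S X)) (arrival X (T b) (k b) (S X)))
    by_cases hs : S X ≤ ℓ
    · rw [if_pos hs]
      split_ifs with h4
      · have h5 := (lt_arrival_iff.1 h4).2
        rw [min_eq_right h4.le]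
        have h6 : ((cnt X (T a) (S X) (arrival X (T b) (k b) (S X)) + 1 : ℕ) : ℝ) ≤ k a := by
          exact_mod_cast h5
        push_cast at h6
        linarith
      · have : ((cnt X (T a) (S X) (min (arrival X (T a) (k a) (S X)) (arrival X (T b) (k b) (S X))) : ℕ) : ℝ)
          ≤ k a := by exact_mod_cast h3
        linarith
    · have e1 := le_arrival X (T a) hka (hle X)
      have e2 := le_arrival X (T b) hkb (hle X)
      have e3 := arrival_le X (T a) (k a) (S X)
      have e4 := arrival_le X (T b) (k b) (S X)
      rw [if_neg hs, cnt_eq_zero X (T a) (by omega), if_neg (by omega)]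
      simp
  rw [h1, Finset.expect_sub_distrib, ← Finset.mul_expect] at h2
  set E := 𝔼 X : Fin ℓ → I, (cnt X Finset.univ (S X)
      (min (arrival X (T a) (k a) (S X)) (arrival X (T b) (k b) (S X))) : ℝ)
  set P := 𝔼 X : Fin ℓ → I, if S X ≤ ℓ then (1 : ℝ) else 0
  set Q := 𝔼 X : Fin ℓ → I,
    if arrival X (T b) (k b) (S X) < arrival X (T a) (k a) (S X) then (1 : ℝ) else 0
  have hQ : 0 ≤ Q := Finset.expect_nonneg fun _ _ => by split_ifs <;> norm_num
  have hL := h.le_itemRatio a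
  have hk : (1 : ℝ) ≤ k a := by exact_mod_cast h.pos a
  have hL0 : 0 < itemRatio I A := by linarith
  have h4 : k a * E ≤ (k a * P - Q) * itemRatio I A := by
    rw [div_mul_eq_mul_div, div_le_iff₀ hL0] at h2
    exact h2
  have h5 : k a * Q ≤ itemRatio I A * Q := by gcongr
  refine le_of_mul_le_mul_left ?_ (show (0 : ℝ) < k a by linarith)
  nlinarith

theorem expect_wait_le (h : Exact T k) (a : A) {S : (Fin ℓ → I) → ℕ} (hS : IsStopping S)
    (hle : ∀ X, S X ≤ ℓ + 1) :
    (𝔼 X : Fin ℓ → I, (cnt X Finset.univ (S X) (arrival X (T a) (k a) (S X)) : ℝ)) ≤ itemRatio I A := by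
  have : Nonempty (Fin ℓ → I) := ⟨fun _ => Classical.choice (Fintype.card_pos_iff.1 (h.card_pos a))⟩
  have h1 := expect_race_le h a a hS hle
  simp only [min_self, lt_irrefl, if_false, Finset.expect_const_zero, sub_zero] at h1
  refine h1.trans (mul_le_of_le_one_right ?_ ?_)
  · linarith [h.one_le_itemRatio a]
  · rw [← Fintype.expect_const (ι := Fin ℓ → I) (1 : ℝ)]
    exact Finset.expect_le_expect fun X _ => by split_ifs <;> norm_num

theorem sq_sum_le_two_mul {ι : Type} [Fintype ι] [LinearOrder ι] (φ : ι → ℝ) (hφ : ∀ i, 0 ≤ φ i) :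
    (∑ i, φ i) ^ 2 ≤ 2 * ∑ r, ∑ q, (if r ≤ q then φ r * φ q else 0) := by
  have h1 : (∑ i, φ i) ^ 2 ≤ ∑ r, ∑ q, ((if r ≤ q then φ r * φ q else 0) +
      if q ≤ r then φ q * φ r else 0) := by
    rw [sq, Finset.sum_mul_sum]
    refine Finset.sum_le_sum fun r _ => Finset.sum_le_sum fun q _ => ?_
    have := mul_nonneg (hφ r) (hφ q)
    rcases le_total r q with h | h
    · rw [if_pos h]
      split_ifs <;> nlinarith
    · rw [if_pos h, mul_comm (φ q)]
      split_ifs <;> nlinarith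
  refine h1.trans (le_of_eq ?_)
  simp only [Finset.sum_add_distrib]
  rw [Finset.sum_comm (f := fun r q => if q ≤ r then φ q * φ r else 0)]
  ring

/-- Up to a factor two, the square counts pairs `r ≤ q` of positions in the wait. For fixed `r`,
Wald's identity applied to the positions from `r` on bounds the expected remaining wait by
`itemRatio`, because at most `k a` liked items are seen in total. Summing over `r` leaves the first
moment. -/
theorem expect_wait_sq_le (h : Exact T k) (a : A) {S : (Fin ℓ → I) → ℕ} (hS : IsStopping S)
    (hle : ∀ X, S X ≤ ℓ + 1) :
    (𝔼 X : Fin ℓ → I, (cnt X Finset.univ (S X) (arrival X (T a) (k a) (S X)) : ℝ) ^ 2) ≤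
      2 * itemRatio I A ^ 2 := by
  have hSt := hS.arrival (T a) (h.pos a) hle
  set φ : Fin ℓ → (Fin ℓ → I) → ℝ := fun q X =>
    if S X ≤ q.1 ∧ q.1 < arrival X (T a) (k a) (S X) then 1 else 0
  have hφ0 : ∀ q X, 0 ≤ φ q X := fun q X => by simp only [φ]; split_ifs <;> norm_num
  have hφ1 : ∀ q X, φ q X ≤ 1 := fun q X => by simp only [φ]; split_ifs <;> norm_num
  have hφu : ∀ (r q : Fin ℓ) X x, r ≤ q → φ r (Function.update X q x) = φ r X := by
    intro r q X x hrq
    exact if_congr (and_congr (hS.le_update X hrq x)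
      (not_le.symm.trans ((not_congr (hSt.le_update X hrq x)).trans not_le))) rfl rfl
  have hcnt : ∀ X : Fin ℓ → I, (cnt X Finset.univ (S X) (arrival X (T a) (k a) (S X)) : ℝ) =
      ∑ q, φ q X := by
    intro X; rw [cnt_eq_sum]; simp [φ]
  have hcntT : ∀ X : Fin ℓ → I, ∑ q, φ q X * (if X q ∈ T a then (1 : ℝ) else 0) ≤ k a := by
    intro X
    rw [← cnt_eq_sum]
    exact_mod_cast cnt_arrival_le X (T a) (h.pos a) le_rfl
  have hk : (1 : ℝ) ≤ k a := by exact_mod_cast h.pos a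
  have hL := h.le_itemRatio a
  have hL0 : 0 < itemRatio I A := by linarith
  have hr : ∀ r : Fin ℓ, (𝔼 X : Fin ℓ → I, ∑ q, if r ≤ q then φ r X * φ q X else 0) ≤
      itemRatio I A * 𝔼 X : Fin ℓ → I, φ r X := by
    intro r
    have h1 := wald (T a) (fun q X => if r ≤ q then φ r X * φ q X else 0) fun q X x => by
      split_ifs with hrq
      · rw [hφu r q X x hrq, hφu q q X x le_rfl]
      · rfl
    rw [h.density] at h1
    have h2 : (𝔼 X : Fin ℓ → I, ∑ q, (if r ≤ q then φ r X * φ q X else 0) *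
        if X q ∈ T a then (1 : ℝ) else 0) ≤ 𝔼 X : Fin ℓ → I, (k a : ℝ) * φ r X := by
      refine Finset.expect_le_expect fun X _ => ?_
      calc _ ≤ ∑ q, φ r X * (φ q X * if X q ∈ T a then (1 : ℝ) else 0) := by
            refine Finset.sum_le_sum fun q _ => ?_
            have h3 : 0 ≤ φ q X * if X q ∈ T a then (1 : ℝ) else 0 :=
              mul_nonneg (hφ0 q X) (by split_ifs <;> norm_num)
            by_cases hrq : r ≤ q
            · rw [if_pos hrq, mul_assoc]
            · rw [if_neg hrq, zero_mul]
              exact mul_nonneg (hφ0 r X) h3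
        _ = φ r X * ∑ q, φ q X * (if X q ∈ T a then (1 : ℝ) else 0) := by rw [Finset.mul_sum]
        _ ≤ φ r X * k a := mul_le_mul_of_nonneg_left (hcntT X) (hφ0 r X)
        _ = _ := mul_comm _ _
    rw [h1, ← Finset.mul_expect, div_mul_eq_mul_div, div_le_iff₀ hL0] at h2
    refine le_of_mul_le_mul_left ?_ (show (0 : ℝ) < k a by linarith)
    linarith
  simp_rw [hcnt]
  calc (𝔼 X : Fin ℓ → I, (∑ q, φ q X) ^ 2)
      ≤ 𝔼 X : Fin ℓ → I, 2 * ∑ r, ∑ q, (if r ≤ q then φ r X * φ q X else 0) :=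
        Finset.expect_le_expect fun X _ => sq_sum_le_two_mul _ fun q => hφ0 q X
    _ = 2 * ∑ r, 𝔼 X : Fin ℓ → I, ∑ q, (if r ≤ q then φ r X * φ q X else 0) := by
        rw [← Finset.mul_expect, Finset.expect_sum_comm]
    _ ≤ 2 * ∑ r, itemRatio I A * 𝔼 X : Fin ℓ → I, φ r X := by
        gcongr with r; exact hr r
    _ = 2 * (itemRatio I A * 𝔼 X : Fin ℓ → I, ∑ r, φ r X) := by
        rw [Finset.expect_sum_comm]; simp only [Finset.mul_sum]
    _ ≤ 2 * (itemRatio I A * itemRatio I A) := by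
        have := expect_wait_le h a hS hle
        simp_rw [hcnt] at this
        gcongr
    _ = _ := by ring

end

/-- The number of windows of a block in which somebody sees her share. -/
def completed (T : A → Finset I) (k : A → ℕ) (X : Fin ℓ → I) (Y : Fin d × Bool → A) : ℝ :=
  ∑ j : Fin d, if winStart T k X Y (j + 1) ≤ ℓ then 1 else 0

/-- The number of windows of a block in which the two agents do not see their shares at the same
time. -/
def splits (T : A → Finset I) (k : A → ℕ) (X : Fin ℓ → I) (Y : Fin d × Bool → A) : ℝ :=
  ∑ j : Fin d, if arrival X (T (Y (j, false))) (k (Y (j, false))) (winStart T k X Y j) ≠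
    arrival X (T (Y (j, true))) (k (Y (j, true))) (winStart T k X Y j) then 1 else 0

/-- The number of items in the windows that agent `i` likes, beyond one share per window. -/
def excess (T : A → Finset I) (k : A → ℕ) (i : A) (X : Fin ℓ → I) (Y : Fin d × Bool → A) : ℝ :=
  ∑ j : Fin d, if winStart T k X Y (j + 1) ≤ ℓ then
    (cnt X (T i) (winStart T k X Y j) (winStart T k X Y (j + 1)) : ℝ) - k i else 0

/-- The number of windows that do not end where agent `i` sees her share. -/
def misses (T : A → Finset I) (k : A → ℕ) (i : A) (X : Fin ℓ → I) (Y : Fin d × Bool → A) : ℝ :=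
  ∑ j : Fin d, if winStart T k X Y (j + 1) ≤ ℓ ∧
    arrival X (T i) (k i) (winStart T k X Y j) ≠ winStart T k X Y (j + 1) then 1 else 0

/-- The total number of positions for which the agents wait. -/
def waits (T : A → Finset I) (k : A → ℕ) (X : Fin ℓ → I) (Y : Fin d × Bool → A) : ℝ :=
  ∑ j : Fin d, ((cnt X Finset.univ (winStart T k X Y j)
      (arrival X (T (Y (j, true))) (k (Y (j, true))) (winStart T k X Y j)) : ℝ) +
    cnt X Finset.univ (winStart T k X Y j)
      (arrival X (T (Y (j, false))) (k (Y (j, false))) (winStart T k X Y j)))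

/-- The sum of the squares of the lengths of the windows. -/
def sqLengths (T : A → Finset I) (k : A → ℕ) (X : Fin ℓ → I) (Y : Fin d × Bool → A) : ℝ :=
  ∑ j : Fin d, (cnt X Finset.univ (winStart T k X Y j) (winStart T k X Y (j + 1)) : ℝ) ^ 2

section

variable {T : A → Finset I} {k : A → ℕ}

/-- The average of the two race bounds with exchanged roles. Whenever the racers finish at different
times, one of the bounds saves a position; this saving drives the first case of the dichotomy. -/
theorem expect_window_le (h : Exact T k) (Y : Fin d × Bool → A) (j : Fin d) :
    (𝔼 X : Fin ℓ → I, (cnt X Finset.univ (winStart T k X Y j) (winStart T k X Y (j + 1)) : ℝ)) ≤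
      itemRatio I A * (𝔼 X : Fin ℓ → I, if winStart T k X Y j ≤ ℓ then (1 : ℝ) else 0) -
      1 / 2 * 𝔼 X : Fin ℓ → I, if arrival X (T (Y (j, false))) (k (Y (j, false))) (winStart T k X Y j) ≠
        arrival X (T (Y (j, true))) (k (Y (j, true))) (winStart T k X Y j) then (1 : ℝ) else 0 := by
  have h1 := expect_race_le h (Y (j, true)) (Y (j, false)) (isStopping_winStart (ℓ := ℓ) h Y j)
    fun X => winStart_le X Y j
  have h2 := expect_race_le h (Y (j, false)) (Y (j, true)) (isStopping_winStart (ℓ := ℓ) h Y j)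
    fun X => winStart_le X Y j
  simp_rw [min_comm (arrival _ (T (Y (j, false))) _ _), ← winStart_succ] at h2
  simp_rw [← winStart_succ] at h1
  have h3 : (𝔼 X : Fin ℓ → I, if arrival X (T (Y (j, false))) (k (Y (j, false))) (winStart T k X Y j) ≠
        arrival X (T (Y (j, true))) (k (Y (j, true))) (winStart T k X Y j) then (1 : ℝ) else 0) =
      (𝔼 X : Fin ℓ → I, if arrival X (T (Y (j, false))) (k (Y (j, false))) (winStart T k X Y j) <
        arrival X (T (Y (j, true))) (k (Y (j, true))) (winStart T k X Y j) then (1 : ℝ) else 0) +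
      𝔼 X : Fin ℓ → I, if arrival X (T (Y (j, true))) (k (Y (j, true))) (winStart T k X Y j) <
        arrival X (T (Y (j, false))) (k (Y (j, false))) (winStart T k X Y j) then (1 : ℝ) else 0 := by
    rw [← Finset.expect_add_distrib]
    refine Finset.expect_congr rfl fun X _ => ?_
    rcases lt_trichotomy (arrival X (T (Y (j, false))) (k (Y (j, false))) (winStart T k X Y j))
      (arrival X (T (Y (j, true))) (k (Y (j, true))) (winStart T k X Y j)) with a | a | a
    · simp [a, a.ne, not_lt.2 a.le]
    · simp [a]
    · simp [a, a.ne', not_lt.2 a.le]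
  rw [h3]
  linarith

theorem sum_winStart_le (X : Fin ℓ → I) (Y : Fin d × Bool → A) :
    (∑ j : Fin d, if winStart T k X Y j ≤ ℓ then (1 : ℝ) else 0) ≤ completed T k X Y + 1 := by
  set f : ℕ → ℝ := fun j => if winStart T k X Y j ≤ ℓ then (1 : ℝ) else 0
  have h1 : (∑ j : Fin d, if winStart T k X Y j ≤ ℓ then (1 : ℝ) else 0) =
    ∑ j ∈ Finset.range d, f j := Fin.sum_univ_eq_sum_range f d
  have h2 : completed T k X Y = ∑ j ∈ Finset.range d, f (j + 1) :=
    Fin.sum_univ_eq_sum_range (fun j => f (j + 1)) d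
  have h3 := Finset.sum_range_succ f d
  rw [Finset.sum_range_succ'] at h3
  have h4 : f 0 ≤ 1 := by simp only [f]; split_ifs <;> norm_num
  have h5 : 0 ≤ f d := by simp only [f]; split_ifs <;> norm_num
  rw [h1, h2]
  linarith

theorem sum_cnt_windows (h : Exact T k) (X : Fin ℓ → I) (Y : Fin d × Bool → A) (S : Finset I) :
    ∑ j : Fin d, cnt X S (winStart T k X Y j) (winStart T k X Y (j + 1)) =
      cnt X S 0 (winStart T k X Y d) := by
  rw [Fin.sum_univ_eq_sum_range
    (fun j => cnt X S (winStart T k X Y j) (winStart T k X Y (j + 1))) d]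
  have : ∀ e, ∑ j ∈ Finset.range e, cnt X S (winStart T k X Y j) (winStart T k X Y (j + 1)) =
      cnt X S 0 (winStart T k X Y e) := by
    intro e
    induction e with
    | zero => simp [winStart, cnt_eq_zero]
    | succ e ih =>
      rw [Finset.sum_range_succ, ih, ← cnt_add X S (Nat.zero_le _) (winStart_le_succ h X Y e)]
  exact this d

/-- By Wald's identity, agent `i` likes the fraction `k i / itemRatio` of the expected length of a
window: `k i` items per started window, minus the saving from splits. At most one started window
remains incomplete, which accounts for the additive `k i`. -/
theorem expect_excess_le (h : Exact T k) (i : A) (Y : Fin d × Bool → A) :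
    (𝔼 X : Fin ℓ → I, excess T k i X Y) ≤
      k i - k i / (2 * itemRatio I A) * 𝔼 X : Fin ℓ → I, splits T k X Y := by
  have : Nonempty (Fin ℓ → I) := ⟨fun _ => Classical.choice (Fintype.card_pos_iff.1 (h.card_pos i))⟩
  have hL := h.one_le_itemRatio i
  have hL0 : 0 < itemRatio I A := by linarith
  set L := itemRatio I A
  have hk : (0 : ℝ) ≤ k i := by positivity
  have h1 : ∀ X : Fin ℓ → I, excess T k i X Y ≤
      (∑ j : Fin d, (cnt X (T i) (winStart T k X Y j) (winStart T k X Y (j + 1)) : ℝ)) -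
        k i * completed T k X Y := by
    intro X
    rw [excess, completed, Finset.mul_sum, ← Finset.sum_sub_distrib]
    refine Finset.sum_le_sum fun j _ => ?_
    split_ifs <;> simp
  refine (Finset.expect_le_expect fun X _ => h1 X).trans ?_
  rw [Finset.expect_sub_distrib, Finset.expect_sum_comm, ← Finset.mul_expect]
  have h2 : ∀ j : Fin d,
      (𝔼 X : Fin ℓ → I, (cnt X (T i) (winStart T k X Y j) (winStart T k X Y (j + 1)) : ℝ)) ≤
      k i * (𝔼 X : Fin ℓ → I, if winStart T k X Y j ≤ ℓ then (1 : ℝ) else 0) -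
      k i / (2 * L) *
        𝔼 X : Fin ℓ → I, if arrival X (T (Y (j, false))) (k (Y (j, false))) (winStart T k X Y j) ≠
        arrival X (T (Y (j, true))) (k (Y (j, true))) (winStart T k X Y j) then (1 : ℝ) else 0 := by
    intro j
    rw [expect_cnt (isStopping_winStart h Y j) (isStopping_winStart h Y (j + 1)), h.density]
    refine (mul_le_mul_of_nonneg_left (expect_window_le h Y j) (by positivity)).trans (le_of_eq ?_)
    change k i / L * (L * _ - _) = _
    field_simp
  have h3 : (∑ j : Fin d, 𝔼 X : Fin ℓ → I, if winStart T k X Y j ≤ ℓ then (1 : ℝ) else 0) ≤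
      (𝔼 X : Fin ℓ → I, completed T k X Y) + 1 := by
    rw [← Finset.expect_sum_comm]
    refine (Finset.expect_le_expect fun X _ => sum_winStart_le X Y).trans ?_
    rw [Finset.expect_add_distrib, Fintype.expect_const]
  have h4 := Finset.sum_le_sum fun (j : Fin d) (_ : j ∈ Finset.univ) => h2 j
  rw [Finset.sum_sub_distrib, ← Finset.mul_sum, ← Finset.mul_sum] at h4
  have h5 := mul_le_mul_of_nonneg_left h3 hk
  have h6 : (𝔼 X : Fin ℓ → I, splits T k X Y) = ∑ j : Fin d,
      𝔼 X : Fin ℓ → I, if arrival X (T (Y (j, false))) (k (Y (j, false))) (winStart T k X Y j) ≠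
        arrival X (T (Y (j, true))) (k (Y (j, true))) (winStart T k X Y j) then (1 : ℝ) else 0 := by
    simp only [splits]; rw [Finset.expect_sum_comm]
  rw [h6]
  linarith

theorem expect_indicator_le_one {Ω : Type} [Fintype Ω] [Nonempty Ω] (P : Ω → Prop)
    [DecidablePred P] : (𝔼 ω, if P ω then (1 : ℝ) else 0) ≤ 1 := by
  refine (Finset.expect_le_expect (g := fun _ => (1 : ℝ)) fun ω _ => ?_).trans
    (Fintype.expect_const _).le
  split_ifs <;> norm_num

/-- If some window is incomplete, the windows exhaust the block, whose length is at least four times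
their expected total length. By Markov's inequality all windows are completed with probability at
least `3/4`. -/
theorem le_expect_completed (h : Exact T k) (a : A) (Y : Fin d × Bool → A)
    (hℓ : 4 * d * itemRatio I A ≤ ℓ) (hℓ0 : 0 < ℓ) :
    3 / 4 * (d : ℝ) ≤ 𝔼 X : Fin ℓ → I, completed T k X Y := by
  have : Nonempty (Fin ℓ → I) := ⟨fun _ => Classical.choice (Fintype.card_pos_iff.1 (h.card_pos a))⟩
  have hL := h.one_le_itemRatio a
  set L := itemRatio I A
  set p := 𝔼 X : Fin ℓ → I, if ¬ winStart T k X Y d ≤ ℓ then (1 : ℝ) else 0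
  have hℓ' : (0 : ℝ) < ℓ := by exact_mod_cast hℓ0
  have h1 : ℓ * p ≤ d * L := by
    have h2 : ∀ X : Fin ℓ → I, (ℓ : ℝ) * (if ¬ winStart T k X Y d ≤ ℓ then (1 : ℝ) else 0) ≤
        ∑ j : Fin d, (cnt X Finset.univ (winStart T k X Y j) (winStart T k X Y (j + 1)) : ℝ) := by
      intro X
      have h3 := sum_cnt_windows h X Y Finset.univ
      have h4 : ((∑ j : Fin d, cnt X Finset.univ (winStart T k X Y j) (winStart T k X Y (j + 1)) : ℕ) : ℝ) =
        cnt X Finset.univ 0 (winStart T k X Y d) := by exact_mod_cast h3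
      push_cast at h4
      rw [h4]
      by_cases h5 : winStart T k X Y d ≤ ℓ
      swap
      · rw [if_pos h5]
        have h6 := cnt_mono_right X Finset.univ 0 (not_le.1 h5).le
        rw [cnt_univ X le_rfl, Nat.sub_zero] at h6
        rw [mul_one]
        exact_mod_cast h6
      · simp [h5]
    have h3 := Finset.expect_le_expect (s := Finset.univ) fun X _ => h2 X
    rw [← Finset.mul_expect, Finset.expect_sum_comm] at h3
    refine h3.trans ((Finset.sum_le_sum (g := fun _ => L) fun j _ => ?_).trans (by simp))
    refine (expect_window_le h Y j).trans ?_
    have h4 := expect_indicator_le_one fun X : Fin ℓ → I => winStart T k X Y j ≤ ℓ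
    have h5 : 0 ≤ 𝔼 X : Fin ℓ → I, if arrival X (T (Y (j, false))) (k (Y (j, false))) (winStart T k X Y j) ≠
        arrival X (T (Y (j, true))) (k (Y (j, true))) (winStart T k X Y j) then (1 : ℝ) else 0 :=
      Finset.expect_nonneg fun _ _ => by split_ifs <;> norm_num
    change L * _ - _ ≤ L
    nlinarith
  have h2 : p ≤ 1 / 4 := by
    refine le_of_mul_le_mul_left ?_ hℓ'
    linarith
  have h3 : ∀ X : Fin ℓ → I, (d : ℝ) - d * (if ¬ winStart T k X Y d ≤ ℓ then (1 : ℝ) else 0) ≤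
      completed T k X Y := by
    intro X
    by_cases h4 : winStart T k X Y d ≤ ℓ
    swap
    · rw [if_pos h4, mul_one, sub_self]
      exact Finset.sum_nonneg fun _ _ => by split_ifs <;> norm_num
    · rw [if_neg (not_not.2 h4), completed, Finset.sum_congr rfl (g := fun _ => (1 : ℝ))]
      · simp
      · exact fun j _ => if_pos ((winStart_mono h X Y (show j.1 + 1 ≤ d from j.2)).trans h4)
  have h4 := Finset.expect_le_expect (s := Finset.univ) fun X _ => h3 X
  rw [Finset.expect_sub_distrib, Fintype.expect_const, ← Finset.mul_expect] at h4
  have : (d : ℝ) * p ≤ d * (1 / 4) := by gcongr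
  linarith

theorem expect_waits_le (h : Exact T k) (Y : Fin d × Bool → A) :
    (𝔼 X : Fin ℓ → I, waits T k X Y) ≤ 2 * d * itemRatio I A := by
  simp only [waits]
  rw [Finset.expect_sum_comm]
  have : ∀ j : Fin d, j ∈ Finset.univ → (𝔼 X : Fin ℓ → I, ((cnt X Finset.univ (winStart T k X Y j)
      (arrival X (T (Y (j, true))) (k (Y (j, true))) (winStart T k X Y j)) : ℝ) +
      cnt X Finset.univ (winStart T k X Y j)
      (arrival X (T (Y (j, false))) (k (Y (j, false))) (winStart T k X Y j)))) ≤
      2 * itemRatio I A := fun j _ => by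
    have h1 := expect_wait_le h (Y (j, true)) (isStopping_winStart (ℓ := ℓ) h Y j)
      fun X => winStart_le X Y j
    have h2 := expect_wait_le h (Y (j, false)) (isStopping_winStart (ℓ := ℓ) h Y j)
      fun X => winStart_le X Y j
    have h3 := add_le_add h1 h2
    rw [← Finset.expect_add_distrib, ← two_mul] at h3
    exact h3
  refine (Finset.sum_le_sum this).trans (le_of_eq ?_)
  simp only [Finset.sum_const, Finset.card_univ, Fintype.card_fin, nsmul_eq_mul]
  ring

theorem expect_sqLengths_le (h : Exact T k) (Y : Fin d × Bool → A) :
    (𝔼 X : Fin ℓ → I, sqLengths T k X Y) ≤ 2 * d * itemRatio I A ^ 2 := by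
  simp only [sqLengths]
  rw [Finset.expect_sum_comm]
  have : ∀ j : Fin d, j ∈ Finset.univ → (𝔼 X : Fin ℓ → I,
      (cnt X Finset.univ (winStart T k X Y j) (winStart T k X Y (j + 1)) : ℝ) ^ 2) ≤
      2 * itemRatio I A ^ 2 := fun j _ => by
    refine le_trans (Finset.expect_le_expect fun X _ => ?_)
      (expect_wait_sq_le h (Y (j, true)) (isStopping_winStart (ℓ := ℓ) h Y j)
        fun X => winStart_le X Y j)
    gcongr
    rw [winStart_succ]
    exact cnt_mono_right _ _ _ (min_le_left _ _)
  refine (Finset.sum_le_sum this).trans (le_of_eq ?_)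
  simp only [Finset.sum_const, Finset.card_univ, Fintype.card_fin, nsmul_eq_mul]
  ring

/-- If agent `i` does not finish where window `j` ends, her time differs from that of one of the
racers. The start of the window does not depend on its racers, so a random `i` can be exchanged with
the other racer; each of the two events then has the probability of a split. -/
theorem expect_misses_le (X : Fin ℓ → I) :
    (𝔼 i : A, 𝔼 Y : Fin d × Bool → A, misses T k i X Y) ≤
      2 * 𝔼 Y : Fin d × Bool → A, splits T k X Y := by
  set st : A → (Fin d × Bool → A) → Fin d → ℕ := fun i Y j =>
    arrival X (T i) (k i) (winStart T k X Y j)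
  have h1 : ∀ i (Y : Fin d × Bool → A), misses T k i X Y ≤ ∑ j : Fin d,
      ((if st i Y j ≠ st (Y (j, true)) Y j then (1 : ℝ) else 0) +
        if st (Y (j, false)) Y j ≠ st i Y j then (1 : ℝ) else 0) := by
    intro i Y
    refine Finset.sum_le_sum fun j _ => ?_
    rw [winStart_succ]
    change (if _ ∧ st i Y j ≠ min (st (Y (j, true)) Y j) (st (Y (j, false)) Y j) then _ else _) ≤ _
    by_cases h1 : st i Y j = st (Y (j, true)) Y j <;>
      by_cases h2 : st (Y (j, false)) Y j = st i Y j
    · rw [if_neg]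
      · split_ifs <;> norm_num
      · rintro ⟨-, h3⟩
        rw [← h1, h2, min_self] at h3
        exact h3 rfl
    all_goals split_ifs <;> norm_num
  have h2 : ∀ j : Fin d, (𝔼 i : A, 𝔼 Y : Fin d × Bool → A,
      if st i Y j ≠ st (Y (j, true)) Y j then (1 : ℝ) else 0) = 𝔼 Y : Fin d × Bool → A,
      if st (Y (j, false)) Y j ≠ st (Y (j, true)) Y j then (1 : ℝ) else 0 := by
    intro j
    rw [← expect_update _ (j, false), Finset.expect_comm]
    refine Finset.expect_congr rfl fun Y _ => Finset.expect_congr rfl fun i _ => ?_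
    have hne : ((j, true) : Fin d × Bool) ≠ (j, false) := by simp
    simp only [st, Function.update_self, Function.update_of_ne hne,
      winStart_update X Y (j, false) i (le_refl j.1)]
  have h3 : ∀ j : Fin d, (𝔼 i : A, 𝔼 Y : Fin d × Bool → A,
      if st (Y (j, false)) Y j ≠ st i Y j then (1 : ℝ) else 0) = 𝔼 Y : Fin d × Bool → A,
      if st (Y (j, false)) Y j ≠ st (Y (j, true)) Y j then (1 : ℝ) else 0 := by
    intro j
    rw [← expect_update _ (j, true), Finset.expect_comm]
    refine Finset.expect_congr rfl fun Y _ => Finset.expect_congr rfl fun i _ => ?_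
    have hne : ((j, false) : Fin d × Bool) ≠ (j, true) := by simp
    simp only [st, Function.update_self, Function.update_of_ne hne,
      winStart_update X Y (j, true) i (le_refl j.1)]
  calc _ ≤ 𝔼 i : A, 𝔼 Y : Fin d × Bool → A, ∑ j : Fin d,
        ((if st i Y j ≠ st (Y (j, true)) Y j then (1 : ℝ) else 0) +
        if st (Y (j, false)) Y j ≠ st i Y j then (1 : ℝ) else 0) :=
        Finset.expect_le_expect fun i _ => Finset.expect_le_expect fun Y _ => h1 i Y
    _ = ∑ j : Fin d, ((𝔼 i : A, 𝔼 Y : Fin d × Bool → A,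
          if st i Y j ≠ st (Y (j, true)) Y j then (1 : ℝ) else 0) +
        𝔼 i : A, 𝔼 Y : Fin d × Bool → A,
          if st (Y (j, false)) Y j ≠ st i Y j then (1 : ℝ) else 0) := by
        simp_rw [Finset.expect_sum_comm, Finset.expect_add_distrib]
    _ = _ := by
        simp only [splits]
        rw [Finset.expect_sum_comm, Finset.mul_sum]
        refine Finset.sum_congr rfl fun j _ => ?_
        rw [h2, h3]
        simp only [st]
        ring

end

end Exploration

/-! ### From independent samples to disjoint blocks. -/

section Transfer

variable {I A J J' : Type} [Fintype I] [DecidableEq I] [Fintype A] [DecidableEq A]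
  [Fintype J] [DecidableEq J] [Fintype J'] [DecidableEq J']

theorem expect_prod {α β : Type} [Fintype α] [Fintype β] (f : α × β → ℝ) :
    (𝔼 p, f p) = 𝔼 a, 𝔼 b, f (a, b) := by
  simp only [Fintype.expect_eq_sum_div_card, Fintype.sum_prod_type, Fintype.card_prod,
    Finset.sum_div]
  refine Finset.sum_congr rfl fun a _ => Finset.sum_congr rfl fun b _ => ?_
  rw [div_div, Nat.cast_mul, mul_comm]

theorem expect_sum_arrow (f : (J → I) → (J' → I) → ℝ) :
    (𝔼 X : J ⊕ J' → I, f (X ∘ Sum.inl) (X ∘ Sum.inr)) = 𝔼 X, 𝔼 X', f X X' := by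
  rw [← expect_prod fun p : (J → I) × (J' → I) => f p.1 p.2]
  exact Fintype.expect_equiv (Equiv.sumArrowEquivProdArrow J J' I) _ _ fun X => rfl

theorem abs_expect_perm_perm_sub_le [Nonempty I] [Nonempty A] (F : (J → I) → (J' → A) → ℝ) {M : ℝ}
    (hF : ∀ X Y, |F X Y| ≤ M) (ι : J ↪ I) (κ : J' ↪ A) :
    |(𝔼 σ : Equiv.Perm I, 𝔼 π : Equiv.Perm A, F (σ ∘ ι) (π ∘ κ)) - 𝔼 X, 𝔼 Y, F X Y| ≤
      2 * M * ((Fintype.card J : ℝ) ^ 2 / Fintype.card I +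
        (Fintype.card J' : ℝ) ^ 2 / Fintype.card A) := by
  have h1 := abs_expect_perm_sub_le (fun X => 𝔼 π : Equiv.Perm A, F X (π ∘ κ))
    (fun X => abs_expect_le fun π => hF X _) ι
  have h2 : |(𝔼 X : J → I, 𝔼 π : Equiv.Perm A, F X (π ∘ κ)) - 𝔼 X, 𝔼 Y, F X Y| ≤
      2 * M * ((Fintype.card J' : ℝ) ^ 2 / Fintype.card A) := by
    rw [← Finset.expect_sub_distrib]
    exact abs_expect_le fun X => abs_expect_perm_sub_le (F X) (hF X) κ
  have h3 := abs_sub_le (𝔼 σ : Equiv.Perm I, 𝔼 π : Equiv.Perm A, F (σ ∘ ι) (π ∘ κ))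
    (𝔼 X : J → I, 𝔼 π : Equiv.Perm A, F X (π ∘ κ)) (𝔼 X, 𝔼 Y, F X Y)
  rw [mul_add]
  linarith

/-- The restriction of an embedding of blocks to one block. -/
def blockEmb {K : ℕ} (ι : Fin K × J ↪ I) (s : Fin K) : J ↪ I :=
  ⟨fun q => ι (s, q), fun q q' h => by simpa using ι.injective h⟩

/-- The restriction of an embedding of blocks to two blocks. -/
def blockPairEmb {K : ℕ} (ι : Fin K × J ↪ I) {s s' : Fin K} (h : s ≠ s') : J ⊕ J ↪ I :=
  ⟨Sum.elim (fun q => ι (s, q)) fun q => ι (s', q), by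
    rintro (q | q) (q' | q') h1 <;> have h2 := ι.injective h1 <;> simp_all [Prod.ext_iff, h.symm]⟩

/-- The total variation distance of a block from independent samples. -/
def blockError (I A J J' : Type) [Fintype I] [Fintype A] [Fintype J] [Fintype J'] : ℝ :=
  (Fintype.card J : ℝ) ^ 2 / Fintype.card I + (Fintype.card J' : ℝ) ^ 2 / Fintype.card A

theorem blockError_nonneg : 0 ≤ blockError I A J J' := by unfold blockError; positivity

theorem abs_expect_block_sub_le [Nonempty I] [Nonempty A] {K : ℕ} (F : (J → I) → (J' → A) → ℝ)
    {M : ℝ} (hF : ∀ X Y, |F X Y| ≤ M) (ι : Fin K × J ↪ I) (κ : Fin K × J' ↪ A) (s : Fin K) :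
    |(𝔼 σ : Equiv.Perm I, 𝔼 π : Equiv.Perm A, F (σ ∘ blockEmb ι s) (π ∘ blockEmb κ s)) -
      𝔼 X, 𝔼 Y, F X Y| ≤ 2 * M * blockError I A J J' :=
  abs_expect_perm_perm_sub_le F hF _ _

/-- For independent samples the expectation is zero. Two disjoint blocks form one sample of double
size without replacement, so its error is four times as large; with the product bounded by `4M²`
this gives `2 · 4M² · 4`. -/
theorem expect_centered_mul_le [Nonempty I] [Nonempty A] {K : ℕ} (F : (J → I) → (J' → A) → ℝ)
    {M μ : ℝ} (hF : ∀ X Y, |F X Y| ≤ M) (hμ : (𝔼 X, 𝔼 Y, F X Y) = μ)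
    (ι : Fin K × J ↪ I) (κ : Fin K × J' ↪ A) {s s' : Fin K} (h : s ≠ s') :
    (𝔼 σ : Equiv.Perm I, 𝔼 π : Equiv.Perm A,
      (F (σ ∘ blockEmb ι s) (π ∘ blockEmb κ s) - μ) *
        (F (σ ∘ blockEmb ι s') (π ∘ blockEmb κ s') - μ)) ≤ 32 * M ^ 2 * blockError I A J J' := by
  have hJ : Nonempty (J → I) := ⟨fun _ => Classical.arbitrary I⟩
  have hJ' : Nonempty (J' → A) := ⟨fun _ => Classical.arbitrary A⟩
  have hμM : |μ| ≤ M := hμ ▸ abs_expect_le fun X => abs_expect_le fun Y => hF X Y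
  have h2 : ∀ X Y, |F X Y - μ| ≤ 2 * M := fun X Y => by
    have := abs_sub (F X Y) μ
    have := hF X Y
    linarith
  set G : (J ⊕ J → I) → (J' ⊕ J' → A) → ℝ := fun X Y =>
    (F (X ∘ Sum.inl) (Y ∘ Sum.inl) - μ) * (F (X ∘ Sum.inr) (Y ∘ Sum.inr) - μ)
  have hG : ∀ X Y, |G X Y| ≤ 4 * M ^ 2 := fun X Y => by
    rw [abs_mul]
    have h3 := mul_le_mul (h2 (X ∘ Sum.inl) (Y ∘ Sum.inl)) (h2 (X ∘ Sum.inr) (Y ∘ Sum.inr))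
      (abs_nonneg _) (by linarith [abs_nonneg μ])
    linarith
  have h3 := abs_expect_perm_perm_sub_le G hG (blockPairEmb ι h) (blockPairEmb κ h)
  have h4 : (𝔼 X, 𝔼 Y, G X Y) = 0 := by
    have e1 : ∀ X : J ⊕ J → I, (𝔼 Y, G X Y) = ((𝔼 Y, F (X ∘ Sum.inl) Y) - μ) *
        ((𝔼 Y, F (X ∘ Sum.inr) Y) - μ) := by
      intro X
      rw [expect_sum_arrow fun Y Y' => (F (X ∘ Sum.inl) Y - μ) * (F (X ∘ Sum.inr) Y' - μ)]
      simp_rw [← Finset.mul_expect, ← Finset.expect_mul, Finset.expect_sub_distrib,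
        Fintype.expect_const]
    simp_rw [e1]
    rw [expect_sum_arrow fun X X' => ((𝔼 Y, F X Y) - μ) * ((𝔼 Y, F X' Y) - μ)]
    simp_rw [← Finset.mul_expect, ← Finset.expect_mul, Finset.expect_sub_distrib,
        Fintype.expect_const, hμ]
    simp
  rw [h4, sub_zero] at h3
  refine (le_abs_self _).trans (h3.trans (le_of_eq ?_))
  simp only [Fintype.card_sum, blockError]
  push_cast
  ring

/-- Expanding the square, the diagonal contributes `4M²` per block, and distinct blocks are almost
uncorrelated. -/
theorem expect_sq_sum_blocks_le [Nonempty I] [Nonempty A] {K : ℕ} (F : (J → I) → (J' → A) → ℝ)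
    {M μ : ℝ} (hF : ∀ X Y, |F X Y| ≤ M) (hμ : (𝔼 X, 𝔼 Y, F X Y) = μ)
    (ι : Fin K × J ↪ I) (κ : Fin K × J' ↪ A) :
    (𝔼 σ : Equiv.Perm I, 𝔼 π : Equiv.Perm A,
      ((∑ s, F (σ ∘ blockEmb ι s) (π ∘ blockEmb κ s)) - K * μ) ^ 2) ≤
      4 * M ^ 2 * K + 32 * M ^ 2 * blockError I A J J' * K ^ 2 := by
  have hJ : Nonempty (J → I) := ⟨fun _ => Classical.arbitrary I⟩
  have hJ' : Nonempty (J' → A) := ⟨fun _ => Classical.arbitrary A⟩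
  have hμM : |μ| ≤ M := hμ ▸ abs_expect_le fun X => abs_expect_le fun Y => hF X Y
  have h2 : ∀ X Y, |F X Y - μ| ≤ 2 * M := fun X Y => by
    have := abs_sub (F X Y) μ
    have := hF X Y
    linarith
  set Z : Equiv.Perm I → Equiv.Perm A → Fin K → ℝ := fun σ π s =>
    F (σ ∘ blockEmb ι s) (π ∘ blockEmb κ s) - μ
  have h3 : ∀ (σ : Equiv.Perm I) (π : Equiv.Perm A), ((∑ s, F (σ ∘ blockEmb ι s) (π ∘ blockEmb κ s)) - K * μ) ^ 2 =
      ∑ s, ∑ s', Z σ π s * Z σ π s' := by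
    intro σ π
    have : (∑ s, F (σ ∘ blockEmb ι s) (π ∘ blockEmb κ s)) - K * μ = ∑ s, Z σ π s := by
      simp only [Z, Finset.sum_sub_distrib, Finset.sum_const, Finset.card_univ, Fintype.card_fin,
        nsmul_eq_mul]
    rw [this, sq, Finset.sum_mul_sum]
  simp_rw [h3, Finset.expect_sum_comm]
  have hη := blockError_nonneg (I := I) (A := A) (J := J) (J' := J')
  have h4 : ∀ s s', (𝔼 σ, 𝔼 π, Z σ π s * Z σ π s') ≤
      (if s = s' then 4 * M ^ 2 else 0) + 32 * M ^ 2 * blockError I A J J' := by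
    intro s s'
    split_ifs with h
    · subst h
      have h5 : (𝔼 σ, 𝔼 π, Z σ π s * Z σ π s) ≤ 4 * M ^ 2 := by
        refine (le_abs_self _).trans (abs_expect_le fun σ => abs_expect_le fun π => ?_)
        rw [abs_mul]
        have h5 := h2 (σ ∘ blockEmb ι s) (π ∘ blockEmb κ s)
        have h3 := mul_le_mul h5 h5 (abs_nonneg _) (by linarith [abs_nonneg μ])
        linarith
      have : 0 ≤ 32 * M ^ 2 * blockError I A J J' := by positivity
      linarith
    · rw [zero_add]
      exact expect_centered_mul_le F hF hμ ι κ h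
  refine (Finset.sum_le_sum fun s _ => Finset.sum_le_sum fun s' _ => h4 s s').trans (le_of_eq ?_)
  simp only [Finset.sum_add_distrib, Finset.sum_ite_eq, Finset.mem_univ, if_true, Finset.sum_const,
    Finset.card_univ, Fintype.card_fin, nsmul_eq_mul]
  ring

end Transfer

/-! ### Bounds on the statistics of a single block. -/

section Bounds

variable {ℓ d : ℕ} {I A : Type} [Fintype I] [DecidableEq I] [Fintype A] [DecidableEq A]
  {T : A → Finset I} {k : A → ℕ}

theorem completed_nonneg (X : Fin ℓ → I) (Y : Fin d × Bool → A) : 0 ≤ completed T k X Y :=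
  Finset.sum_nonneg fun _ _ => by split_ifs <;> norm_num

theorem completed_le (X : Fin ℓ → I) (Y : Fin d × Bool → A) : completed T k X Y ≤ d := by
  refine (Finset.sum_le_sum (g := fun _ => (1 : ℝ)) fun j _ => ?_).trans (by simp)
  split_ifs <;> norm_num

theorem misses_nonneg (i : A) (X : Fin ℓ → I) (Y : Fin d × Bool → A) : 0 ≤ misses T k i X Y :=
  Finset.sum_nonneg fun _ _ => by split_ifs <;> norm_num

theorem misses_le (i : A) (X : Fin ℓ → I) (Y : Fin d × Bool → A) : misses T k i X Y ≤ d := by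
  refine (Finset.sum_le_sum (g := fun _ => (1 : ℝ)) fun j _ => ?_).trans (by simp)
  split_ifs <;> norm_num

theorem abs_excess_le (h : Exact T k) (i : A) (X : Fin ℓ → I) (Y : Fin d × Bool → A)
    (hℓ : d * itemRatio I A ≤ ℓ) : |excess T k i X Y| ≤ ℓ := by
  have hk := h.le_itemRatio i
  have hk0 : (0 : ℝ) ≤ k i := by positivity
  refine abs_le.2 ⟨?_, ?_⟩
  · calc -(ℓ : ℝ) ≤ -(d * k i) := by
          have : (d : ℝ) * k i ≤ d * itemRatio I A := by gcongr
          linarith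
      _ = ∑ _j : Fin d, -(k i : ℝ) := by simp
      _ ≤ _ := Finset.sum_le_sum fun j _ => by
          have : (0 : ℝ) ≤ cnt X (T i) (winStart T k X Y j) (winStart T k X Y (j + 1)) := by positivity
          split_ifs <;> linarith
  · calc excess T k i X Y
        ≤ ∑ j : Fin d, (cnt X (T i) (winStart T k X Y j) (winStart T k X Y (j + 1)) : ℝ) :=
          Finset.sum_le_sum fun j _ => by
            have : (0 : ℝ) ≤ cnt X (T i) (winStart T k X Y j) (winStart T k X Y (j + 1)) := by positivity
            split_ifs <;> linarith
      _ = cnt X (T i) 0 (winStart T k X Y d) := by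
          exact_mod_cast sum_cnt_windows h X Y (T i)
      _ ≤ ℓ := by exact_mod_cast cnt_le _ _ _ _

theorem waits_nonneg (X : Fin ℓ → I) (Y : Fin d × Bool → A) : 0 ≤ waits T k X Y :=
  Finset.sum_nonneg fun _ _ => by positivity

theorem waits_le (X : Fin ℓ → I) (Y : Fin d × Bool → A) : waits T k X Y ≤ 2 * d * ℓ := by
  refine (Finset.sum_le_sum (g := fun _ => (2 * ℓ : ℝ)) fun j _ => ?_).trans (le_of_eq ?_)
  · have h1 : ∀ s r, (cnt X Finset.univ s r : ℝ) ≤ ℓ := fun s r => by exact_mod_cast cnt_le _ _ _ _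
    have := h1 (winStart T k X Y j) (arrival X (T (Y (j, true))) (k (Y (j, true))) (winStart T k X Y j))
    have := h1 (winStart T k X Y j) (arrival X (T (Y (j, false))) (k (Y (j, false))) (winStart T k X Y j))
    linarith
  · simp; ring

theorem sqLengths_nonneg (X : Fin ℓ → I) (Y : Fin d × Bool → A) : 0 ≤ sqLengths T k X Y :=
  Finset.sum_nonneg fun _ _ => by positivity

theorem sqLengths_le (X : Fin ℓ → I) (Y : Fin d × Bool → A) : sqLengths T k X Y ≤ d * ℓ ^ 2 := by
  refine (Finset.sum_le_sum (g := fun _ => (ℓ ^ 2 : ℝ)) fun j _ => ?_).trans (le_of_eq ?_)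
  · have h1 : (cnt X Finset.univ (winStart T k X Y j) (winStart T k X Y (j + 1)) : ℝ) ≤ ℓ := by
      exact_mod_cast cnt_le _ _ _ _
    gcongr
  · simp

end Bounds

/-! ### The dichotomy for the number of deprived agents. -/

section BlockSums

variable {ℓ d K : ℕ} {I A : Type} [Fintype I] [DecidableEq I] [Fintype A] [DecidableEq A]
  {T : A → Finset I} {k : A → ℕ}

/-- The sum of a statistic over all blocks. -/
def blockSum (F : (Fin ℓ → I) → (Fin d × Bool → A) → ℝ) (ι : Fin K × Fin ℓ ↪ I)
    (κ : Fin K × (Fin d × Bool) ↪ A) (σ : Equiv.Perm I) (π : Equiv.Perm A) : ℝ :=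
  ∑ s, F (σ ∘ blockEmb ι s) (π ∘ blockEmb κ s)

theorem abs_expect_blockSum_sub_le [Nonempty I] [Nonempty A]
    (F : (Fin ℓ → I) → (Fin d × Bool → A) → ℝ) {M : ℝ} (hF : ∀ X Y, |F X Y| ≤ M)
    (ι : Fin K × Fin ℓ ↪ I) (κ : Fin K × (Fin d × Bool) ↪ A) :
    |(𝔼 σ, 𝔼 π, blockSum F ι κ σ π) - K * 𝔼 X, 𝔼 Y, F X Y| ≤
      K * (2 * M * blockError I A (Fin ℓ) (Fin d × Bool)) := by
  have h1 : (𝔼 σ, 𝔼 π, blockSum F ι κ σ π) - K * (𝔼 X, 𝔼 Y, F X Y) =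
      ∑ s : Fin K, ((𝔼 σ : Equiv.Perm I, 𝔼 π : Equiv.Perm A,
        F (σ ∘ blockEmb ι s) (π ∘ blockEmb κ s)) - 𝔼 X, 𝔼 Y, F X Y) := by
    simp only [blockSum]
    simp_rw [Finset.expect_sum_comm]
    rw [Finset.sum_sub_distrib]
    simp
  rw [h1]
  refine (Finset.abs_sum_le_sum_abs _ _).trans
    ((Finset.sum_le_sum fun s _ => abs_expect_block_sub_le F hF ι κ s).trans (by simp))

/-- Few agents like substantially more items in the windows than their shares: if the windows often
end at a position where the competing agent does not see her share, then the windows contain few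
items that an agent likes, and otherwise few windows do not end where an agent sees her share. -/
theorem expect_card_deprived_le [Nonempty A] (h : Exact T k) (ι : Fin K × Fin ℓ ↪ I)
    (κ : Fin K × (Fin d × Bool) ↪ A) (hℓ : d * itemRatio I A ≤ ℓ) {y f V : ℝ} (hy : 0 < y)
    (hf : 0 < f) (hKf : itemRatio I A * K ≤ f / 4)
    (hV : 4 * (ℓ : ℝ) ^ 2 * K + 32 * (ℓ : ℝ) ^ 2 * blockError I A (Fin ℓ) (Fin d × Bool) * K ^ 2 ≤ V) :
    (𝔼 σ, 𝔼 π, ∑ i, if 0 < blockSum (excess T k i) ι κ σ π ∧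
      f < blockSum (excess T k i) ι κ σ π + blockSum (misses T k i) ι κ σ π then (1 : ℝ) else 0) ≤
    Fintype.card A * (V / y ^ 2 + 16 * V / f ^ 2 + 2 / f * (4 * itemRatio I A * (y + K) +
      2 * K * d * blockError I A (Fin ℓ) (Fin d × Bool))) := by
  set a₀ : A := Classical.arbitrary A
  have : Nonempty I := Fintype.card_pos_iff.1 (h.card_pos a₀)
  have hJ : Nonempty (Fin ℓ → I) := ⟨fun _ => Classical.arbitrary I⟩
  have hJ' : Nonempty (Fin d × Bool → A) := ⟨fun _ => Classical.arbitrary A⟩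
  set η := blockError I A (Fin ℓ) (Fin d × Bool)
  have hη : 0 ≤ η := blockError_nonneg
  set L := itemRatio I A
  have hL : 1 ≤ L := h.one_le_itemRatio a₀
  set u : ℝ := (Fintype.card A : ℝ)
  have hu : 0 < u := by simp only [u]; exact_mod_cast Fintype.card_pos
  set G := 𝔼 X : Fin ℓ → I, 𝔼 Y : Fin d × Bool → A, splits T k X Y
  set μ : A → ℝ := fun i => 𝔼 X : Fin ℓ → I, 𝔼 Y : Fin d × Bool → A, excess T k i X Y
  have hμ : ∀ i, μ i ≤ k i - k i / (2 * L) * G := by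
    intro i
    have h1 : μ i = 𝔼 Y : Fin d × Bool → A, 𝔼 X : Fin ℓ → I, excess T k i X Y :=
      Finset.expect_comm _ _ _
    have h2 : G = 𝔼 Y : Fin d × Bool → A, 𝔼 X : Fin ℓ → I, splits T k X Y :=
      Finset.expect_comm _ _ _
    rw [h1, h2]
    refine (Finset.expect_le_expect fun Y _ => expect_excess_le h i Y).trans ?_
    rw [Finset.expect_sub_distrib, Fintype.expect_const, ← Finset.mul_expect]
  have hG : 0 ≤ G := Finset.expect_nonneg fun X _ => Finset.expect_nonneg fun Y _ =>
    Finset.sum_nonneg fun _ _ => by split_ifs <;> norm_num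
  set Z : A → Equiv.Perm I → Equiv.Perm A → ℝ := fun i => blockSum (excess T k i) ι κ
  set N : A → Equiv.Perm I → Equiv.Perm A → ℝ := fun i => blockSum (misses T k i) ι κ
  have hZ : ∀ i, (𝔼 σ, 𝔼 π, (Z i σ π - K * μ i) ^ 2) ≤ V := fun i =>
    (expect_sq_sum_blocks_le (excess T k i) (fun X Y => abs_excess_le h i X Y hℓ) rfl ι κ).trans hV
  have hV0 : 0 ≤ V := le_trans (by positivity) hV
  have hK : (0 : ℝ) ≤ K := by positivity
  have hN0 : ∀ i σ π, 0 ≤ N i σ π := fun i σ π =>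
    Finset.sum_nonneg fun s _ => misses_nonneg i _ _
  have hpos : 0 ≤ 2 / f * (4 * L * (y + K) + 2 * K * d * η) := by positivity
  -- If there are many splits, the expected total excess of every agent is at most `-y`, so a
  -- positive excess is a deviation by `y`, and Chebyshev's inequality applies.
  rcases le_or_gt (y + K) (K * G / (2 * L)) with hc | hc
  · have h1 : ∀ i σ π, (if 0 < Z i σ π ∧ f < Z i σ π + N i σ π then (1 : ℝ) else 0) ≤
        (Z i σ π - K * μ i) ^ 2 / y ^ 2 := by
      intro i σ π
      split_ifs with h1
      · have hk : (1 : ℝ) ≤ k i := by exact_mod_cast h.pos i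
        have h2 : K * μ i ≤ k i * (K - K * G / (2 * L)) := by
          calc K * μ i ≤ K * (k i - k i / (2 * L) * G) := mul_le_mul_of_nonneg_left (hμ i) hK
            _ = _ := by ring
        have h3 : K * μ i ≤ -y := by nlinarith
        rw [one_le_div (by positivity)]
        exact pow_le_pow_left₀ hy.le (by linarith [h1.1]) 2
      · positivity
    calc _ ≤ 𝔼 σ, 𝔼 π, ∑ i, (Z i σ π - K * μ i) ^ 2 / y ^ 2 :=
          Finset.expect_le_expect fun σ _ => Finset.expect_le_expect fun π _ =>
            Finset.sum_le_sum fun i _ => h1 i σ π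
      _ = ∑ i, (𝔼 σ, 𝔼 π, (Z i σ π - K * μ i) ^ 2) / y ^ 2 := by
          simp_rw [Finset.expect_sum_comm, Finset.expect_div]
      _ ≤ ∑ _i : A, V / y ^ 2 := Finset.sum_le_sum fun i _ =>
          div_le_div_of_nonneg_right (hZ i) (by positivity)
      _ = u * (V / y ^ 2) := by simp [u]
      _ ≤ _ := by
          refine mul_le_mul_of_nonneg_left ?_ hu.le
          have : 0 ≤ 16 * V / f ^ 2 := by positivity
          linarith
  -- If there are few splits, there are few misses on average over the agents. A counted agent has
  -- excess at least `f/2`, which deviates by `f/4` from a mean of at most `f/4` (Chebyshev), or at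
  -- least `f/2` misses (Markov).
  · have hc' : K * G ≤ 2 * L * (y + K) := by
      rw [div_lt_iff₀ (by linarith)] at hc; linarith
    have h1 : ∀ i σ π, (if 0 < Z i σ π ∧ f < Z i σ π + N i σ π then (1 : ℝ) else 0) ≤
        16 * (Z i σ π - K * μ i) ^ 2 / f ^ 2 + 2 / f * N i σ π := by
      intro i σ π
      have hN := hN0 i σ π
      split_ifs with h1
      · have h2 : K * μ i ≤ f / 4 := by
          have h3 : μ i ≤ L := by
            have : 0 ≤ k i / (2 * L) * G := by positivity
            linarith [hμ i, h.le_itemRatio i]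
          calc K * μ i ≤ K * L := by gcongr
            _ ≤ _ := by linarith
        rcases le_or_gt (f / 2) (Z i σ π) with h3 | h3
        · have h4 : 1 ≤ 16 * (Z i σ π - K * μ i) ^ 2 / f ^ 2 := by
            rw [one_le_div (by positivity)]
            have := pow_le_pow_left₀ (by positivity) (show f / 4 ≤ Z i σ π - K * μ i by linarith) 2
            linarith
          have : 0 ≤ 2 / f * N i σ π := by positivity
          linarith
        · have h4 : 1 ≤ 2 / f * N i σ π := by
            rw [div_mul_eq_mul_div, one_le_div hf]; linarith [h1.2]
          have : 0 ≤ 16 * (Z i σ π - K * μ i) ^ 2 / f ^ 2 := by positivity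
          linarith
      · positivity
    have h2 : ∑ i, (𝔼 σ, 𝔼 π, N i σ π) ≤ u * (2 * K * G + 2 * K * d * η) := by
      have h3 : ∀ i, (𝔼 σ, 𝔼 π, N i σ π) ≤ K * (𝔼 X : Fin ℓ → I, 𝔼 Y : Fin d × Bool → A, misses T k i X Y) + 2 * K * d * η := by
        intro i
        have h4 := (abs_le.1 (abs_expect_blockSum_sub_le (ℓ := ℓ) (d := d) (misses T k i) (M := d) (fun X Y => by
          rw [abs_of_nonneg (misses_nonneg i X Y)]; exact misses_le i X Y) ι κ)).2
        change (𝔼 σ, 𝔼 π, N i σ π) - _ ≤ K * (2 * d * η) at h4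
        linarith
      have h5 : ∑ i, (𝔼 X : Fin ℓ → I, 𝔼 Y : Fin d × Bool → A, misses T k i X Y) ≤ u * (2 * G) := by
        have h6 : (𝔼 X : Fin ℓ → I, 𝔼 i : A, 𝔼 Y : Fin d × Bool → A, misses T k i X Y) ≤ 2 * G := by
          refine (Finset.expect_le_expect fun X _ => expect_misses_le X).trans ?_
          rw [← Finset.mul_expect]
        rw [Finset.expect_comm, Fintype.expect_eq_sum_div_card, div_le_iff₀ hu] at h6
        linarith
      refine (Finset.sum_le_sum fun i _ => h3 i).trans ?_
      rw [Finset.sum_add_distrib, ← Finset.mul_sum]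
      have h7 := mul_le_mul_of_nonneg_left h5 hK
      simp only [Finset.sum_const, Finset.card_univ, nsmul_eq_mul]
      change _ + u * _ ≤ _
      linarith
    calc _ ≤ 𝔼 σ, 𝔼 π, ∑ i, (16 * (Z i σ π - K * μ i) ^ 2 / f ^ 2 + 2 / f * N i σ π) :=
          Finset.expect_le_expect fun σ _ => Finset.expect_le_expect fun π _ =>
            Finset.sum_le_sum fun i _ => h1 i σ π
      _ = ∑ i, (16 * (𝔼 σ, 𝔼 π, (Z i σ π - K * μ i) ^ 2) / f ^ 2 + 2 / f * 𝔼 σ, 𝔼 π, N i σ π) := by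
          simp_rw [Finset.expect_sum_comm, Finset.expect_add_distrib, ← Finset.mul_expect,
            ← Finset.expect_div, ← Finset.mul_expect]
      _ ≤ ∑ i, (16 * V / f ^ 2 + 2 / f * 𝔼 σ, 𝔼 π, N i σ π) := Finset.sum_le_sum fun i _ => by
          have := hZ i
          gcongr
      _ = u * (16 * V / f ^ 2) + 2 / f * ∑ i, 𝔼 σ, 𝔼 π, N i σ π := by
          rw [Finset.sum_add_distrib, ← Finset.mul_sum]; simp [u]
      _ ≤ u * (16 * V / f ^ 2) + 2 / f * (u * (2 * K * G + 2 * K * d * η)) := by gcongr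
      _ ≤ u * (16 * V / f ^ 2) + 2 / f * (u * (4 * L * (y + K) + 2 * K * d * η)) := by
          have h6 : 2 * (K : ℝ) * G ≤ 4 * L * (y + K) := by linarith
          have h7 := mul_le_mul_of_nonneg_left (mul_le_mul_of_nonneg_left
            (add_le_add_left h6 (2 * K * d * η)) hu.le) (show 0 ≤ 2 / f by positivity)
          linarith
      _ ≤ _ := by
          have : 0 ≤ u * (V / y ^ 2) := by positivity
          linarith

end BlockSums

/-! ### The choice of the parameters. -/

section Tuning

variable {I A : Type} [Fintype I] [DecidableEq I] [Fintype A] [DecidableEq A]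
  {T : A → Finset I} {k : A → ℕ} {g L : ℕ}

/-- The parameters of the exploration: `L` is the number of items per agent up to a factor two, and
the number of agents is much larger than `g`. -/
structure Tuned (I A : Type) [Fintype I] [Fintype A] (g L : ℕ) : Prop where
  large : 64 ≤ g
  le_large : L ≤ g
  ratio_le : itemRatio I A ≤ L
  le_ratio : (L : ℝ) ≤ 2 * itemRatio I A
  one_le_ratio : 1 ≤ itemRatio I A
  pow_le : g ^ 24 ≤ Fintype.card A

/-- The number of blocks. -/
def blockCount (A : Type) [Fintype A] (g : ℕ) : ℕ := Fintype.card A / (16 * g ^ 4)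

namespace Tuned

theorem pow_pos (h : Tuned I A g L) (e : ℕ) : (0 : ℝ) < (g : ℝ) ^ e := by
  have : (64 : ℝ) ≤ g := by exact_mod_cast h.large
  positivity

theorem pow_le_card (h : Tuned I A g L) : (g : ℝ) ^ 24 ≤ Fintype.card A := by
  exact_mod_cast h.pow_le

theorem card_pos (h : Tuned I A g L) : (0 : ℝ) < Fintype.card A :=
  (h.pow_pos 24).trans_le h.pow_le_card

theorem blockCount_mul_le (_h : Tuned I A g L) :
    (blockCount A g : ℝ) * (g : ℝ) ^ 4 ≤ Fintype.card A / 16 := by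
  have h1 : blockCount A g * (16 * g ^ 4) ≤ Fintype.card A := Nat.div_mul_le_self _ _
  have h2 : (blockCount A g : ℝ) * (16 * (g : ℝ) ^ 4) ≤ Fintype.card A := by exact_mod_cast h1
  linarith

theorem le_blockCount_mul (h : Tuned I A g L) :
    (Fintype.card A : ℝ) / 16 - (g : ℝ) ^ 4 ≤ blockCount A g * (g : ℝ) ^ 4 := by
  have h0 : 0 < 16 * g ^ 4 := by have := h.large; positivity
  have h1 : Fintype.card A < 16 * g ^ 4 * (blockCount A g + 1) := Nat.lt_mul_div_succ _ h0
  have h2 : (Fintype.card A : ℝ) < 16 * (g : ℝ) ^ 4 * (blockCount A g + 1) := by exact_mod_cast h1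
  linarith

/-- The number of items is `itemRatio` times the number of agents. This cancels one of the two
factors `L` in the squared block length; the other one is at most `g`. -/
theorem blockError_le (h : Tuned I A g L) :
    blockError I A (Fin (4 * g ^ 4 * L)) (Fin (g ^ 4) × Bool) ≤ 33 * (g : ℝ) ^ 9 / Fintype.card A := by
  have hu := h.card_pos
  have hg : (64 : ℝ) ≤ g := by exact_mod_cast h.large
  have hL : (L : ℝ) ≤ g := by exact_mod_cast h.le_large
  have hr := h.one_le_ratio
  have hI : (Fintype.card I : ℝ) = Fintype.card A * itemRatio I A := by
    rw [itemRatio]; field_simp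
  simp only [blockError, Fintype.card_fin, Fintype.card_prod, Fintype.card_bool]
  push_cast
  rw [hI]
  have h1 : (4 * (g : ℝ) ^ 4 * L) ^ 2 / (Fintype.card A * itemRatio I A) ≤
      32 * (g : ℝ) ^ 9 / Fintype.card A := by
    rw [div_le_div_iff₀ (by positivity) hu]
    have h2 : (L : ℝ) ^ 2 ≤ 2 * g * itemRatio I A := by nlinarith [h.le_ratio]
    calc (4 * (g : ℝ) ^ 4 * L) ^ 2 * Fintype.card A = 16 * (g : ℝ) ^ 8 * Fintype.card A * L ^ 2 := by
          ring
      _ ≤ 16 * (g : ℝ) ^ 8 * Fintype.card A * (2 * g * itemRatio I A) := by gcongr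
      _ = _ := by ring
  have h2 : ((g : ℝ) ^ 4 * 2) ^ 2 / Fintype.card A ≤ (g : ℝ) ^ 9 / Fintype.card A := by
    refine div_le_div_of_nonneg_right ?_ hu.le
    have : (0 : ℝ) ≤ (g : ℝ) ^ 8 := by positivity
    nlinarith
  refine (add_le_add h1 h2).trans (le_of_eq ?_)
  ring

theorem mul_blockError_le (h : Tuned I A g L) {c : ℝ} (hc : c ≤ (g : ℝ) ^ 13) :
    c * blockError I A (Fin (4 * g ^ 4 * L)) (Fin (g ^ 4) × Bool) ≤ 1 / 64 := by
  have hu := h.card_pos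
  have hg : (64 : ℝ) ≤ g := by exact_mod_cast h.large
  have h2 : 64 * (33 * (g : ℝ) ^ 22) ≤ (g : ℝ) ^ 24 := by
    rw [show (g : ℝ) ^ 24 = g ^ 2 * (g : ℝ) ^ 22 by ring, ← mul_assoc]
    gcongr
    nlinarith
  calc _ ≤ (g : ℝ) ^ 13 * (33 * (g : ℝ) ^ 9 / Fintype.card A) :=
        mul_le_mul hc h.blockError_le blockError_nonneg (by positivity)
    _ = 33 * (g : ℝ) ^ 22 / Fintype.card A := by ring
    _ ≤ 1 / 64 := by
        rw [div_le_div_iff₀ hu (by norm_num)]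
        linarith [h.pow_le_card]

theorem length_le (h : Tuned I A g L) : (4 * (g : ℝ) ^ 4 * L) ≤ (g : ℝ) ^ 6 := by
  have hg : (64 : ℝ) ≤ g := by exact_mod_cast h.large
  have hL : (L : ℝ) ≤ g := by exact_mod_cast h.le_large
  calc (4 * (g : ℝ) ^ 4 * L) ≤ g * (g : ℝ) ^ 4 * g := by gcongr; linarith
    _ = _ := by ring

theorem sq_length_le (h : Tuned I A g L) : (4 * (g : ℝ) ^ 4 * L) ^ 2 ≤ 16 * (g : ℝ) ^ 10 := by
  have hL : (L : ℝ) ≤ g := by exact_mod_cast h.le_large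
  calc (4 * (g : ℝ) ^ 4 * L) ^ 2 ≤ (4 * (g : ℝ) ^ 4 * g) ^ 2 := by gcongr
    _ = _ := by ring

variable (ι : Fin (blockCount A g) × Fin (4 * g ^ 4 * L) ↪ I)
  (κ : Fin (blockCount A g) × (Fin (g ^ 4) × Bool) ↪ A)

/-- With `u` agents, `f = u/g` and `y = u/g⁴`. This `y` is so small that in the case of few splits
only a small fraction of the agents misses often, and large compared to the standard deviation,
which is of order `√(u g¹¹)`; the latter uses `u ≥ g²⁴`. -/
theorem expect_deprived_le [Nonempty A] (h : Tuned I A g L) (hT : Exact T k) :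
    (𝔼 σ, 𝔼 π, ∑ i, if 0 < blockSum (excess T k i) ι κ σ π ∧
      (Fintype.card A : ℝ) / g < blockSum (excess T k i) ι κ σ π + blockSum (misses T k i) ι κ σ π
      then (1 : ℝ) else 0) ≤ Fintype.card A / g := by
  have hu := h.card_pos
  have hg : (64 : ℝ) ≤ g := by exact_mod_cast h.large
  have hL : (L : ℝ) ≤ g := by exact_mod_cast h.le_large
  have hr := h.one_le_ratio
  have hrg : itemRatio I A ≤ g := h.ratio_le.trans hL
  have hug := h.pow_le_card
  have hK := h.blockCount_mul_le
  have hη : 0 ≤ blockError I A (Fin (4 * g ^ 4 * L)) (Fin (g ^ 4) × Bool) := blockError_nonneg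
  have hη' := h.blockError_le
  set u : ℝ := (Fintype.card A : ℝ)
  set K : ℝ := (blockCount A g : ℝ)
  have hK0 : 0 ≤ K := by positivity
  have hK' : K ≤ u / (16 * (g : ℝ) ^ 4) := by
    rw [le_div_iff₀ (by positivity)]; linarith
  have hV : 4 * ((4 * g ^ 4 * L : ℕ) : ℝ) ^ 2 * K + 32 * ((4 * g ^ 4 * L : ℕ) : ℝ) ^ 2 *
      blockError I A (Fin (4 * g ^ 4 * L)) (Fin (g ^ 4) × Bool) * K ^ 2 ≤ 67 * u * (g : ℝ) ^ 11 := by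
    push_cast
    have h1 := h.sq_length_le
    calc _ ≤ 4 * (16 * (g : ℝ) ^ 10) * (u / (16 * (g : ℝ) ^ 4)) +
          32 * (16 * (g : ℝ) ^ 10) * (33 * (g : ℝ) ^ 9 / u) * (u / (16 * (g : ℝ) ^ 4)) ^ 2 := by gcongr
      _ = 4 * u * (g : ℝ) ^ 6 + 66 * u * (g : ℝ) ^ 11 := by field_simp; ring
      _ ≤ 1 * u * (g : ℝ) ^ 11 + 66 * u * (g : ℝ) ^ 11 := by
          have : 4 * u * (g : ℝ) ^ 6 ≤ 1 * u * (g : ℝ) ^ 11 := by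
            rw [show 1 * u * (g : ℝ) ^ 11 = g ^ 5 * u * (g : ℝ) ^ 6 by ring]
            gcongr
            nlinarith [pow_le_pow_left₀ (by norm_num) hg 5]
          linarith
      _ = _ := by ring
  have hKf : itemRatio I A * K ≤ u / g / 4 := by
    calc itemRatio I A * K ≤ g * (u / (16 * (g : ℝ) ^ 4)) := by gcongr
      _ = u / g / 4 * (1 / (4 * (g : ℝ) ^ 2)) := by field_simp; ring
      _ ≤ u / g / 4 * 1 := by
          gcongr
          rw [div_le_one (by positivity)]
          nlinarith
      _ = _ := mul_one _
  have hℓ : ((g ^ 4 : ℕ) : ℝ) * itemRatio I A ≤ ((4 * g ^ 4 * L : ℕ) : ℝ) := by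
    push_cast
    have := mul_le_mul_of_nonneg_left h.ratio_le (h.pow_pos 4).le
    have : 0 ≤ (g : ℝ) ^ 4 * L := by positivity
    linarith
  refine (expect_card_deprived_le hT ι κ hℓ (y := u / (g : ℝ) ^ 4) (f := u / g) (by positivity)
    (by positivity) hKf hV).trans ?_
  refine le_trans (mul_le_mul_of_nonneg_left ?_ hu.le) (mul_one_div u (g : ℝ)).le
  have e1 : 67 * u * (g : ℝ) ^ 11 / (u / (g : ℝ) ^ 4) ^ 2 ≤ 1 / 64 * (1 / g) := by
    rw [show 67 * u * (g : ℝ) ^ 11 / (u / (g : ℝ) ^ 4) ^ 2 = 67 * (g : ℝ) ^ 20 / u * (1 / g) by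
      field_simp]
    refine mul_le_mul_of_nonneg_right ?_ (by positivity)
    rw [div_le_div_iff₀ hu (by norm_num)]
    have : 67 * (g : ℝ) ^ 20 * 64 ≤ (g : ℝ) ^ 24 := by
      rw [show (g : ℝ) ^ 24 = g ^ 4 * (g : ℝ) ^ 20 by ring, mul_right_comm]
      gcongr
      nlinarith [pow_le_pow_left₀ (by norm_num) hg 4]
    linarith
  have e2 : 16 * (67 * u * (g : ℝ) ^ 11) / (u / g) ^ 2 ≤ 1 / 64 * (1 / g) := by
    rw [show 16 * (67 * u * (g : ℝ) ^ 11) / (u / g) ^ 2 = 1072 * (g : ℝ) ^ 14 / u * (1 / g) by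
      field_simp; ring]
    refine mul_le_mul_of_nonneg_right ?_ (by positivity)
    rw [div_le_div_iff₀ hu (by norm_num)]
    have : 1072 * (g : ℝ) ^ 14 * 64 ≤ (g : ℝ) ^ 24 := by
      rw [show (g : ℝ) ^ 24 = g ^ 10 * (g : ℝ) ^ 14 by ring, mul_right_comm]
      gcongr
      nlinarith [pow_le_pow_left₀ (by norm_num) hg 10]
    linarith
  have e3 : 2 / (u / g) * (4 * itemRatio I A * (u / (g : ℝ) ^ 4 + K) + 2 * K * ((g ^ 4 : ℕ) : ℝ) *
      blockError I A (Fin (4 * g ^ 4 * L)) (Fin (g ^ 4) × Bool)) ≤ 1 / 2 * (1 / g) := by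
    push_cast
    calc _ ≤ 2 / (u / g) * (4 * g * (u / (g : ℝ) ^ 4 + u / (16 * (g : ℝ) ^ 4)) +
          2 * (u / (16 * (g : ℝ) ^ 4)) * (g : ℝ) ^ 4 * (33 * (g : ℝ) ^ 9 / u)) := by gcongr
      _ = (17 / (2 * (g : ℝ)) + 33 / 4 * (g : ℝ) ^ 11 / u) * (1 / g) := by field_simp; ring
      _ ≤ (1 / 4 + 1 / 4) * (1 / g) := by
          refine mul_le_mul_of_nonneg_right (add_le_add ?_ ?_) (by positivity)
          · rw [div_le_div_iff₀ (by positivity) (by norm_num)]; linarith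
          · rw [show 33 / 4 * (g : ℝ) ^ 11 / u = 33 * (g : ℝ) ^ 11 / (4 * u) by field_simp,
              div_le_div_iff₀ (by positivity) (by norm_num)]
            have : 33 * (g : ℝ) ^ 11 ≤ (g : ℝ) ^ 24 := by
              rw [show (g : ℝ) ^ 24 = g ^ 13 * (g : ℝ) ^ 11 by ring]
              gcongr
              nlinarith [pow_le_pow_left₀ (by norm_num) hg 13]
            linarith
      _ = _ := by ring
  have : (0 : ℝ) < 1 / g := by positivity
  linarith

theorem abs_expect_blockSum_sub_le [Nonempty A] (h : Tuned I A g L)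
    (F : (Fin (4 * g ^ 4 * L) → I) → (Fin (g ^ 4) × Bool → A) → ℝ) {c : ℝ}
    (hF : ∀ X Y, |F X Y| ≤ c * (g : ℝ) ^ 4) (hc : c ≤ (g : ℝ) ^ 13) :
    |(𝔼 σ, 𝔼 π, blockSum F ι κ σ π) - blockCount A g * 𝔼 X, 𝔼 Y, F X Y| ≤
      Fintype.card A / 512 := by
  have : Nonempty I := by
    by_contra hI
    rw [not_nonempty_iff] at hI
    have := h.one_le_ratio
    simp [itemRatio] at this
    linarith
  have hK := h.blockCount_mul_le
  refine (FairAllocation.abs_expect_blockSum_sub_le F hF ι κ).trans ?_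
  have h1 := h.mul_blockError_le hc
  have hK0 : (0 : ℝ) ≤ (blockCount A g : ℝ) * (g : ℝ) ^ 4 := by positivity
  calc _ = 2 * ((blockCount A g : ℝ) * (g : ℝ) ^ 4) *
        (c * blockError I A (Fin (4 * g ^ 4 * L)) (Fin (g ^ 4) × Bool)) := by ring
    _ ≤ 2 * ((blockCount A g : ℝ) * (g : ℝ) ^ 4) * (1 / 64) := by gcongr
    _ ≤ _ := by linarith

/-- There are about `u/16` windows, three quarters of which are completed in expectation; `u/64`
leaves room for rounding and for the sampling error. -/
theorem le_expect_completed [Nonempty A] (h : Tuned I A g L) (hT : Exact T k) :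
    (Fintype.card A : ℝ) / 64 ≤ 𝔼 σ, 𝔼 π, blockSum (completed T k) ι κ σ π := by
  have hu := h.card_pos
  have hg : (64 : ℝ) ≤ g := by exact_mod_cast h.large
  have hr := h.one_le_ratio
  have h1 := (abs_le.1 (h.abs_expect_blockSum_sub_le ι κ (completed T k) (c := 1) (fun X Y => by
    rw [abs_of_nonneg (completed_nonneg X Y)]
    simpa using completed_le (T := T) (k := k) X Y) (one_le_pow₀ (by linarith)))).1
  have hL : (1 : ℝ) ≤ L := hr.trans h.ratio_le
  have hL' : 1 ≤ L := by exact_mod_cast hL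
  have hg' := h.large
  have h2 : 3 / 4 * ((g : ℝ) ^ 4) ≤ 𝔼 X : Fin (4 * g ^ 4 * L) → I, 𝔼 Y : Fin (g ^ 4) × Bool → A,
      completed T k X Y := by
    rw [Finset.expect_comm, ← Fintype.expect_const (ι := Fin (g ^ 4) × Bool → A) (3 / 4 * (g : ℝ) ^ 4)]
    refine Finset.expect_le_expect fun Y _ => ?_
    have := FairAllocation.le_expect_completed (ℓ := 4 * g ^ 4 * L) hT (Classical.arbitrary A) Y
      (by
        push_cast
        have := mul_le_mul_of_nonneg_left h.ratio_le (h.pow_pos 4).le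
        linarith) (by positivity)
    exact_mod_cast this
  have h3 := mul_le_mul_of_nonneg_left h2 (show (0 : ℝ) ≤ blockCount A g by positivity)
  have h4 := h.le_blockCount_mul
  have h5 : 64 * (g : ℝ) ^ 4 ≤ Fintype.card A := by
    refine le_trans ?_ h.pow_le_card
    rw [show (g : ℝ) ^ 24 = g ^ 20 * (g : ℝ) ^ 4 by ring]
    gcongr
    nlinarith [pow_le_pow_left₀ (by norm_num) hg 20]
  linarith

theorem expect_waits_le [Nonempty A] (h : Tuned I A g L) (hT : Exact T k) :
    (𝔼 σ, 𝔼 π, blockSum (waits T k) ι κ σ π) ≤ 3 / 8 * Fintype.card A * L := by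
  have hu := h.card_pos
  have hg : (64 : ℝ) ≤ g := by exact_mod_cast h.large
  have hr := h.one_le_ratio
  have hL : (1 : ℝ) ≤ L := hr.trans h.ratio_le
  have h1 := (abs_le.1 (h.abs_expect_blockSum_sub_le ι κ (waits T k) (c := 2 * (4 * (g : ℝ) ^ 4 * L))
    (fun X Y => by
      rw [abs_of_nonneg (waits_nonneg X Y)]
      refine (waits_le X Y).trans (le_of_eq ?_)
      push_cast; ring) (by
      calc 2 * (4 * (g : ℝ) ^ 4 * L) ≤ (g : ℝ) ^ 7 * (g : ℝ) ^ 6 := by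
            gcongr
            · nlinarith [pow_le_pow_left₀ (by norm_num) hg 7]
            · exact h.length_le
        _ = _ := by ring))).2
  have h2 : (𝔼 X : Fin (4 * g ^ 4 * L) → I, 𝔼 Y : Fin (g ^ 4) × Bool → A, waits T k X Y) ≤
      2 * (g : ℝ) ^ 4 * L := by
    rw [Finset.expect_comm, ← Fintype.expect_const (ι := Fin (g ^ 4) × Bool → A) (2 * (g : ℝ) ^ 4 * L)]
    refine Finset.expect_le_expect fun Y _ => (FairAllocation.expect_waits_le hT Y).trans ?_
    push_cast
    have := h.ratio_le
    gcongr
  have h3 := mul_le_mul_of_nonneg_left h2 (show (0 : ℝ) ≤ blockCount A g by positivity)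
  have h4 := mul_le_mul_of_nonneg_right h.blockCount_mul_le (show (0 : ℝ) ≤ L by positivity)
  have h5 : (Fintype.card A : ℝ) * 1 ≤ Fintype.card A * L := by gcongr
  linarith

theorem expect_sqLengths_le [Nonempty A] (h : Tuned I A g L) (hT : Exact T k) :
    (𝔼 σ, 𝔼 π, blockSum (sqLengths T k) ι κ σ π) ≤ 1 / 4 * Fintype.card A * (L : ℝ) ^ 2 := by
  have hu := h.card_pos
  have hg : (64 : ℝ) ≤ g := by exact_mod_cast h.large
  have hr := h.one_le_ratio
  have hL : (1 : ℝ) ≤ L := hr.trans h.ratio_le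
  have h1 := (abs_le.1 (h.abs_expect_blockSum_sub_le ι κ (sqLengths T k)
    (c := (4 * (g : ℝ) ^ 4 * L) ^ 2)
    (fun X Y => by
      rw [abs_of_nonneg (sqLengths_nonneg X Y)]
      refine (sqLengths_le X Y).trans (le_of_eq ?_)
      push_cast; ring) (by
      calc (4 * (g : ℝ) ^ 4 * L) ^ 2 ≤ (g : ℝ) ^ 3 * (g : ℝ) ^ 10 := by
            refine h.sq_length_le.trans ?_
            gcongr
            nlinarith [pow_le_pow_left₀ (by norm_num) hg 3]
        _ = _ := by ring))).2
  have h2 : (𝔼 X : Fin (4 * g ^ 4 * L) → I, 𝔼 Y : Fin (g ^ 4) × Bool → A, sqLengths T k X Y) ≤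
      2 * (g : ℝ) ^ 4 * (L : ℝ) ^ 2 := by
    rw [Finset.expect_comm,
      ← Fintype.expect_const (ι := Fin (g ^ 4) × Bool → A) (2 * (g : ℝ) ^ 4 * (L : ℝ) ^ 2)]
    refine Finset.expect_le_expect fun Y _ => (FairAllocation.expect_sqLengths_le hT Y).trans ?_
    push_cast
    have := h.ratio_le
    gcongr
  have h3 := mul_le_mul_of_nonneg_left h2 (show (0 : ℝ) ≤ blockCount A g by positivity)
  have h4 := mul_le_mul_of_nonneg_right h.blockCount_mul_le (show (0 : ℝ) ≤ (L : ℝ) ^ 2 by positivity)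
  have h5 : (Fintype.card A : ℝ) * 1 ≤ Fintype.card A * (L : ℝ) ^ 2 := by
    gcongr; exact one_le_pow₀ hL
  linarith

end Tuned

theorem exists_block_embedding (h : Tuned I A g L) :
    Nonempty (Fin (blockCount A g) × Fin (4 * g ^ 4 * L) ↪ I) ∧
      Nonempty (Fin (blockCount A g) × (Fin (g ^ 4) × Bool) ↪ A) := by
  have hK := h.blockCount_mul_le
  have hu := h.card_pos
  refine ⟨Function.Embedding.nonempty_of_card_le ?_, Function.Embedding.nonempty_of_card_le ?_⟩
  · simp only [Fintype.card_prod, Fintype.card_fin]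
    have hI : (Fintype.card I : ℝ) = Fintype.card A * itemRatio I A := by
      rw [itemRatio]; field_simp
    have h2 := mul_le_mul_of_nonneg_right hK (show (0 : ℝ) ≤ 4 * L by positivity)
    have h3 := mul_le_mul_of_nonneg_left h.le_ratio hu.le
    have : (0 : ℝ) ≤ Fintype.card I := by positivity
    have h4 : ((blockCount A g * (4 * g ^ 4 * L) : ℕ) : ℝ) ≤ Fintype.card I := by
      push_cast
      linarith
    exact_mod_cast h4
  · simp only [Fintype.card_prod, Fintype.card_fin, Fintype.card_bool]
    have h4 : ((blockCount A g * (g ^ 4 * 2) : ℕ) : ℝ) ≤ Fintype.card A := by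
      push_cast
      linarith
    exact_mod_cast h4

end Tuning

/-! ### Announcing small numbers and combining trees. -/

section

variable {X : Type} {n : ℕ}

/-- An agent announces a number `ρ` by about `ρ / L + log L` bits. -/
theorem RTree.exists_announce_small (i : Fin n) {L b : ℕ} (hL : 1 ≤ L) (hb : L ≤ 2 ^ b) (M : ℕ) :
    ∀ ρ : X → ℕ, (∀ x, ρ x < (M + 1) * L) → ∃ t : RTree X n ℕ, ∀ v,
      t.Spec v (fun a => a = ρ (v i)) ((ρ (v i) / L + 1 + b : ℕ) : ℝ≥0∞) := by
  induction M with
  | zero =>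
    intro ρ hρ
    obtain ⟨t, ht⟩ := RTree.exists_askNat i b ρ fun x => (hρ x).trans_le (by omega)
    exact ⟨t, fun v => (ht v).mono (fun _ h => h) (by exact_mod_cast Nat.le_add_left _ _)⟩
  | succ M ih =>
    intro ρ hρ
    obtain ⟨t, ht⟩ := ih (fun x => ρ x - L) fun x => by
      have := hρ x
      have : 0 < (M + 1) * L := by positivity
      rw [add_mul (M + 1), one_mul] at *
      omega
    obtain ⟨t', ht'⟩ := RTree.exists_askNat (X := X) i b (fun x => if ρ x < L then ρ x else 0) fun x => by
      split_ifs <;> [omega; positivity]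
    -- The quotient by `L` is sent in unary, the remainder by `b` bits.
    refine ⟨.ask i (fun x => decide (ρ x < L)) fun c =>
      if c then t' else t.bind fun a => .ret (a + L), fun v => ?_⟩
    by_cases h : ρ (v i) < L
    · refine (RTree.Spec.ask (c := (b : ℝ≥0∞)) ?_).mono (fun _ h => h) ?_
      · simp only [h, decide_true, if_true]
        refine (ht' v).mono (fun a ha => ?_) le_rfl
        rw [ha, if_pos h]
      · rw [Nat.div_eq_of_lt h]
        push_cast
        exact le_of_eq (by ring)
    · refine (RTree.Spec.ask (c := (((ρ (v i) - L) / L + 1 + b : ℕ) : ℝ≥0∞) + 0) ?_).mono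
        (fun _ h => h) ?_
      · simp only [h, decide_false, Bool.false_eq_true, if_false]
        refine (ht v).bind fun a ha => RTree.spec_ret ?_
        omega
      · have h1 : ρ (v i) / L = (ρ (v i) - L) / L + 1 := by
          conv_lhs => rw [← Nat.sub_add_cancel (not_lt.1 h)]
          rw [Nat.add_div_right _ (by omega)]
        rw [h1]
        push_cast
        rw [add_zero]
        exact le_of_eq (by ring)

/-- Running trees one after the other. -/
theorem RTree.exists_forall {ι β : Type} [DecidableEq ι] [Nonempty β] (t : ι → RTree X n β)
    (S : Finset ι) : ∃ t' : RTree X n (ι → β), ∀ (v : Fin n → X) (Q : ι → β → Prop) (c : ι → ℝ≥0∞),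
      (∀ s, (t s).Spec v (Q s) (c s)) →
      t'.Spec v (fun f => ∀ s ∈ S, Q s (f s)) (∑ s ∈ S, c s) := by
  induction S using Finset.induction_on with
  | empty => exact ⟨.ret fun _ => Classical.arbitrary β, fun v Q c _ => RTree.spec_ret (by simp)⟩
  | insert s S hs ih =>
    obtain ⟨t', ht'⟩ := ih
    refine ⟨t'.bind fun f => (t s).bind fun a => .ret (Function.update f s a), fun v Q c h => ?_⟩
    rw [Finset.sum_insert hs, add_comm]
    refine (ht' v Q c h).bind fun f hf => ?_
    rw [← add_zero (c s)]
    refine (h s).bind fun a ha => RTree.spec_ret fun r hr => ?_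
    rcases Finset.mem_insert.1 hr with rfl | hr
    · rwa [Function.update_self]
    · rw [Function.update_of_ne (show r ≠ s from fun e => hs (e ▸ hr))]
      exact hf r hr

end

/-! ### Taking over windows. -/

section Windows

variable {n m : ℕ} {W : Type} [Fintype W] [DecidableEq W]

/-- Every window is assigned to an agent who likes enough of its items, where the windows are prefixes
of given sequences of items. -/
structure Hosted (k : Finset (Fin m) → ℕ) (τ : Finset (Fin m) → Finset (Fin m))
    (P : W → ℕ → Finset (Fin m)) (V : Finset (Fin n)) (S : Finset W) (y₀ : W → ℕ)
    (v : Fin n → Finset (Fin m)) (y : W → ℕ) (h : W → Fin n) : Prop where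
  le : ∀ w ∈ S, y w ≤ y₀ w
  mem : ∀ w ∈ S, h w ∈ V
  inj : ∀ w ∈ S, ∀ w' ∈ S, h w = h w' → w = w'
  share : ∀ w ∈ S, k (v (h w)) ≤ (τ (v (h w)) ∩ P w (y w)).card

/-- The number of items in the windows that an agent likes. -/
def windowCount (τ : Finset (Fin m) → Finset (Fin m)) (P : W → ℕ → Finset (Fin m)) (S : Finset W)
    (y : W → ℕ) (x : Finset (Fin m)) : ℕ := ∑ w ∈ S, (τ x ∩ P w (y w)).card

/-- The windows whose last item an agent does not like. -/
def untied (τ : Finset (Fin m) → Finset (Fin m)) (P : W → ℕ → Finset (Fin m)) (S : Finset W)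
    (y : W → ℕ) (x : Finset (Fin m)) : Finset W :=
  S.filter fun w => ¬ (τ x ∩ P w (y w - 1)).card < (τ x ∩ P w (y w)).card

/-- Sequences of items, given by their prefixes. -/
structure IsPrefix (P : W → ℕ → Finset (Fin m)) : Prop where
  zero : ∀ w, P w 0 = ∅
  mono : ∀ w, Monotone (P w)
  card_succ : ∀ w y, (P w (y + 1) \ P w y).card ≤ 1

variable {k : Finset (Fin m) → ℕ} {τ : Finset (Fin m) → Finset (Fin m)}
  {P : W → ℕ → Finset (Fin m)} {V : Finset (Fin n)} {S : Finset W} {y₀ y : W → ℕ}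
  {v : Fin n → Finset (Fin m)} {h : W → Fin n}

theorem IsPrefix.card_inter_mono (hP : IsPrefix P) (T : Finset (Fin m)) (w : W) {a b : ℕ}
    (hab : a ≤ b) : (T ∩ P w a).card ≤ (T ∩ P w b).card :=
  Finset.card_le_card (Finset.inter_subset_inter_left (hP.mono w hab))

theorem IsPrefix.card_inter_le (hP : IsPrefix P) (T : Finset (Fin m)) (w : W) (a : ℕ) :
    (T ∩ P w a).card ≤ (T ∩ P w (a - 1)).card + 1 := by
  rcases a with _ | a
  · simp
  · have h1 : T ∩ P w (a + 1) ⊆ (T ∩ P w a) ∪ (P w (a + 1) \ P w a) := by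
      intro e he
      simp only [Finset.mem_inter, Finset.mem_union, Finset.mem_sdiff] at he ⊢
      tauto
    exact (Finset.card_le_card h1).trans ((Finset.card_union_le _ _).trans
      (Nat.add_le_add_left (hP.card_succ w a) _))

/-- Few windows were shortened by agents outside of an exceptional set. -/
theorem Hosted.card_shortened_le (hP : IsPrefix P) (hy : Hosted k τ P V S y₀ v y h) {F : ℕ}
    {x : Finset (Fin m)} (hx : windowCount τ P S y₀ x + (untied τ P S y₀ x).card ≤ F + S.card * k x)
    (hd : S.card * k x < windowCount τ P S y x) : (S.filter fun w => y w < y₀ w).card < F := by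
  have h1 : (S.filter fun w => y w < y₀ w).card + windowCount τ P S y x ≤
      (untied τ P S y₀ x).card + windowCount τ P S y₀ x := by
    simp only [windowCount, untied, Finset.card_filter]
    rw [← Finset.sum_add_distrib, ← Finset.sum_add_distrib]
    -- A shortened window has lost its last item; if the agent likes this item, her count in the
    -- window has dropped.
    refine Finset.sum_le_sum fun w hw => ?_
    have h2 := hP.card_inter_mono (τ x) w (hy.le w hw)
    split_ifs with h3 h4 h4
    · have h5 := hP.card_inter_mono (τ x) w (show y w ≤ y₀ w - 1 by omega)
      omega
    · omega
    · omega
    · omega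
  omega

/-- Hosts are distinct, so at most `F + |D|` windows are shortened. A window of length at most `Z`
loses at most `Z` items, and a longer one loses at most `y₀ ≤ y₀²/Z`. -/
theorem Hosted.shrink_le (hy : Hosted k τ P V S y₀ v y h) {F Z : ℕ} (hZ : 0 < Z)
    {D : Finset (Fin n)} (hF : (S.filter fun w => y w < y₀ w ∧ h w ∉ D).card ≤ F) :
    ∑ w ∈ S, (y₀ w - y w) ≤ Z * (F + D.card) + ∑ w ∈ S, y₀ w ^ 2 / Z := by
  have h1 : (S.filter fun w => y w < y₀ w).card ≤ F + D.card := by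
    have h2 : (S.filter fun w => y w < y₀ w) ⊆ (S.filter fun w => y w < y₀ w ∧ h w ∉ D) ∪
        S.filter fun w => h w ∈ D := by
      intro w hw
      simp only [Finset.mem_filter, Finset.mem_union] at hw ⊢
      tauto
    have h3 : (S.filter fun w => h w ∈ D).card ≤ D.card := by
      refine Finset.card_le_card_of_injOn h (fun w hw => (Finset.mem_filter.1 hw).2) ?_
      intro w hw w' hw' e
      exact hy.inj w (Finset.mem_filter.1 hw).1 w' (Finset.mem_filter.1 hw').1 e
    have := (Finset.card_le_card h2).trans (Finset.card_union_le _ _)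
    omega
  have h2 : ∀ w ∈ S, y₀ w - y w ≤ (if y w < y₀ w then Z else 0) + y₀ w ^ 2 / Z := by
    intro w _
    split_ifs with h3
    · rcases le_total (y₀ w) Z with h4 | h4
      · exact Nat.le_add_right_of_le (by omega)
      · have : y₀ w ≤ y₀ w ^ 2 / Z := by
          rw [Nat.le_div_iff_mul_le hZ, sq]
          exact Nat.mul_le_mul_left _ h4
        exact Nat.le_add_left_of_le ((Nat.sub_le _ _).trans this)
    · rw [Nat.sub_eq_zero_of_le (not_lt.1 h3)]
      exact Nat.zero_le _
  refine (Finset.sum_le_sum h2).trans ?_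
  rw [Finset.sum_add_distrib, ← Finset.sum_filter, Finset.sum_const, smul_eq_mul, mul_comm]
  gcongr

/-- Agents who see more items that they like in the windows than they can spare take over windows. -/
theorem exists_kicks {β : Type} [Nonempty W] (k : Finset (Fin m) → ℕ)
    (τ : Finset (Fin m) → Finset (Fin m)) (P : W → ℕ → Finset (Fin m)) (hP : IsPrefix P)
    (V : Finset (Fin n)) (S : Finset W) (y₀ : W → ℕ) {b : ℕ} (hb : Fintype.card W ≤ 2 ^ b)
    (next : (W → ℕ) → (W → Fin n) → RTree (Finset (Fin m)) n β) :
    ∀ (N : ℕ) (y : W → ℕ) (h : W → Fin n) (Fl : Finset (Fin n)), ∑ w, y w + Fl.card = N →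
    ∃ t : RTree (Finset (Fin m)) n β, ∀ (v : Fin n → Finset (Fin m)) (D : Finset (Fin n)) (F M : ℕ)
      (Q : β → Prop) (c : ℝ≥0∞),
      (∀ i ∈ V, i ∉ D → S.card * k (v i) < windowCount τ P S y₀ (v i) →
        windowCount τ P S y₀ (v i) + (untied τ P S y₀ (v i)).card ≤ F + S.card * k (v i)) →
      (∀ y h, Hosted k τ P V S y₀ v y h → (S.filter fun w => y w < y₀ w ∧ h w ∉ D).card ≤ F →
        ∑ w ∈ S, (y₀ w - y w) ≤ M) →
      Hosted k τ P V S y₀ v y h → (S.filter fun w => y w < y₀ w ∧ h w ∉ D).card ≤ F →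
      Fl ⊆ V → (∀ w ∈ S, h w ∉ Fl) →
      (∀ i ∈ V, i ∉ Fl → (∀ w ∈ S, h w ≠ i) → windowCount τ P S y (v i) ≤ S.card * k (v i)) →
      (∀ y h, Hosted k τ P V S y₀ v y h → (∀ i ∈ V, (∀ w ∈ S, h w ≠ i) →
        windowCount τ P S y (v i) ≤ S.card * k (v i)) → (next y h).Spec v Q c) →
      t.Spec v Q ((Fl.card + (b + 1) * (M - ∑ w ∈ S, (y₀ w - y w)) : ℕ) + c) := by
  classical
  intro N
  -- The set `Fl` contains the agents who have yet to be checked. A check costs one bit; if the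
  -- agent has enough items left, she leaves `Fl` for good, since windows only shrink. Otherwise she
  -- takes over a window for `b` further bits. The window loses an item, and in `Fl` she is replaced
  -- by the evicted host, so these `b + 1` bits are paid from the budget `M` for lost items.
  induction N using Nat.strong_induction_on with
  | _ N ih =>
  intro y h Fl hN
  rcases Fl.eq_empty_or_nonempty with rfl | ⟨i, hi⟩
  · refine ⟨next y h, fun v D F M Q c _ _ hy _ _ _ hf hn => ?_⟩
    refine (hn y h hy fun i hi hw => hf i hi (by simp) hw).mono (fun _ h => h) le_add_self
  have hcard : (Fl.erase i).card + 1 = Fl.card := Finset.card_erase_add_one hi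
  obtain ⟨t₀, ht₀⟩ := ih (∑ w, y w + (Fl.erase i).card) (by omega) y h (Fl.erase i) rfl
  have hkick : ∀ w, ∃ t : RTree (Finset (Fin m)) n β, 0 < y w →
      ∀ (v : Fin n → Finset (Fin m)) (D : Finset (Fin n)) (F M : ℕ) (Q : β → Prop) (c : ℝ≥0∞),
      (∀ i ∈ V, i ∉ D → S.card * k (v i) < windowCount τ P S y₀ (v i) →
        windowCount τ P S y₀ (v i) + (untied τ P S y₀ (v i)).card ≤ F + S.card * k (v i)) →
      (∀ y h, Hosted k τ P V S y₀ v y h → (S.filter fun w => y w < y₀ w ∧ h w ∉ D).card ≤ F →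
        ∑ w ∈ S, (y₀ w - y w) ≤ M) →
      Hosted k τ P V S y₀ v (Function.update y w (y w - 1)) (Function.update h w i) →
      (S.filter fun w' => Function.update y w (y w - 1) w' < y₀ w' ∧
        Function.update h w i w' ∉ D).card ≤ F →
      insert (h w) (Fl.erase i) ⊆ V →
      (∀ w' ∈ S, Function.update h w i w' ∉ insert (h w) (Fl.erase i)) →
      (∀ j ∈ V, j ∉ insert (h w) (Fl.erase i) → (∀ w' ∈ S, Function.update h w i w' ≠ j) →
        windowCount τ P S (Function.update y w (y w - 1)) (v j) ≤ S.card * k (v j)) →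
      (∀ y h, Hosted k τ P V S y₀ v y h → (∀ i ∈ V, (∀ w ∈ S, h w ≠ i) →
        windowCount τ P S y (v i) ≤ S.card * k (v i)) → (next y h).Spec v Q c) →
      t.Spec v Q (((insert (h w) (Fl.erase i)).card + (b + 1) * (M - ∑ w' ∈ S,
        (y₀ w' - Function.update y w (y w - 1) w')) : ℕ) + c) := by
    intro w
    by_cases hw : 0 < y w
    · have h1 : ∑ w', Function.update y w (y w - 1) w' + 1 = ∑ w', y w' := by
        rw [Finset.sum_update_of_mem (Finset.mem_univ w), ← Finset.sum_sdiff
          (Finset.subset_univ {w}), Finset.sum_singleton]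
        omega
      have h2 := Finset.card_insert_le (h w) (Fl.erase i)
      obtain ⟨t, ht⟩ := ih _ (by omega) (Function.update y w (y w - 1)) (Function.update h w i)
        (insert (h w) (Fl.erase i)) rfl
      exact ⟨t, fun _ => ht⟩
    · exact ⟨next y h, fun hw' => absurd hw' hw⟩
  choose t₁ ht₁ using hkick
  obtain ⟨a, ha⟩ := RTree.exists_announce_mem (X := Finset (Fin m)) i hb
    (fun x w => w ∈ S ∧ k x < (τ x ∩ P w (y w)).card)
  refine ⟨.ask i (fun x => decide (S.card * k x < windowCount τ P S y x)) fun c =>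
    if c then a.bind t₁ else t₀, fun v D F M Q c hD hM hy hF hFV hhF hFl hn => ?_⟩
  by_cases hd : S.card * k (v i) < windowCount τ P S y (v i)
  swap
  · refine (RTree.Spec.ask (c := (((Fl.erase i).card + (b + 1) * (M - ∑ w ∈ S, (y₀ w - y w)) : ℕ) +
      c)) ?_).mono (fun _ h => h) ?_
    · simp only [hd, decide_false, Bool.false_eq_true, if_false]
      refine ht₀ v D F M Q c hD hM hy hF ((Finset.erase_subset _ _).trans hFV)
        (fun w hw e => hhF w hw (Finset.mem_of_mem_erase e)) (fun j hj hjF hjw => ?_) hn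
      by_cases hji : j = i
      · rw [hji]; omega
      · exact hFl j hj (fun e => hjF (Finset.mem_erase.2 ⟨hji, e⟩)) hjw
    · rw [← hcard]
      push_cast
      exact le_of_eq (by ring)
  have hiV := hFV hi
  -- By averaging, some window contains more than a share for her, so a share remains after its last
  -- item is removed.
  obtain ⟨w₀, hw₀, hk₀⟩ : ∃ w ∈ S, k (v i) < (τ (v i) ∩ P w (y w)).card := by
    by_contra! hcon
    have := Finset.sum_le_sum hcon
    rw [Finset.sum_const, smul_eq_mul] at this
    exact absurd hd (not_lt.2 this)
  have hpos : ∑ w ∈ S, (y₀ w - y w) < M ∧ ∀ w ∈ S, k (v i) < (τ (v i) ∩ P w (y w)).card →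
      (t₁ w).Spec v Q ((Fl.card + (b + 1) * (M - (∑ w ∈ S, (y₀ w - y w) + 1)) : ℕ) + c) := by
    have key : ∀ w ∈ S, k (v i) < (τ (v i) ∩ P w (y w)).card → ∑ w ∈ S, (y₀ w - y w) < M ∧ 
      (t₁ w).Spec v Q ((Fl.card + (b + 1) * (M - (∑ w ∈ S, (y₀ w - y w) + 1)) : ℕ) + c) := by
      intro w hw hk
      have hy0 : 0 < y w := by
        by_contra h0
        rw [Nat.eq_zero_of_not_pos h0, hP.zero] at hk
        simp at hk
      have hle := hy.le w hw
      have hH : Hosted k τ P V S y₀ v (Function.update y w (y w - 1)) (Function.update h w i) := by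
        constructor
        · intro w' hw'
          by_cases e : w' = w
          · subst e; rw [Function.update_self]; omega
          · rw [Function.update_of_ne e]; exact hy.le w' hw'
        · intro w' hw'
          by_cases e : w' = w
          · subst e; rwa [Function.update_self]
          · rw [Function.update_of_ne e]; exact hy.mem w' hw'
        · intro w' hw' w'' hw'' e
          by_cases e1 : w' = w <;> by_cases e2 : w'' = w
          · rw [e1, e2]
          · subst e1
            rw [Function.update_self, Function.update_of_ne e2] at e
            exact absurd (e ▸ hi) (hhF w'' hw'')
          · subst e2
            rw [Function.update_self, Function.update_of_ne e1] at e
            exact absurd (e ▸ hi) (hhF w' hw')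
          · rw [Function.update_of_ne e1, Function.update_of_ne e2] at e
            exact hy.inj w' hw' w'' hw'' e
        · intro w' hw'
          by_cases e : w' = w
          · subst e
            rw [Function.update_self, Function.update_self]
            have := hP.card_inter_le (τ (v i)) w' (y w')
            omega
          · rw [Function.update_of_ne e, Function.update_of_ne e]; exact hy.share w' hw'
      have hS : ∑ w' ∈ S, (y₀ w' - Function.update y w (y w - 1) w') = ∑ w ∈ S, (y₀ w - y w) + 1 := by
        rw [← Finset.add_sum_erase S _ hw, ← Finset.add_sum_erase S (fun w => y₀ w - y w) hw]
        rw [Function.update_self, Finset.sum_congr rfl (g := fun w => y₀ w - y w)]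
        · omega
        · intro w' hw'
          rw [Function.update_of_ne (Finset.ne_of_mem_erase hw')]
      -- Windows hosted by exceptional agents do not count. Any other agent who still sees too many
      -- items guarantees, by `Hosted.card_shortened_le`, that fewer than `F` windows were shortened
      -- so far.
      have hF' : (S.filter fun w' => Function.update y w (y w - 1) w' < y₀ w' ∧
          Function.update h w i w' ∉ D).card ≤ F := by
        by_cases hiD : i ∈ D
        · refine (Finset.card_le_card fun w' hw' => ?_).trans hF
          rw [Finset.mem_filter] at hw' ⊢
          by_cases e : w' = w
          · subst e
            rw [Function.update_self, Function.update_self] at hw'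
            exact absurd hiD hw'.2.2
          · rwa [Function.update_of_ne e, Function.update_of_ne e] at hw'
        · have h1 : windowCount τ P S y (v i) ≤ windowCount τ P S y₀ (v i) :=
            Finset.sum_le_sum fun w hw => hP.card_inter_mono _ w (hy.le w hw)
          have h2 := hy.card_shortened_le hP (hD i hiV hiD (hd.trans_le h1)) hd
          have h3 : (S.filter fun w' => Function.update y w (y w - 1) w' < y₀ w' ∧
              Function.update h w i w' ∉ D) ⊆ insert w (S.filter fun w => y w < y₀ w) := by
            intro w' hw'
            rw [Finset.mem_filter] at hw'
            rw [Finset.mem_insert, Finset.mem_filter]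
            by_cases e : w' = w
            · exact Or.inl e
            · rw [Function.update_of_ne e] at hw'
              exact Or.inr ⟨hw'.1, hw'.2.1⟩
          have := (Finset.card_le_card h3).trans (Finset.card_insert_le _ _)
          omega
      have hM' := hM _ _ hH hF'
      refine ⟨by omega, ?_⟩
      refine (ht₁ w hy0 v D F M Q c hD hM hH hF' ?_ ?_ ?_ hn).mono (fun _ h => h) ?_
      · exact Finset.insert_subset (hy.mem w hw) ((Finset.erase_subset _ _).trans hFV)
      · intro w' hw' hmem
        rw [Finset.mem_insert] at hmem
        by_cases e : w' = w
        · subst e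
          rw [Function.update_self] at hmem
          rcases hmem with e1 | e1
          · exact hhF w' hw' (e1 ▸ hi)
          · exact Finset.notMem_erase _ _ e1
        · rw [Function.update_of_ne e] at hmem
          rcases hmem with e1 | e1
          · exact e (hy.inj _ hw' _ hw e1)
          · exact hhF w' hw' (Finset.mem_of_mem_erase e1)
      · intro j hj hjF hjw
        have h1 : windowCount τ P S (Function.update y w (y w - 1)) (v j) ≤
            windowCount τ P S y (v j) := Finset.sum_le_sum fun w' hw' => hP.card_inter_mono _ w' (by
          by_cases e : w' = w
          · subst e; rw [Function.update_self]; omega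
          · rw [Function.update_of_ne e])
        refine h1.trans (hFl j hj (fun e => ?_) fun w' hw' e => ?_)
        · by_cases hji : j = i
          · exact hjw w hw (by rw [Function.update_self, hji])
          · exact hjF (Finset.mem_insert_of_mem (Finset.mem_erase.2 ⟨hji, e⟩))
        · by_cases e1 : w' = w
          · subst e1
            exact hjF (Finset.mem_insert.2 (Or.inl e.symm))
          · exact hjw w' hw' (by rw [Function.update_of_ne e1, e])
      · rw [hS]
        have h5 := (Finset.card_insert_le (h w) (Fl.erase i)).trans hcard.le
        exact add_le_add_left (Nat.cast_le.2 (Nat.add_le_add_right h5 _)) _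
    exact ⟨(key w₀ hw₀ hk₀).1, fun w hw hk => (key w hw hk).2⟩
  refine (RTree.Spec.ask (c := (b : ℝ≥0∞) + ((Fl.card + (b + 1) *
    (M - (∑ w ∈ S, (y₀ w - y w) + 1)) : ℕ) + c)) ?_).mono (fun _ h => h) ?_
  · simp only [hd, decide_true, if_true]
    exact (ha v ⟨w₀, hw₀, hk₀⟩).bind fun w hw => hpos.2 w hw.1 hw.2
  · obtain ⟨e, he⟩ : ∃ e, M - ∑ w ∈ S, (y₀ w - y w) = e + 1 :=
      ⟨M - ∑ w ∈ S, (y₀ w - y w) - 1, by omega⟩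
    have he' : M - (∑ w ∈ S, (y₀ w - y w) + 1) = e := by omega
    rw [he, he']
    push_cast
    exact le_of_eq (by ring)

end Windows

section

variable {n m : ℕ} {W : Type} [Fintype W] [DecidableEq W]
variable {k : Finset (Fin m) → ℕ} {τ : Finset (Fin m) → Finset (Fin m)}
  {P : W → ℕ → Finset (Fin m)} {R : Finset (Fin m)} {V : Finset (Fin n)} {S : Finset W}
  {y₀ y : W → ℕ} {v : Fin n → Finset (Fin m)} {h : W → Fin n}

theorem Hosted.card_image (hy : Hosted k τ P V S y₀ v y h) : (S.image h).card = S.card :=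
  Finset.card_image_of_injOn fun w hw w' hw' e => hy.inj w hw w' hw' e

theorem Hosted.card_sdiff (hy : Hosted k τ P V S y₀ v y h) :
    (V \ S.image h).card = V.card - S.card := by
  rw [Finset.card_sdiff_of_subset, hy.card_image]
  intro i hi
  obtain ⟨w, hw, rfl⟩ := Finset.mem_image.1 hi
  exact hy.mem w hw

/-- The windows take at most `|S|` of the `|V|` shares of an agent who is not a host, and `|V| -
|S|` agents remain. -/
theorem Hosted.hasShares (hy : Hosted k τ P V S y₀ v y h) (hτ : ∀ x, τ x ⊆ x ∩ R)
    (he : ∀ i ∈ V, V.card * k (v i) ≤ (τ (v i)).card)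
    (hu : ∀ i ∈ V, (∀ w ∈ S, h w ≠ i) → windowCount τ P S y (v i) ≤ S.card * k (v i)) :
    HasShares k (R \ S.biUnion fun w => P w (y w)) (V \ S.image h) v := by
  intro i hi
  obtain ⟨hi, hih⟩ := Finset.mem_sdiff.1 hi
  have h1 := hu i hi fun w hw e => hih (Finset.mem_image.2 ⟨w, hw, e⟩)
  rw [hy.card_sdiff, Nat.sub_mul]
  have h2 : τ (v i) ⊆ (v i ∩ (R \ S.biUnion fun w => P w (y w))) ∪
      S.biUnion fun w => τ (v i) ∩ P w (y w) := by
    intro e hte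
    have := Finset.mem_inter.1 (hτ _ hte)
    by_cases hew : ∃ w ∈ S, e ∈ P w (y w)
    · obtain ⟨w, hw, hew⟩ := hew
      exact Finset.mem_union_right _ (Finset.mem_biUnion.2 ⟨w, hw, Finset.mem_inter.2 ⟨hte, hew⟩⟩)
    · refine Finset.mem_union_left _ (Finset.mem_inter.2 ⟨this.1, Finset.mem_sdiff.2 ⟨this.2, ?_⟩⟩)
      intro hc
      obtain ⟨w, hw, hew'⟩ := Finset.mem_biUnion.1 hc
      exact hew ⟨w, hw, hew'⟩
  have h3 := (Finset.card_le_card h2).trans ((Finset.card_union_le _ _).trans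
    (Nat.add_le_add_left Finset.card_biUnion_le _))
  have h4 := he i hi
  change _ ≤ _ + windowCount τ P S y (v i) at h3
  omega

open Classical in
/-- The hosts of the windows receive their items. -/
def hostedAllocation (P : W → ℕ → Finset (Fin m)) (S : Finset W) (y : W → ℕ) (h : W → Fin n)
    (A : Fin m → Fin n) (e : Fin m) : Fin n :=
  if hw : ∃ w ∈ S, e ∈ P w (y w) then h hw.choose else A e

theorem Hosted.givesShares (hP : IsPrefix P) (hy : Hosted k τ P V S y₀ v y h)
    (hτ : ∀ x, τ x ⊆ x ∩ R)
    (hd : ∀ w ∈ S, ∀ w' ∈ S, w ≠ w' → Disjoint (P w (y₀ w)) (P w' (y₀ w'))) {A : Fin m → Fin n}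
    (hA : GivesShares k (R \ S.biUnion fun w => P w (y w)) (V \ S.image h) v A) :
    GivesShares k R V v (hostedAllocation P S y h A) := by
  intro i hi
  by_cases hih : i ∈ S.image h
  · obtain ⟨w, hw, rfl⟩ := Finset.mem_image.1 hih
    refine (hy.share w hw).trans (Finset.card_le_card fun e he => ?_)
    obtain ⟨h1, h2⟩ := Finset.mem_inter.1 he
    refine Finset.mem_filter.2 ⟨hτ _ h1, ?_⟩
    have hex : ∃ w ∈ S, e ∈ P w (y w) := ⟨w, hw, h2⟩
    rw [hostedAllocation, dif_pos hex]
    obtain ⟨h3, h4⟩ := hex.choose_spec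
    congr 1
    by_contra hne
    exact Finset.disjoint_left.1 (hd _ h3 w hw hne) (hP.mono _ (hy.le _ h3) h4)
      (hP.mono _ (hy.le _ hw) h2)
  · refine (hA i (Finset.mem_sdiff.2 ⟨hi, hih⟩)).trans (Finset.card_le_card fun e he => ?_)
    simp only [Finset.mem_filter, Finset.mem_inter, Finset.mem_sdiff, Finset.mem_biUnion] at he ⊢
    refine ⟨⟨he.1.1, he.1.2.1⟩, ?_⟩
    rw [hostedAllocation, dif_neg he.1.2.2]
    exact he.2

/-- Given windows and hosts, the agents take over windows until the remaining agents can share the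
remaining items. -/
theorem exists_shareOut [Nonempty W] (k : Finset (Fin m) → ℕ)
    (τ : Finset (Fin m) → Finset (Fin m)) {P : W → ℕ → Finset (Fin m)} (hP : IsPrefix P)
    (R : Finset (Fin m)) (hτ : ∀ x, τ x ⊆ x ∩ R) (V : Finset (Fin n)) (S : Finset W) (y₀ : W → ℕ)
    (h₀ : W → Fin n) {b Z : ℕ} (hb : Fintype.card W ≤ 2 ^ b) (hZ : 0 < Z)
    (sol : Finset (Fin m) → Finset (Fin n) → RTree (Finset (Fin m)) n (Fin m → Fin n)) :
    ∃ t : RTree (Finset (Fin m)) n (Fin m → Fin n), ∀ (v : Fin n → Finset (Fin m))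
      (D : Finset (Fin n)) (F : ℕ) (c : ℝ≥0∞),
      (∀ w ∈ S, ∀ w' ∈ S, w ≠ w' → Disjoint (P w (y₀ w)) (P w' (y₀ w'))) →
      (∀ i ∈ V, i ∉ D → S.card * k (v i) < windowCount τ P S y₀ (v i) →
        windowCount τ P S y₀ (v i) + (untied τ P S y₀ (v i)).card ≤ F + S.card * k (v i)) →
      Hosted k τ P V S y₀ v y₀ h₀ → (∀ i ∈ V, V.card * k (v i) ≤ (τ (v i)).card) →
      (∀ R' V', V' ⊆ V → V'.card = V.card - S.card → HasShares k R' V' v →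
        (sol R' V').Spec v (GivesShares k R' V' v) c) →
      t.Spec v (GivesShares k R V v)
        ((V.card + (b + 1) * (Z * (F + D.card) + ∑ w ∈ S, y₀ w ^ 2 / Z) : ℕ) + c) := by
  obtain ⟨t, ht⟩ := exists_kicks k τ P hP V S y₀ hb (fun y h =>
    (sol (R \ S.biUnion fun w => P w (y w)) (V \ S.image h)).bind fun A =>
      .ret (hostedAllocation P S y h A)) _ y₀ h₀ (V \ S.image h₀) rfl
  refine ⟨t, fun v D F c hd hD hy he hsol => ?_⟩
  refine (ht v D F (Z * (F + D.card) + ∑ w ∈ S, y₀ w ^ 2 / Z) (GivesShares k R V v) c hD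
    (fun y h hy' hF => hy'.shrink_le hZ hF) hy (by simp) Finset.sdiff_subset
    (fun w hw e => (Finset.mem_sdiff.1 e).2 (Finset.mem_image_of_mem _ hw)) ?_ ?_).mono
    (fun _ h => h) ?_
  · intro i hi hi' hw
    exact absurd (Finset.mem_sdiff.2 ⟨hi, fun e => by
      obtain ⟨w, hw', e⟩ := Finset.mem_image.1 e
      exact hw w hw' e⟩) hi'
  · intro y h hy' hu
    rw [← add_zero c]
    exact (hsol _ _ Finset.sdiff_subset hy'.card_sdiff (hy'.hasShares hτ he hu)).bind fun A hA =>
      RTree.spec_ret (hy'.givesShares hP hτ hd hA)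
  · refine add_le_add_left (Nat.cast_le.2 ?_) _
    exact Nat.add_le_add (Finset.card_le_card Finset.sdiff_subset)
      (Nat.mul_le_mul_left _ (Nat.sub_le _ _))

end

/-! ### The communication in a block. -/

section

variable {ℓ d : ℕ} {I A : Type} [Fintype I] [DecidableEq I] [Fintype A] [DecidableEq A]

/-- The agent who sees her share at the end of a window. -/
def winHost (T : A → Finset I) (k : A → ℕ) (X : Fin ℓ → I) (Y : Fin d × Bool → A) (j : Fin d) : A :=
  if arrival X (T (Y (j, true))) (k (Y (j, true))) (winStart T k X Y j) ≤
    arrival X (T (Y (j, false))) (k (Y (j, false))) (winStart T k X Y j) then Y (j, true)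
  else Y (j, false)

theorem arrival_winHost (T : A → Finset I) (k : A → ℕ) (X : Fin ℓ → I) (Y : Fin d × Bool → A)
    (j : Fin d) : arrival X (T (winHost T k X Y j)) (k (winHost T k X Y j)) (winStart T k X Y j) =
      winStart T k X Y (j + 1) := by
  rw [winStart_succ, winHost]
  split_ifs with h
  · exact (min_eq_left h).symm
  · exact (min_eq_right (not_le.1 h).le).symm

theorem winHost_mem (T : A → Finset I) (k : A → ℕ) (X : Fin ℓ → I) (Y : Fin d × Bool → A)
    (j : Fin d) : ∃ c, winHost T k X Y j = Y (j, c) := by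
  rw [winHost]
  split_ifs
  · exact ⟨true, rfl⟩
  · exact ⟨false, rfl⟩

theorem arrival_sub_le (X : Fin ℓ → I) (T : Finset I) {k s : ℕ} (hs : s ≤ ℓ + 1) :
    arrival X T k s - s ≤ cnt X Finset.univ s (arrival X T k s) + 1 := by
  have h1 := arrival_le X T k s
  rcases Nat.lt_or_ge ℓ (arrival X T k s) with h2 | h2
  · have h3 := cnt_mono_right X Finset.univ s h2.le
    rw [cnt_univ X le_rfl] at h3
    omega
  · rw [cnt_univ X h2]
    omega

variable {n : ℕ} {Λ : Type} {V : Finset (Fin n)}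

/-- The number of bits by which two agents announce when they see their shares. -/
def raceBits (T : A → Finset I) (k : A → ℕ) (X : Fin ℓ → I) (Y : Fin d × Bool → A) (L b : ℕ)
    (j : Fin d) : ℕ :=
  (arrival X (T (Y (j, true))) (k (Y (j, true))) (winStart T k X Y j) - winStart T k X Y j) / L + 1 + b +
    ((arrival X (T (Y (j, false))) (k (Y (j, false))) (winStart T k X Y j) - winStart T k X Y j) / L +
      1 + b)

theorem sum_raceBits_le (T : A → Finset I) (k : A → ℕ) (X : Fin ℓ → I) (Y : Fin d × Bool → A)
    {L : ℕ} (hL : 1 ≤ L) (b : ℕ) :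
    ((∑ j, raceBits T k X Y L b j : ℕ) : ℝ) ≤ waits T k X Y / L + d * (4 + 2 * b) := by
  have hL' : (1 : ℝ) ≤ L := by exact_mod_cast hL
  rw [waits, Finset.sum_div]
  have : (d : ℝ) * (4 + 2 * b) = ∑ _j : Fin d, (4 + 2 * b : ℝ) := by simp; ring
  rw [this, ← Finset.sum_add_distrib, Nat.cast_sum]
  refine Finset.sum_le_sum fun j _ => ?_
  have key : ∀ a : A, (((arrival X (T a) (k a) (winStart T k X Y j) - winStart T k X Y j) / L : ℕ) : ℝ) ≤
      (cnt X Finset.univ (winStart T k X Y j) (arrival X (T a) (k a) (winStart T k X Y j)) : ℝ) / L + 1 := by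
    intro a
    have h1 := arrival_sub_le X (T a) (k := k a) (winStart_le (T := T) (k := k) X Y j)
    refine Nat.cast_div_le.trans ?_
    rw [div_add_one (by positivity)]
    refine div_le_div_of_nonneg_right ?_ (by positivity)
    have : ((arrival X (T a) (k a) (winStart T k X Y j) - winStart T k X Y j : ℕ) : ℝ) ≤
      cnt X Finset.univ (winStart T k X Y j) (arrival X (T a) (k a) (winStart T k X Y j)) + 1 := by
      exact_mod_cast h1
    linarith
  have h1 := key (Y (j, true))
  have h2 := key (Y (j, false))
  rw [raceBits, add_div]
  push_cast
  linarith

/-- The agents find the windows of a block and their hosts. -/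
theorem exists_windows [Nonempty A] (θ : Λ → Finset I) (k : Λ → ℕ) (X : Fin ℓ → I)
    (Y : Fin d × Bool → A) (φ : A → Fin n) {L b : ℕ} (hL : 1 ≤ L) (hb : L ≤ 2 ^ b) :
    ∃ t : RTree Λ n ((ℕ → ℕ) × (Fin d → A)), ∀ v : Fin n → Λ, (∀ a, 1 ≤ k (v (φ a))) →
      t.Spec v (fun p => p = (winStart (fun a => θ (v (φ a))) (fun a => k (v (φ a))) X Y,
        winHost (fun a => θ (v (φ a))) (fun a => k (v (φ a))) X Y))
        ((∑ j, raceBits (fun a => θ (v (φ a))) (fun a => k (v (φ a))) X Y L b j : ℕ) : ℝ≥0∞) := by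
  have key : ∀ e ≤ d, ∃ t : RTree Λ n ((ℕ → ℕ) × (ℕ → A)), ∀ v : Fin n → Λ,
      (∀ a, 1 ≤ k (v (φ a))) →
      t.Spec v (fun p => (∀ j ≤ e, p.1 j =
          winStart (fun a => θ (v (φ a))) (fun a => k (v (φ a))) X Y j) ∧
        ∀ j : Fin d, j.1 < e → p.2 j =
          winHost (fun a => θ (v (φ a))) (fun a => k (v (φ a))) X Y j)
        ((∑ j ∈ Finset.range e, if h : j < d then
          raceBits (fun a => θ (v (φ a))) (fun a => k (v (φ a))) X Y L b ⟨j, h⟩ else 0 : ℕ) : ℝ≥0∞) := by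
    intro e
    induction e with
    | zero =>
      intro _
      refine ⟨.ret (fun _ => 0, fun _ => Classical.arbitrary A), fun v _ => RTree.spec_ret ⟨?_, ?_⟩⟩
      · intro j hj
        rw [Nat.le_zero.1 hj, winStart]
      · intro j hj
        omega
    | succ e ih =>
      intro he
      obtain ⟨t, ht⟩ := ih (by omega)
      have hann : ∀ (c : Bool) (s : ℕ), ∃ a : RTree Λ n ℕ, ∀ v : Fin n → Λ,
          a.Spec v (fun r => r = arrival X (θ (v (φ (Y (⟨e, he⟩, c))))) (k (v (φ (Y (⟨e, he⟩, c))))) s - s)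
            (((arrival X (θ (v (φ (Y (⟨e, he⟩, c))))) (k (v (φ (Y (⟨e, he⟩, c))))) s - s) / L + 1 + b : ℕ) :
              ℝ≥0∞) := fun c s =>
        RTree.exists_announce_small (φ (Y (⟨e, he⟩, c))) hL hb (ℓ + 1)
          (fun x => arrival X (θ x) (k x) s - s) fun x => by
            have := arrival_le X (θ x) (k x) s
            have h2 : (ℓ + 1 + 1) * 1 ≤ (ℓ + 1 + 1) * L := Nat.mul_le_mul_left _ hL
            omega
      choose a ha using hann
      refine ⟨t.bind fun p => (a true (p.1 e)).bind fun r => (a false (p.1 e)).bind fun r' =>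
        .ret (Function.update p.1 (e + 1) (p.1 e + min r r'),
          Function.update p.2 e (if r ≤ r' then Y (⟨e, he⟩, true) else Y (⟨e, he⟩, false))),
        fun v hv => ?_⟩
      rw [Finset.sum_range_succ, dif_pos (show e < d from he), Nat.cast_add]
      refine (ht v hv).bind fun p hp => ?_
      set T : A → Finset I := fun a => θ (v (φ a))
      set κ : A → ℕ := fun a => k (v (φ a))
      have h1 : ∀ c, winStart T κ X Y e ≤
          arrival X (T (Y (⟨e, he⟩, c))) (κ (Y (⟨e, he⟩, c))) (winStart T κ X Y e) := fun c =>
        le_arrival _ _ (hv _) (winStart_le _ _ _)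
      have hpe := hp.1 e le_rfl
      rw [raceBits, Nat.cast_add, hpe]
      refine (ha true _ v).bind fun r hr => ?_
      rw [← add_zero (Nat.cast _)]
      refine (ha false _ v).bind fun r' hr' => RTree.spec_ret ⟨fun j hj => ?_, fun j hj => ?_⟩
      · simp only
        by_cases hje : j = e + 1
        · subst hje
          have := h1 true
          have := h1 false
          have h2 := winStart_succ (T := T) (k := κ) X Y ⟨e, he⟩
          simp only at h2
          rw [Function.update_self, h2, hr, hr']
          simp only [T, κ] at *
          omega
        · rw [Function.update_of_ne hje]
          exact hp.1 j (by omega)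
      · simp only
        by_cases hje : j.1 = e
        · obtain rfl : j = ⟨e, he⟩ := Fin.ext hje
          rw [Function.update_self, winHost]
          have h2 := h1 true
          have h3 := h1 false
          refine if_congr ?_ rfl rfl
          rw [hr, hr']
          simp only [T, κ] at *
          omega
        · rw [Function.update_of_ne hje]
          exact hp.2 j (by omega)
  obtain ⟨t, ht⟩ := key d le_rfl
  refine ⟨t.bind fun p => .ret (fun j => if j ≤ d then p.1 j else ℓ + 1, fun j => p.2 j),
    fun v hv => ?_⟩
  have h1 := ht v hv
  rw [Finset.sum_range] at h1
  simp only [Fin.is_lt, dif_pos, Fin.eta] at h1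
  rw [← add_zero (Nat.cast _)]
  refine h1.bind fun p hp => RTree.spec_ret ?_
  refine Prod.ext ?_ ?_
  · funext j
    simp only
    split_ifs with hj
    · exact hp.1 j hj
    · obtain ⟨j, rfl⟩ : ∃ j', j = j' + 1 := ⟨j - 1, by omega⟩
      rw [winStart, dif_neg (by omega)]
  · funext j
    exact hp.2 j trivial

end

/-! ### A round with fixed random choices. -/

section

variable {n m K ℓ d : ℕ} {R : Finset (Fin m)} {V : Finset (Fin n)}

/-- The windows in which somebody sees her share. -/
def winSet (ℓ d : ℕ) (ws : Fin K → ℕ → ℕ) : Finset (Fin K × Fin d) :=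
  Finset.univ.filter fun w => ws w.1 (w.2 + 1) ≤ ℓ

/-- The lengths of the windows. -/
def winLength (ws : Fin K → ℕ → ℕ) (w : Fin K × Fin d) : ℕ := ws w.1 (w.2 + 1) - ws w.1 w.2

/-- The first items of the windows. -/
def winItems (X : Fin K → Fin ℓ → {e // e ∈ R}) (ws : Fin K → ℕ → ℕ) (w : Fin K × Fin d) (y : ℕ) :
    Finset (Fin m) :=
  (Finset.univ.filter fun q : Fin ℓ => ws w.1 w.2 ≤ q.1 ∧ q.1 < ws w.1 w.2 + y).image
    fun q => (X w.1 q : Fin m)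

theorem isPrefix_winItems (X : Fin K → Fin ℓ → {e // e ∈ R}) (ws : Fin K → ℕ → ℕ) :
    IsPrefix (winItems X ws : Fin K × Fin d → ℕ → Finset (Fin m)) := by
  constructor
  · intro w
    rw [winItems, Finset.filter_false_of_mem, Finset.image_empty]
    intro q _
    omega
  · intro w a b hab
    refine Finset.image_subset_image fun q hq => ?_
    simp only [Finset.mem_filter] at hq ⊢
    exact ⟨hq.1, by omega⟩
  · intro w y
    rw [Finset.card_le_one]
    have key : ∀ e ∈ winItems X ws w (y + 1) \ winItems X ws w y,
        ∃ q : Fin ℓ, q.1 = ws w.1 w.2 + y ∧ (X w.1 q : Fin m) = e := by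
      intro e he
      obtain ⟨h1, h2⟩ := Finset.mem_sdiff.1 he
      obtain ⟨q, hq, rfl⟩ := Finset.mem_image.1 h1
      have hq := (Finset.mem_filter.1 hq).2
      refine ⟨q, ?_, rfl⟩
      by_contra hne
      exact h2 (Finset.mem_image_of_mem _ (Finset.mem_filter.2 ⟨Finset.mem_univ _, by omega⟩))
    intro e he e' he'
    obtain ⟨q, hq, rfl⟩ := key e he
    obtain ⟨q', hq', rfl⟩ := key e' he'
    rw [show q = q' from Fin.ext (hq.trans hq'.symm)]

theorem card_inter_winItems {X : Fin K → Fin ℓ → {e // e ∈ R}} (hX : ∀ s, Function.Injective (X s))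
    (ws : Fin K → ℕ → ℕ) (T : Finset (Fin m)) (w : Fin K × Fin d) (y : ℕ) :
    (T ∩ winItems X ws w y).card =
      cnt (X w.1) (T.subtype (· ∈ R)) (ws w.1 w.2) (ws w.1 w.2 + y) := by
  rw [cnt_eq_card, ← Finset.card_image_of_injective _ (Subtype.val_injective.comp (hX w.1))]
  congr 1
  ext e
  simp only [Finset.mem_inter, winItems, Finset.mem_image, Finset.mem_filter, Finset.mem_univ,
    true_and, Finset.mem_subtype, Function.comp]
  constructor
  · rintro ⟨h1, q, h2, rfl⟩
    exact ⟨q, ⟨h2, h1⟩, rfl⟩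
  · rintro ⟨q, ⟨h2, h1⟩, rfl⟩
    exact ⟨h1, q, h2, rfl⟩

theorem sum_winSet {M : Type} [AddCommMonoid M] (ws : Fin K → ℕ → ℕ) (f : Fin K × Fin d → M) :
    ∑ w ∈ winSet ℓ d ws, f w = ∑ s, ∑ j : Fin d, if ws s (j + 1) ≤ ℓ then f (s, j) else 0 := by
  rw [winSet, Finset.sum_filter, Fintype.sum_prod_type]

variable {v : Fin n → Finset (Fin m)} {k : Finset (Fin m) → ℕ} {τ : Finset (Fin m) → Finset (Fin m)}
  {X : Fin K → Fin ℓ → {e // e ∈ R}} {Y : Fin K → Fin d × Bool → {i // i ∈ V}}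

/-- The liked items that are used, as a set of remaining items. -/
def restricted (R : Finset (Fin m)) (τ : Finset (Fin m) → Finset (Fin m)) (x : Finset (Fin m)) :
    Finset {e // e ∈ R} := (τ x).subtype (· ∈ R)

/-- The starts of the windows in all blocks. -/
def allStarts (v : Fin n → Finset (Fin m)) (k : Finset (Fin m) → ℕ)
    (τ : Finset (Fin m) → Finset (Fin m)) (X : Fin K → Fin ℓ → {e // e ∈ R})
    (Y : Fin K → Fin d × Bool → {i // i ∈ V}) (s : Fin K) : ℕ → ℕ :=
  winStart (fun a : {i // i ∈ V} => restricted R τ (v a)) (fun a => k (v a)) (X s) (Y s)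

/-- The hosts of the windows in all blocks. -/
def allHosts (v : Fin n → Finset (Fin m)) (k : Finset (Fin m) → ℕ)
    (τ : Finset (Fin m) → Finset (Fin m)) (X : Fin K → Fin ℓ → {e // e ∈ R})
    (Y : Fin K → Fin d × Bool → {i // i ∈ V}) (w : Fin K × Fin d) : Fin n :=
  (winHost (fun a : {i // i ∈ V} => restricted R τ (v a)) (fun a => k (v a)) (X w.1) (Y w.1) w.2).1

variable (h : Exact (fun a : {i // i ∈ V} => restricted R τ (v a)) (fun a => k (v a)))
include h

theorem allStarts_mono (s : Fin K) : Monotone (allStarts v k τ X Y s) := winStart_mono h _ _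

theorem start_add_winLength (w : Fin K × Fin d) : allStarts v k τ X Y w.1 w.2 +
    winLength (allStarts v k τ X Y) w = allStarts v k τ X Y w.1 (w.2 + 1) := by
  have := allStarts_mono h (X := X) (Y := Y) w.1 (Nat.le_succ w.2)
  rw [winLength]
  simp only [Nat.succ_eq_add_one] at this
  omega

theorem disjoint_winItems (hX : Function.Injective fun p : Fin K × Fin ℓ => X p.1 p.2)
    {w w' : Fin K × Fin d} (hw : w ≠ w') :
    Disjoint (winItems X (allStarts v k τ X Y) w (winLength (allStarts v k τ X Y) w))
      (winItems X (allStarts v k τ X Y) w' (winLength (allStarts v k τ X Y) w')) := by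
  rw [Finset.disjoint_left]
  intro e he he'
  obtain ⟨q, hq, rfl⟩ := Finset.mem_image.1 he
  obtain ⟨q', hq', e⟩ := Finset.mem_image.1 he'
  have e := @hX (w'.1, q') (w.1, q) (Subtype.ext e)
  rw [Prod.mk.injEq] at e
  have hq := (Finset.mem_filter.1 hq).2
  have hq' := (Finset.mem_filter.1 hq').2
  rw [start_add_winLength h] at hq hq'
  rw [e.1, e.2] at hq'
  refine hw (Prod.ext e.1.symm (Fin.ext ?_))
  rcases lt_trichotomy w.2.1 w'.2.1 with h1 | h1 | h1
  · have := allStarts_mono h (X := X) (Y := Y) w.1 (Nat.succ_le_of_lt h1)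
    simp only [Nat.succ_eq_add_one] at this
    omega
  · exact h1
  · have := allStarts_mono h (X := X) (Y := Y) w.1 (Nat.succ_le_of_lt h1)
    simp only [Nat.succ_eq_add_one] at this
    omega

theorem hosted_allHosts (hX : Function.Injective fun p : Fin K × Fin ℓ => X p.1 p.2)
    (hY : Function.Injective fun p : Fin K × (Fin d × Bool) => Y p.1 p.2) :
    Hosted k τ (winItems X (allStarts v k τ X Y)) V (winSet ℓ d (allStarts v k τ X Y))
      (winLength (allStarts v k τ X Y)) v (winLength (allStarts v k τ X Y))
      (allHosts v k τ X Y) := by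
  have hX' : ∀ s, Function.Injective (X s) := fun s q q' e => by
    simpa using @hX (s, q) (s, q') e
  refine ⟨fun _ _ => le_rfl, fun w _ => by rw [allHosts]; exact Subtype.prop _, ?_, ?_⟩
  · intro w _ w' _ e
    obtain ⟨c, hc⟩ := winHost_mem (fun a : {i // i ∈ V} => restricted R τ (v a)) (fun a => k (v a))
      (X w.1) (Y w.1) w.2
    obtain ⟨c', hc'⟩ := winHost_mem (fun a : {i // i ∈ V} => restricted R τ (v a)) (fun a => k (v a))
      (X w'.1) (Y w'.1) w'.2
    have e := Subtype.ext e
    rw [hc, hc'] at e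
    have := @hY (w.1, (w.2, c)) (w'.1, (w'.2, c')) e
    simp only [Prod.mk.injEq] at this
    exact Prod.ext this.1 this.2.1
  · intro w hw
    rw [card_inter_winItems hX', start_add_winLength h]
    have hw := (Finset.mem_filter.1 hw).2
    have h1 := arrival_winHost (fun a : {i // i ∈ V} => restricted R τ (v a)) (fun a => k (v a))
      (X w.1) (Y w.1) w.2
    change arrival _ (restricted R τ (v (allHosts v k τ X Y w))) (k (v (allHosts v k τ X Y w))) _ =
      allStarts v k τ X Y w.1 (w.2 + 1) at h1
    rw [← h1] at hw ⊢
    exact le_cnt_arrival hw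

theorem card_winSet : ((winSet ℓ d (allStarts v k τ X Y)).card : ℝ) =
    ∑ s, completed (fun a : {i // i ∈ V} => restricted R τ (v a)) (fun a => k (v a)) (X s) (Y s) := by
  rw [Finset.card_eq_sum_ones, Nat.cast_sum, sum_winSet]
  simp [completed, allStarts]

theorem windowCount_eq (hX : ∀ s, Function.Injective (X s)) (i : {i // i ∈ V}) :
    (windowCount τ (winItems X (allStarts v k τ X Y)) (winSet ℓ d (allStarts v k τ X Y))
      (winLength (allStarts v k τ X Y)) (v i) : ℝ) =
    (winSet ℓ d (allStarts v k τ X Y)).card * k (v i) +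
      ∑ s, excess (fun a : {i // i ∈ V} => restricted R τ (v a)) (fun a => k (v a)) i (X s) (Y s) := by
  have h1 : ∑ s, excess (fun a : {i // i ∈ V} => restricted R τ (v a)) (fun a => k (v a)) i (X s) (Y s) =
      ∑ w ∈ winSet ℓ d (allStarts v k τ X Y), (((τ (v i) ∩ winItems X (allStarts v k τ X Y) w
        (winLength (allStarts v k τ X Y) w)).card : ℝ) - k (v i)) := by
    rw [sum_winSet]
    refine Finset.sum_congr rfl fun s _ => Finset.sum_congr rfl fun j _ => ?_
    refine if_congr Iff.rfl ?_ rfl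
    rw [card_inter_winItems hX, start_add_winLength h]
    rfl
  rw [h1, Finset.sum_sub_distrib, windowCount]
  simp

/-- If an agent finishes exactly at the end of a window, she has seen fewer than `k` liked items
before the last position and at least `k` after it, so she likes the last item. -/
theorem card_untied_le (hX : ∀ s, Function.Injective (X s)) (i : {i // i ∈ V}) :
    ((untied τ (winItems X (allStarts v k τ X Y)) (winSet ℓ d (allStarts v k τ X Y))
      (winLength (allStarts v k τ X Y)) (v i)).card : ℝ) ≤
      ∑ s, misses (fun a : {i // i ∈ V} => restricted R τ (v a)) (fun a => k (v a)) i (X s) (Y s) := by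
  have aux : ∀ (p q r : Prop) [Decidable p] [Decidable r] [Decidable (p ∧ q)], (p → r → q) →
      (if p then ((if r then 1 else 0 : ℕ) : ℝ) else 0) ≤ if p ∧ q then 1 else 0 := by
    intro p q r _ _ _ h1
    by_cases hp : p <;> by_cases hr : r
    · rw [if_pos hp, if_pos hr, if_pos ⟨hp, h1 hp hr⟩, Nat.cast_one]
    all_goals
      split_ifs <;> norm_num
  rw [untied, Finset.card_filter, Nat.cast_sum, sum_winSet]
  refine Finset.sum_le_sum fun s _ => Finset.sum_le_sum fun j _ => aux _ _ _ fun h1 h0 h2 => h0 ?_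
  · change allStarts v k τ X Y s (j + 1) ≤ ℓ at h1
    change arrival (X s) (restricted R τ (v i)) (k (v i)) (allStarts v k τ X Y s j) =
      allStarts v k τ X Y s (j + 1) at h2
    rw [card_inter_winItems hX, card_inter_winItems hX, start_add_winLength h]
    have hk := h.pos i
    have h3 := le_cnt_arrival (h2.trans_le h1)
    rw [h2] at h3
    have h4 : allStarts v k τ X Y s j < allStarts v k τ X Y s (j + 1) := by
      by_contra h4
      rw [cnt_eq_zero _ _ (not_lt.1 h4)] at h3
      omega
    have h5 : allStarts v k τ X Y s j + (winLength (allStarts v k τ X Y) (s, j) - 1) <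
        allStarts v k τ X Y s (j + 1) := by
      have := start_add_winLength h (X := X) (Y := Y) (s, j)
      simp only at this
      omega
    rw [← h2] at h5
    exact (lt_arrival_iff.1 h5).2.trans_le h3

theorem sum_sq_winLength_le : ((∑ w ∈ winSet ℓ d (allStarts v k τ X Y),
    winLength (allStarts v k τ X Y) w ^ 2 : ℕ) : ℝ) ≤
      ∑ s, sqLengths (fun a : {i // i ∈ V} => restricted R τ (v a)) (fun a => k (v a)) (X s) (Y s) := by
  rw [sum_winSet, Nat.cast_sum]
  refine Finset.sum_le_sum fun s _ => ?_
  rw [Nat.cast_sum]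
  refine Finset.sum_le_sum fun j _ => ?_
  split_ifs with h1
  · have h2 := cnt_univ (X s) (s := allStarts v k τ X Y s j) h1
    rw [winLength, ← h2, Nat.cast_pow]
    rfl
  · rw [Nat.cast_zero]
    positivity

omit h in
/-- A round of the protocol, for given random choices. -/
theorem exists_round [Nonempty (Fin K × Fin d)] [Nonempty {i // i ∈ V}]
    (hX : Function.Injective fun p : Fin K × Fin ℓ => X p.1 p.2)
    (hY : Function.Injective fun p : Fin K × (Fin d × Bool) => Y p.1 p.2)
    (k : Finset (Fin m) → ℕ) (τ : Finset (Fin m) → Finset (Fin m)) (hτ : ∀ x, τ x ⊆ x ∩ R)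
    {L b B Z g : ℕ} (hL : 1 ≤ L) (hb : L ≤ 2 ^ b) (hB : K * d ≤ 2 ^ B) (hZ : 0 < Z) (hg : 0 < g)
    (sol : Finset (Fin m) → Finset (Fin n) → RTree (Finset (Fin m)) n (Fin m → Fin n)) :
    ∃ t : RTree (Finset (Fin m)) n (Fin m → Fin n), ∀ (v : Fin n → Finset (Fin m)) (c : ℝ≥0∞),
      Exact (fun a : {i // i ∈ V} => restricted R τ (v a)) (fun a => k (v a)) →
      (∀ R' V', V' ⊆ V → V'.card + (winSet ℓ d (allStarts v k τ X Y)).card = V.card →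
        HasShares k R' V' v → (sol R' V').Spec v (GivesShares k R' V' v) c) →
      t.Spec v (GivesShares k R V v) (ENNReal.ofReal (
        (∑ s, waits (fun a : {i // i ∈ V} => restricted R τ (v a)) (fun a => k (v a)) (X s) (Y s)) / L +
        K * d * (4 + 2 * b) + (V.card + (B + 1) * (Z * ((V.card : ℝ) / g + ∑ i : {i // i ∈ V},
          if 0 < ∑ s, excess (fun a : {i // i ∈ V} => restricted R τ (v a)) (fun a => k (v a)) i (X s) (Y s) ∧
            (V.card : ℝ) / g <
            ∑ s, excess (fun a : {i // i ∈ V} => restricted R τ (v a)) (fun a => k (v a)) i (X s) (Y s) +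
            ∑ s, misses (fun a : {i // i ∈ V} => restricted R τ (v a)) (fun a => k (v a)) i (X s) (Y s)
          then (1 : ℝ) else 0) +
        (∑ s, sqLengths (fun a : {i // i ∈ V} => restricted R τ (v a)) (fun a => k (v a)) (X s) (Y s)) / Z))) +
        c) := by
  classical
  have h1 : ∀ s, ∃ t : RTree (Finset (Fin m)) n ((ℕ → ℕ) × (Fin d → {i // i ∈ V})), ∀ v,
      (∀ a : {i // i ∈ V}, 1 ≤ k (v a)) → t.Spec v _ _ := fun s =>
    exists_windows (restricted R τ) k (X s) (Y s) (fun a => (a : Fin n)) hL hb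
  choose t ht using h1
  obtain ⟨t', ht'⟩ := RTree.exists_forall t Finset.univ
  have hcard : Fintype.card (Fin K × Fin d) ≤ 2 ^ B := by simpa using hB
  have h2 : ∀ p : Fin K → (ℕ → ℕ) × (Fin d → {i // i ∈ V}), ∃ t, _ := fun p =>
    exists_shareOut k τ (isPrefix_winItems (d := d) X fun s => (p s).1) R hτ V
      (winSet ℓ d fun s => (p s).1) (winLength fun s => (p s).1) (fun w => ((p w.1).2 w.2 : Fin n))
      hcard hZ sol
  choose t'' ht'' using h2
  refine ⟨t'.bind t'', fun v c hE hsol => ?_⟩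
  have hX' : ∀ s, Function.Injective (X s) := fun s q q' e => by
    simpa using @hX (s, q) (s, q') e
  have h3 := ht' v _ _ fun s => ht s v hE.pos
  set S := winSet ℓ d (allStarts v k τ X Y) with hS
  set P : Fin K × Fin d → ℕ → Finset (Fin m) := winItems X (allStarts v k τ X Y) with hP
  set y : Fin K × Fin d → ℕ := winLength (allStarts v k τ X Y) with hy
  set F := V.card / g
  -- The exceptional agents for the takeovers. Every other agent with too many items in the windows
  -- has small excess and likes the last items of all but few windows.
  set D := V.filter fun i => S.card * k (v i) < windowCount τ P S y (v i) ∧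
    F + S.card * k (v i) < windowCount τ P S y (v i) + (untied τ P S y (v i)).card
  have hH := hosted_allHosts hE hX hY
  have hSV : S.card ≤ V.card := by
    rw [← hH.card_image]
    exact Finset.card_le_card fun i hi => by
      obtain ⟨w, hw, rfl⟩ := Finset.mem_image.1 hi
      exact hH.mem w hw
  refine (h3.bind (c' := ((V.card + (B + 1) * (Z * (F + D.card) + ∑ w ∈ S, y w ^ 2 / Z) : ℕ) + c))
    fun p hp => ?_).mono (fun _ h => h) ?_
  · obtain rfl : p = fun s => (allStarts v k τ X Y s, winHost (fun a : {i // i ∈ V} =>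
        restricted R τ (v a)) (fun a => k (v a)) (X s) (Y s)) := by
      funext s
      exact hp s (Finset.mem_univ s)
    refine ht'' _ v D F c (fun w _ w' _ hne => disjoint_winItems hE hX hne) ?_ hH ?_ ?_
    · intro i hi hiD h4
      by_contra h5
      exact hiD (Finset.mem_filter.2 ⟨hi, h4, not_le.1 h5⟩)
    · intro i hi
      have h4 := hE.card ⟨i, hi⟩
      rw [Fintype.card_coe] at h4
      simp only [restricted] at h4
      rw [← h4, Finset.card_subtype]
      exact Finset.card_le_card (Finset.filter_subset _ _)
    · intro R' V' hV' hcV' hs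
      exact hsol R' V' hV' (by change _ = V.card - S.card at hcV'; omega) hs
  · rw [← add_assoc]
    refine add_le_add_left ?_ _
    rw [← Nat.cast_sum, ← Nat.cast_add]
    rw [← ENNReal.ofReal_natCast]
    refine ENNReal.ofReal_le_ofReal ?_
    rw [Nat.cast_add]
    refine add_le_add ?_ ?_
    · rw [Nat.cast_sum]
      refine (Finset.sum_le_sum fun s _ => sum_raceBits_le _ _ _ _ hL b).trans (le_of_eq ?_)
      rw [Finset.sum_add_distrib, Finset.sum_div]
      simp
      ring
    · push_cast
      have hF : ((F : ℕ) : ℝ) ≤ V.card / g := Nat.cast_div_le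
      have hD : (D.card : ℝ) ≤ ∑ i : {i // i ∈ V},
          if 0 < ∑ s, excess (fun a : {i // i ∈ V} => restricted R τ (v a)) (fun a => k (v a)) i (X s) (Y s) ∧
            (V.card : ℝ) / g <
            ∑ s, excess (fun a : {i // i ∈ V} => restricted R τ (v a)) (fun a => k (v a)) i (X s) (Y s) +
            ∑ s, misses (fun a : {i // i ∈ V} => restricted R τ (v a)) (fun a => k (v a)) i (X s) (Y s)
          then (1 : ℝ) else 0 := by
        rw [Finset.card_filter, ← Finset.sum_coe_sort V, Nat.cast_sum]
        refine Finset.sum_le_sum fun i _ => ?_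
        have h4 := windowCount_eq hE hX' (Y := Y) i
        have h5 := card_untied_le hE hX' (Y := Y) i
        by_cases h6 : S.card * k (v i) < windowCount τ P S y (v i) ∧
          F + S.card * k (v i) < windowCount τ P S y (v i) + (untied τ P S y (v i)).card
        · rw [if_pos h6, if_pos]
          · simp
          obtain ⟨h7, h8⟩ := h6
          have h7 : (S.card : ℝ) * k (v i) < windowCount τ P S y (v i) := by exact_mod_cast h7
          have h8 : ((F + 1 : ℕ) : ℝ) + S.card * k (v i) ≤ windowCount τ P S y (v i) +
            (untied τ P S y (v i)).card := by exact_mod_cast (by omega : F + 1 + _ ≤ _)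
          -- The integer threshold `F` is rounded down, but exceeding it means being at least `F +
          -- 1`, which is above `|V| / g`.
          have h9 : (V.card : ℝ) / g < ((F + 1 : ℕ) : ℝ) := by
            rw [div_lt_iff₀ (by exact_mod_cast hg), mul_comm]
            exact_mod_cast Nat.lt_mul_div_succ V.card hg
          constructor <;> linarith
        · rw [if_neg h6]
          split_ifs <;> norm_num
      have hQ : (∑ w ∈ S, ((y w ^ 2 / Z : ℕ) : ℝ)) ≤
          (∑ s, sqLengths (fun a : {i // i ∈ V} => restricted R τ (v a)) (fun a => k (v a)) (X s) (Y s)) / Z := by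
        refine (Finset.sum_le_sum fun w _ => Nat.cast_div_le).trans ?_
        rw [← Finset.sum_div, ← Nat.cast_sum]
        exact div_le_div_of_nonneg_right (sum_sq_winLength_le hE) (by positivity)
      gcongr

end

/-! ### A round with random choices. -/

section

variable {n m : ℕ} {R : Finset (Fin m)} {V : Finset (Fin n)}

/-- Every agent discards liked items such that she keeps a multiple of the number of agents. -/
theorem exists_trim (k : Finset (Fin m) → ℕ) (R : Finset (Fin m)) (V : Finset (Fin n)) :
    ∃ τ : Finset (Fin m) → Finset (Fin m), (∀ x, τ x ⊆ x ∩ R) ∧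
      ∀ v : Fin n → Finset (Fin m), HasShares k R V v → (∀ i ∈ V, 1 ≤ k (v i)) →
        Exact (fun a : {i // i ∈ V} => restricted R τ (v a)) (fun a => k (v a)) := by
  classical
  have h1 : ∀ x : Finset (Fin m), ∃ T ⊆ x ∩ R, V.card * k x ≤ (x ∩ R).card →
      T.card = V.card * k x := by
    intro x
    by_cases hx : V.card * k x ≤ (x ∩ R).card
    · obtain ⟨T, hT, hc⟩ := Finset.exists_subset_card_eq hx
      exact ⟨T, hT, fun _ => hc⟩
    · exact ⟨∅, Finset.empty_subset _, fun h => absurd h hx⟩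
  choose τ hτ hc using h1
  refine ⟨τ, hτ, fun v hv hk => ⟨fun a => hk a a.2, fun a => ?_⟩⟩
  rw [restricted, Finset.card_subtype, Finset.filter_true_of_mem
    fun e he => (Finset.mem_inter.1 (hτ _ he)).2, hc _ (hv a a.2), Fintype.card_coe]

theorem injective_comp_blockEmb {K : ℕ} {I J : Type} (ι : Fin K × J ↪ I) (σ : Equiv.Perm I) :
    Function.Injective fun p : Fin K × J => (σ ∘ blockEmb ι p.1) p.2 := by
  intro p p' h
  exact ι.injective (σ.injective h)

/-- A round of the protocol, with random choices. -/
theorem exists_averaged_round [Nonempty {i // i ∈ V}] (k : Finset (Fin m) → ℕ) {L b B Z g : ℕ}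
    (hT : Tuned {e // e ∈ R} {i // i ∈ V} g L) (hb : L ≤ 2 ^ b) (hB : V.card ≤ 2 ^ B) (hZ : 0 < Z)
    (sol : Finset (Fin m) → Finset (Fin n) → RTree (Finset (Fin m)) n (Fin m → Fin n))
    (ψ : ℕ → ℝ) (hψ : ∀ x ≤ V.card, 0 ≤ ψ x) {δ : ℝ} (hδ : 0 ≤ δ)
    (hψδ : ∀ h ≤ V.card, ψ (V.card - h) ≤ ψ V.card - δ * h) :
    ∃ t : RTree (Finset (Fin m)) n (Fin m → Fin n), ∀ v : Fin n → Finset (Fin m),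
      HasShares k R V v → (∀ i ∈ V, 1 ≤ k (v i)) →
      (∀ R' V', V' ⊆ V → HasShares k R' V' v →
        (sol R' V').Spec v (GivesShares k R' V' v) (ENNReal.ofReal (ψ V'.card))) →
      t.Spec v (GivesShares k R V v) (ENNReal.ofReal (V.card * (3 / 8 + (4 + 2 * b) / 16 + 1) +
        (B + 1) * (Z * (2 * V.card / g) + V.card * L ^ 2 / (4 * Z)) + (ψ V.card - δ * V.card / 64))) := by
  obtain ⟨⟨ι⟩, ⟨κ⟩⟩ := exists_block_embedding hT
  obtain ⟨τ, hτ, hE⟩ := exists_trim k R V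
  have hg0 : 0 < g := lt_of_lt_of_le (by norm_num) hT.large
  have hL : (1 : ℝ) ≤ L := hT.one_le_ratio.trans hT.ratio_le
  have hL' : 1 ≤ L := by exact_mod_cast hL
  have hK := hT.blockCount_mul_le
  have hK' := hT.le_blockCount_mul
  rw [Fintype.card_coe] at hK hK'
  have hKd : blockCount {i // i ∈ V} g * g ^ 4 ≤ V.card := by
    have h1 : ((blockCount {i // i ∈ V} g * g ^ 4 : ℕ) : ℝ) ≤ V.card := by
      push_cast
      have : (0 : ℝ) ≤ V.card := by positivity
      linarith
    exact_mod_cast h1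
  have hne : Nonempty (Fin (blockCount {i // i ∈ V} g) × Fin (g ^ 4)) := by
    refine ⟨⟨⟨0, Nat.div_pos ?_ (by positivity)⟩, ⟨0, by positivity⟩⟩⟩
    refine le_trans ?_ hT.pow_le
    rw [show g ^ 24 = g ^ 20 * g ^ 4 by ring]
    refine Nat.mul_le_mul_right _ (le_trans ?_ (Nat.pow_le_pow_left hT.large 20))
    norm_num
  have h1 : ∀ ω : Equiv.Perm {e // e ∈ R} × Equiv.Perm {i // i ∈ V}, ∃ t, _ := fun ω =>
    exists_round (X := fun s => ω.1 ∘ blockEmb ι s) (Y := fun s => ω.2 ∘ blockEmb κ s)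
      (injective_comp_blockEmb ι ω.1) (injective_comp_blockEmb κ ω.2) k τ hτ hL' hb
      (hKd.trans hB) hZ hg0 sol
  choose t ht using h1
  refine ⟨RTree.coinOver t, fun v hv hk hsol => ?_⟩
  have hEx := hE v hv hk
  set T : {i // i ∈ V} → Finset {e // e ∈ R} := fun a => restricted R τ (v a)
  set q : {i // i ∈ V} → ℕ := fun a => k (v a)
  set u : ℝ := (V.card : ℝ)
  set D : Equiv.Perm {e // e ∈ R} → Equiv.Perm {i // i ∈ V} → ℝ := fun σ π =>
    ∑ i, if 0 < blockSum (excess T q i) ι κ σ π ∧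
      u / g < blockSum (excess T q i) ι κ σ π + blockSum (misses T q i) ι κ σ π then (1 : ℝ) else 0
  have hS : ∀ ω : Equiv.Perm {e // e ∈ R} × Equiv.Perm {i // i ∈ V},
      ((winSet (4 * g ^ 4 * L) (g ^ 4) (allStarts v k τ (fun s => ω.1 ∘ blockEmb ι s)
        (fun s => ω.2 ∘ blockEmb κ s))).card : ℝ) = blockSum (completed T q) ι κ ω.1 ω.2 := fun ω =>
    card_winSet hEx
  have hSV : ∀ ω : Equiv.Perm {e // e ∈ R} × Equiv.Perm {i // i ∈ V},
      (winSet (4 * g ^ 4 * L) (g ^ 4) (allStarts v k τ (fun s => ω.1 ∘ blockEmb ι s)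
        (fun s => ω.2 ∘ blockEmb κ s))).card ≤ V.card := fun ω => by
    refine (Finset.card_le_univ _).trans ?_
    simpa using hKd
  have hwaits : ∀ σ π, 0 ≤ blockSum (waits T q) ι κ σ π := fun σ π =>
    Finset.sum_nonneg fun _ _ => waits_nonneg _ _
  have hsq : ∀ σ π, 0 ≤ blockSum (sqLengths T q) ι κ σ π := fun σ π =>
    Finset.sum_nonneg fun _ _ => sqLengths_nonneg _ _
  have hD : ∀ σ π, 0 ≤ D σ π := fun σ π =>
    Finset.sum_nonneg fun _ _ => by split_ifs <;> norm_num
  set c : Equiv.Perm {e // e ∈ R} → Equiv.Perm {i // i ∈ V} → ℝ := fun σ π =>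
    blockSum (waits T q) ι κ σ π / L +
      (blockCount {i // i ∈ V} g : ℝ) * ((g ^ 4 : ℕ) : ℝ) * (4 + 2 * b) +
      (u + (B + 1) * (Z * (u / g + D σ π) + blockSum (sqLengths T q) ι κ σ π / Z))
  have hc : ∀ σ π, 0 ≤ c σ π := fun σ π => by
    have := hwaits σ π
    have := hsq σ π
    have := hD σ π
    positivity
  have h2 : ∀ ω, (t ω).Spec v (GivesShares k R V v) (ENNReal.ofReal (c ω.1 ω.2 + ψ (V.card -
      (winSet (4 * g ^ 4 * L) (g ^ 4) (allStarts v k τ (fun s => ω.1 ∘ blockEmb ι s)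
        (fun s => ω.2 ∘ blockEmb κ s))).card))) := fun ω => by
    rw [ENNReal.ofReal_add (hc _ _) (hψ _ (Nat.sub_le _ _))]
    refine ht ω v _ hEx fun R' V' hV' hcard hs => ?_
    rw [← hcard, Nat.add_sub_cancel]
    exact hsol R' V' hV' hs
  refine (RTree.Spec.coinOver_ofReal (fun ω => add_nonneg (hc _ _) (hψ _ (Nat.sub_le _ _))) h2).mono (fun _ h => h)
    (ENNReal.ofReal_le_ofReal ?_)
  -- Every completed window serves a host and lowers the potential by at least `δ`; by linearity,
  -- only the expected number of completed windows is needed.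
  have h3 : ∀ ω : Equiv.Perm {e // e ∈ R} × Equiv.Perm {i // i ∈ V},
      c ω.1 ω.2 + ψ (V.card - (winSet (4 * g ^ 4 * L) (g ^ 4) (allStarts v k τ
        (fun s => ω.1 ∘ blockEmb ι s) (fun s => ω.2 ∘ blockEmb κ s))).card) ≤
      c ω.1 ω.2 + (ψ V.card - δ * blockSum (completed T q) ι κ ω.1 ω.2) := fun ω => by
    rw [← hS]
    exact add_le_add_right (hψδ _ (hSV ω)) _
  refine (Finset.expect_le_expect fun ω _ => h3 ω).trans ?_
  rw [expect_prod]
  have e1 := hT.expect_waits_le ι κ hEx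
  have e2 := hT.expect_sqLengths_le ι κ hEx
  have e3 := hT.expect_deprived_le ι κ hEx
  have e4 := hT.le_expect_completed ι κ hEx
  rw [Fintype.card_coe] at e1 e2 e3 e4
  change (𝔼 σ, 𝔼 π, D σ π) ≤ _ at e3
  simp only [c, Finset.expect_add_distrib, Finset.expect_sub_distrib, Fintype.expect_const,
    ← Finset.mul_expect, ← Finset.expect_div]
  have f1 : (𝔼 σ, 𝔼 π, blockSum (waits T q) ι κ σ π) / L ≤ 3 / 8 * u := by
    rw [div_le_iff₀ (by linarith)]
    exact e1
  have f2 : (blockCount {i // i ∈ V} g : ℝ) * ((g ^ 4 : ℕ) : ℝ) * (4 + 2 * b) ≤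
      u / 16 * (4 + 2 * b) := by
    push_cast
    gcongr
  have f3 : (𝔼 σ, 𝔼 π, blockSum (sqLengths T q) ι κ σ π) / Z ≤ u * L ^ 2 / (4 * Z) := by
    rw [show u * (L : ℝ) ^ 2 / (4 * Z) = (1 / 4 * u * (L : ℝ) ^ 2) / Z by field_simp]
    gcongr
  have f4 : (B + 1 : ℝ) * (Z * (u / g + 𝔼 σ, 𝔼 π, D σ π) +
      (𝔼 σ, 𝔼 π, blockSum (sqLengths T q) ι κ σ π) / Z) ≤
      (B + 1) * (Z * (2 * u / g) + u * L ^ 2 / (4 * Z)) := by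
    have : u / g + (𝔼 σ, 𝔼 π, D σ π) ≤ 2 * u / g := by
      rw [show 2 * u / (g : ℝ) = u / g + u / g by ring]
      linarith
    gcongr
  have f5 := mul_le_mul_of_nonneg_left e4 hδ
  have f6 : δ * (u / 64) = δ * u / 64 := by ring
  linarith

end

/-! ### Iterating the rounds. -/

/-- Up to a constant factor, the number of bits for `x` agents who share `m` items. -/
def entropyBound (m x : ℕ) : ℝ := x * (Real.logb 2 ((m : ℝ) / x) + 10)

theorem entropyBound_nonneg {m x : ℕ} (h : x ≤ m) : 0 ≤ entropyBound m x := by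
  rcases Nat.eq_zero_or_pos x with rfl | hx
  · simp [entropyBound]
  · have : 0 ≤ Real.logb 2 ((m : ℝ) / x) := by
      refine Real.logb_nonneg (by norm_num) ?_
      rw [le_div_iff₀ (by exact_mod_cast hx), one_mul]
      exact_mod_cast h
    unfold entropyBound
    positivity

/-- The derivative of `x (log₂(m/x) + 10)` is at least `log₂(m/x) + 8`, because `1 / ln 2 ≤ 2`, and
for `x ≤ u` this is at least its value at `u`. -/
theorem entropyBound_sub_le {m u h : ℕ} (hm : 0 < m) (hh : h ≤ u) :
    entropyBound m (u - h) ≤ entropyBound m u - (Real.logb 2 ((m : ℝ) / u) + 8) * h := by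
  have hm' : (0 : ℝ) < m := by exact_mod_cast hm
  obtain ⟨x, rfl⟩ : ∃ x, u = x + h := ⟨u - h, by omega⟩
  rw [Nat.add_sub_cancel]
  unfold entropyBound
  push_cast
  rcases Nat.eq_zero_or_pos x with rfl | hx
  · simp only [Nat.cast_zero, zero_add, zero_mul]
    have : (0 : ℝ) ≤ h := by positivity
    nlinarith
  have hx' : (0 : ℝ) < x := by exact_mod_cast hx
  have hh' : (0 : ℝ) ≤ h := by positivity
  have h1 : Real.logb 2 ((m : ℝ) / x) - Real.logb 2 ((m : ℝ) / (x + h)) ≤ 2 * (h / x) := by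
    rw [← Real.logb_div (by positivity) (by positivity),
      show (m : ℝ) / x / (m / (x + h)) = 1 + h / x by field_simp]
    rw [Real.logb, div_le_iff₀ (Real.log_pos (by norm_num))]
    have h2 := Real.log_le_sub_one_of_pos (show (0 : ℝ) < 1 + h / x by positivity)
    have h3 := Real.log_two_gt_d9
    have h4 : (0 : ℝ) ≤ h / x := by positivity
    nlinarith
  have h5 := mul_le_mul_of_nonneg_left h1 hx'.le
  have h6 : (x : ℝ) * (2 * (h / x)) = 2 * h := by field_simp
  linarith

section

variable {n m : ℕ}

/-- The number of bits of a counter up to `m`, and a bit more. -/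
def counterBits (m : ℕ) : ℕ := Nat.clog 2 (m + 1) + 8

theorem lt_two_pow_counterBits (m : ℕ) : m < 2 ^ counterBits m := by
  have h1 := Nat.le_pow_clog (b := 2) (by norm_num) (m + 1)
  have h2 : 2 ^ Nat.clog 2 (m + 1) ≤ 2 ^ counterBits m :=
    Nat.pow_le_pow_right (by norm_num) (by unfold counterBits; omega)
  omega

theorem clog_le_logb_add_one {x : ℕ} (hx : 0 < x) : (Nat.clog 2 x : ℝ) ≤ Real.logb 2 x + 1 := by
  rcases Nat.lt_or_ge 1 x with h | h
  · have h1 := Nat.pow_pred_clog_lt_self (b := 2) (by norm_num) h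
    have h2 : 0 < Nat.clog 2 x := Nat.clog_pos (by norm_num) h
    have h3 : ((Nat.clog 2 x - 1 : ℕ) : ℝ) ≤ Real.logb 2 x := by
      rw [Real.le_logb_iff_rpow_le (by norm_num) (by exact_mod_cast hx), Real.rpow_natCast]
      exact_mod_cast h1.le
    rw [Nat.cast_sub h2] at h3
    push_cast at h3
    linarith
  · obtain rfl : x = 1 := by omega
    simp

theorem counterBits_le {m : ℕ} (hm : 0 < m) : (counterBits m : ℝ) ≤ Real.logb 2 m + 10 := by
  have h1 := clog_le_logb_add_one (Nat.succ_pos m)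
  have h2 : Real.logb 2 ((m + 1 : ℕ) : ℝ) ≤ Real.logb 2 m + 1 := by
    have hm' : (1 : ℝ) ≤ m := by exact_mod_cast hm
    have : Real.logb 2 m + 1 = Real.logb 2 (m * 2) := by
      rw [Real.logb_mul (by positivity) (by norm_num), Real.logb_self_eq_one (by norm_num)]
    rw [this]
    refine Real.logb_le_logb_of_le (by norm_num) (by positivity) ?_
    push_cast
    linarith
  unfold counterBits
  push_cast
  simp only [Nat.succ_eq_add_one] at h1
  linarith

/-- The number of agents is not much larger than the number of items per agent: then the number of
items is small in terms of the number of items per agent. -/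
theorem counterBits_le_of_lt {m u L : ℕ} (hu : 0 < u) (hum : u ≤ m)
    (hL : (L : ℝ) ≤ 2 * (m / u)) (hL0 : 0 < L) (h : u < (L ^ 2 * counterBits m ^ 2) ^ 24) :
    (31 * counterBits m : ℝ) ≤ 2500 * (Real.logb 2 ((m : ℝ) / u) + 10) := by
  have hB := counterBits_le (hu.trans_le hum)
  have hB0 : (0 : ℝ) < counterBits m := by
    have : 0 < counterBits m := by unfold counterBits; omega
    exact_mod_cast this
  set B := counterBits m
  have hu' : (0 : ℝ) < u := by exact_mod_cast hu
  have hm' : (0 : ℝ) < m := by exact_mod_cast hu.trans_le hum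
  have hL' : (0 : ℝ) < L := by exact_mod_cast hL0
  set a := Real.logb 2 ((m : ℝ) / u) with ha
  have h1 : Real.logb 2 m = a + Real.logb 2 u := by
    rw [ha, Real.logb_div (by positivity) (by positivity)]; ring
  have h2 : Real.logb 2 u ≤ 48 * (Real.logb 2 L + Real.logb 2 B) := by
    have h3 : (u : ℝ) ≤ (L * B) ^ 48 := by
      have : u ≤ (L * B) ^ 48 := by
        refine h.le.trans (le_of_eq ?_)
        ring
      exact_mod_cast this
    refine (Real.logb_le_logb_of_le (by norm_num) hu' h3).trans (le_of_eq ?_)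
    rw [Real.logb_pow, Real.logb_mul (by positivity) (by positivity)]
    norm_num
  have h4 : Real.logb 2 L ≤ a + 1 := by
    refine (Real.logb_le_logb_of_le (by norm_num) hL' hL).trans (le_of_eq ?_)
    rw [Real.logb_mul (by norm_num) (by positivity), Real.logb_self_eq_one (by norm_num)]
    ring
  -- In the bound for `B ≈ log₂ m = a + log₂ u`, the term `48 log₂ B` appears. The slope `1/128`
  -- keeps it below `3B/8` plus a constant, so it can be moved to the left hand side.
  have h5 : Real.logb 2 B ≤ B / 128 + 8 := by
    have h6 : Real.logb 2 B = Real.logb 2 (B / 256) + 8 := by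
      rw [Real.logb_div (by positivity) (by norm_num), show (256 : ℝ) = 2 ^ (8 : ℕ) by norm_num,
        Real.logb_pow, Real.logb_self_eq_one (by norm_num)]
      norm_num
    have h7 : Real.logb 2 (B / 256) ≤ B / 128 := by
      rw [Real.logb, div_le_iff₀ (Real.log_pos (by norm_num))]
      have h2 := Real.log_le_sub_one_of_pos (show (0 : ℝ) < B / 256 by positivity)
      have h3 := Real.log_two_gt_d9
      nlinarith
    linarith
  have ha0 : 0 ≤ a := Real.logb_nonneg (by norm_num) (by
    rw [le_div_iff₀ hu', one_mul]; exact_mod_cast hum)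
  linarith

theorem evenPaz_cost_le {u m : ℕ} (hu : u ≤ m) :
    23 * (counterBits m : ℝ) * (u - √u) + 8 * u * Nat.clog 2 u ≤ 31 * counterBits m * u := by
  have h1 : Nat.clog 2 u ≤ counterBits m := by
    refine (Nat.clog_le_of_le_pow ?_)
    exact hu.trans (lt_two_pow_counterBits m).le
  have h2 : (Nat.clog 2 u : ℝ) ≤ counterBits m := by exact_mod_cast h1
  have h3 : (0 : ℝ) ≤ √u := Real.sqrt_nonneg _
  have h4 : (0 : ℝ) ≤ counterBits m := by positivity
  have h5 : (0 : ℝ) ≤ counterBits m * √u := by positivity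
  have h6 : (8 * u * Nat.clog 2 u : ℝ) ≤ 8 * u * counterBits m := by gcongr
  linarith

/-- The protocol with a bounded number of rounds. -/
theorem exists_rounds [Nonempty (Fin n)] (hnm : n ≤ m) (k : Finset (Fin m) → ℕ) (f : ℕ) :
    ∀ (R : Finset (Fin m)) (V : Finset (Fin n)), ∃ t : RTree (Finset (Fin m)) n (Fin m → Fin n),
      ∀ v : Fin n → Finset (Fin m), HasShares k R V v → (∀ i ∈ V, 1 ≤ k (v i)) →
      t.Spec v (GivesShares k R V v) (ENNReal.ofReal (2500 * entropyBound m V.card +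
        (63 / 64) ^ f * (31 * counterBits m * V.card))) := by
  have hVm : ∀ V : Finset (Fin n), V.card ≤ m := fun V =>
    (Finset.card_le_univ V).trans (by simpa using hnm)
  have hm : 0 < m := (Fin.pos (Classical.arbitrary (Fin n))).trans_le hnm
  have hEP : ∀ (R : Finset (Fin m)) (V : Finset (Fin n)),
      ∃ t : RTree (Finset (Fin m)) n (Fin m → Fin n), ∀ v, HasShares k R V v →
        t.Spec v (GivesShares k R V v) (ENNReal.ofReal (31 * counterBits m * V.card)) := by
    intro R V
    obtain ⟨t, ht⟩ := exists_evenPaz k (lt_two_pow_counterBits m) V.card R V rfl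
    exact ⟨t, fun v hv => (ht v hv).mono (fun _ h => h)
      (ENNReal.ofReal_le_ofReal (evenPaz_cost_le (hVm V)))⟩
  induction f with
  | zero =>
    intro R V
    obtain ⟨t, ht⟩ := hEP R V
    refine ⟨t, fun v hv _ => (ht v hv).mono (fun _ h => h) (ENNReal.ofReal_le_ofReal ?_)⟩
    have := entropyBound_nonneg (hVm V)
    rw [pow_zero, one_mul]
    linarith
  | succ f ih =>
    intro R V
    set u := V.card with hu
    -- The halving procedure is already cheap enough.
    by_cases hsmall : (31 * counterBits m * u : ℝ) ≤ 2500 * entropyBound m u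
    · obtain ⟨t, ht⟩ := hEP R V
      refine ⟨t, fun v hv _ => (ht v hv).mono (fun _ h => h) (ENNReal.ofReal_le_ofReal ?_)⟩
      have : (0 : ℝ) ≤ (63 / 64) ^ (f + 1) * (31 * counterBits m * u) := by positivity
      linarith
    -- Impossible when all agents have shares, but some tree has to be given.
    by_cases hR : R.card < u
    · obtain ⟨t, ht⟩ := hEP R V
      refine ⟨t, fun v hv hk => absurd hR (not_lt.2 ?_)⟩
      obtain ⟨i, hi⟩ := Finset.card_pos.1 ((Nat.zero_le _).trans_lt hR)
      calc u ≤ u * k (v i) := Nat.le_mul_of_pos_right _ (hk i hi)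
        _ ≤ (v i ∩ R).card := hv i hi
        _ ≤ R.card := Finset.card_le_card Finset.inter_subset_right
    have hu0 : 0 < u := by
      by_contra h0
      rw [Nat.eq_zero_of_not_pos h0] at hsmall
      simp [entropyBound] at hsmall
    have hu' : (0 : ℝ) < u := by exact_mod_cast hu0
    have hRu : (u : ℝ) ≤ R.card := by exact_mod_cast not_lt.1 hR
    have hRm : (R.card : ℝ) ≤ m := by exact_mod_cast (Finset.card_le_univ R).trans (by simp)
    set B := counterBits m with hB
    have hB8 : 8 ≤ B := by rw [hB]; unfold counterBits; omega
    set L := R.card / u + 1 with hL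
    have hL1 : (R.card : ℝ) / u ≤ L := by
      rw [div_le_iff₀ hu', mul_comm]
      exact_mod_cast (Nat.lt_mul_div_succ R.card hu0).le
    have hL2 : (L : ℝ) ≤ 2 * (R.card / u) := by
      have h1 : ((R.card / u : ℕ) : ℝ) ≤ R.card / u := Nat.cast_div_le
      have h2 : 1 ≤ (R.card : ℝ) / u := by rwa [le_div_iff₀ hu', one_mul]
      rw [hL]
      push_cast
      linarith
    have hL0 : 0 < L := Nat.succ_pos _
    have hL3 : (L : ℝ) ≤ 2 * (m / u) := hL2.trans (by gcongr)
    set a := Real.logb 2 ((m : ℝ) / u) with ha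
    have hbig : (L ^ 2 * B ^ 2) ^ 24 ≤ u := by
      by_contra hcon
      have := counterBits_le_of_lt hu0 (hVm V) hL3 hL0 (not_le.1 hcon)
      refine hsmall ?_
      have h1 := mul_le_mul_of_nonneg_right this hu'.le
      unfold entropyBound
      linarith
    have hne : Nonempty {i // i ∈ V} := by
      obtain ⟨i, hi⟩ := Finset.card_pos.1 hu0
      exact ⟨⟨i, hi⟩⟩
    have hT : Tuned {e // e ∈ R} {i // i ∈ V} (L ^ 2 * B ^ 2) L := by
      have hr : itemRatio {e // e ∈ R} {i // i ∈ V} = R.card / u := by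
        rw [itemRatio, Fintype.card_coe, Fintype.card_coe]
      constructor
      · calc 64 ≤ 1 ^ 2 * 8 ^ 2 := by norm_num
          _ ≤ _ := Nat.mul_le_mul (Nat.pow_le_pow_left hL0 2) (Nat.pow_le_pow_left hB8 2)
      · calc L = L * 1 := (mul_one L).symm
          _ ≤ L * (L * B ^ 2) := Nat.mul_le_mul_left _ (Nat.mul_pos hL0 (by positivity))
          _ = _ := by ring
      · rw [hr]; exact hL1
      · rw [hr]; exact hL2
      · rw [hr, le_div_iff₀ hu', one_mul]; exact hRu
      · rw [Fintype.card_coe]; exact hbig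
    choose sol hsol using ih
    have hδ : (0 : ℝ) ≤ 2500 * (a + 8) + (63 / 64) ^ f * (31 * B) := by
      have ha0 : 0 ≤ a := Real.logb_nonneg (by norm_num) (by
        rw [le_div_iff₀ hu', one_mul]; exact hRu.trans hRm)
      positivity
    -- With `Z = L²B` and `g = L²B²`, the terms `BZ/g` for shortened windows and `BL²/Z` for long
    -- windows are both constant. The slope of the potential pays for the round through its entropy
    -- part, and the fraction `1/64` of served agents turns the halving cost `31B` per agent into
    -- `63/64` of it.
    obtain ⟨t, ht⟩ := exists_averaged_round k hT (Nat.le_pow_clog (b := 2) (by norm_num) L)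
      ((hVm V).trans (lt_two_pow_counterBits m).le) (show 0 < L ^ 2 * B by positivity) sol
      (fun x => 2500 * entropyBound m x + (63 / 64) ^ f * (31 * B * x))
      (fun x hx => by
        have := entropyBound_nonneg (hx.trans (hVm V))
        positivity) hδ (fun h hh => by
        have h1 := entropyBound_sub_le hm hh
        rw [Nat.cast_sub hh]
        linarith)
    refine ⟨t, fun v hv hk => (ht v hv hk fun R' V' hV' hs => hsol R' V' v hs fun i hi =>
      hk i (hV' hi)).mono (fun _ h => h) (ENNReal.ofReal_le_ofReal ?_)⟩
    rw [← hu, ← hB]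
    have hb : (Nat.clog 2 L : ℝ) ≤ a + 2 := by
      have h1 := clog_le_logb_add_one hL0
      have h4 : Real.logb 2 L ≤ a + 1 := by
        refine (Real.logb_le_logb_of_le (by norm_num) (by exact_mod_cast hL0) hL3).trans (le_of_eq ?_)
        have : (0 : ℝ) < m := by exact_mod_cast hm
        rw [Real.logb_mul (by norm_num) (by positivity), Real.logb_self_eq_one (by norm_num)]
        ring
      linarith
    have hB' : (8 : ℝ) ≤ B := by exact_mod_cast hB8
    have hL' : (0 : ℝ) < L := by exact_mod_cast hL0
    have e1 : ((B : ℝ) + 1) * (((L ^ 2 * B : ℕ) : ℝ) * (2 * u / ((L ^ 2 * B ^ 2 : ℕ) : ℝ)) +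
        u * (L : ℝ) ^ 2 / (4 * ((L ^ 2 * B : ℕ) : ℝ))) ≤ 5 * u := by
      push_cast
      rw [show ((B : ℝ) + 1) * ((L : ℝ) ^ 2 * B * (2 * u / ((L : ℝ) ^ 2 * (B : ℝ) ^ 2)) +
        u * (L : ℝ) ^ 2 / (4 * ((L : ℝ) ^ 2 * B))) = 9 / 4 * u * ((B + 1) / B) by field_simp; ring]
      have : ((B : ℝ) + 1) / B ≤ 9 / 8 := by
        rw [div_le_div_iff₀ (by linarith) (by norm_num)]; linarith
      calc 9 / 4 * u * (((B : ℝ) + 1) / B) ≤ 9 / 4 * u * (9 / 8) := by gcongr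
        _ ≤ _ := by linarith
    have e2 := mul_le_mul_of_nonneg_left hb hu'.le
    have ha0 : 0 ≤ a := Real.logb_nonneg (by norm_num) (by
      rw [le_div_iff₀ hu', one_mul]; exact hRu.trans hRm)
    have e3 : 0 ≤ (u : ℝ) * a := by positivity
    rw [pow_succ (63 / 64 : ℝ) f]
    linarith

/-- Every agent receives her share with few bits. -/
theorem exists_solver : ∃ C : ℝ, 0 < C ∧ ∀ n m : ℕ, 1 ≤ n → 2 * n ≤ m →
    ∃ t : RTree (Finset (Fin m)) n (Fin m → Fin n), ∀ v : Fin n → Finset (Fin m),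
      HasShares (fun T => T.card / n) Finset.univ Finset.univ v →
      t.Spec v (GivesShares (fun T => T.card / n) Finset.univ Finset.univ v)
        (ENNReal.ofReal (C * n * Real.logb 2 ((m : ℝ) / n))) := by
  -- The sum of `2500`, `2500 · 10` and one bit each for the initial question and the final halving,
  -- using `log₂(m/n) ≥ 1`.
  refine ⟨27502, by norm_num, fun n m hn hm => ?_⟩
  have : Nonempty (Fin n) := ⟨⟨0, hn⟩⟩
  have hn' : (0 : ℝ) < n := by exact_mod_cast hn
  have hB0 : (0 : ℝ) < 31 * counterBits m := by
    have : 0 < counterBits m := by unfold counterBits; omega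
    positivity
  -- After `f` rounds the halving procedure contributes at most one bit per agent.
  obtain ⟨f, hf⟩ := exists_pow_lt_of_lt_one (show 0 < 1 / (31 * counterBits m : ℝ) by positivity)
    (show (63 / 64 : ℝ) < 1 by norm_num)
  have hsol := exists_rounds (n := n) (m := m) (by omega) (fun T => T.card / n) f Finset.univ
  choose sol hsol using hsol
  -- Agents with share zero need nothing and are sorted out by one bit each, as windows require
  -- positive shares.
  obtain ⟨t, ht⟩ := RTree.exists_askAll (X := Finset (Fin m)) (Finset.univ : Finset (Fin n))
    fun _ T => 1 ≤ T.card / n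
  refine ⟨t.bind sol, fun v hv => ?_⟩
  have h1 : ∀ V : Finset (Fin n), 2500 * entropyBound m V.card +
      (63 / 64) ^ f * (31 * counterBits m * V.card) ≤ 2500 * entropyBound m n + n := by
    intro V
    have hVn : V.card ≤ n := by simpa using Finset.card_le_univ V
    have h2 := entropyBound_sub_le (m := m) (u := n) (h := n - V.card) (by omega) (Nat.sub_le _ _)
    rw [Nat.sub_sub_self hVn] at h2
    have h3 : 0 ≤ Real.logb 2 ((m : ℝ) / n) := Real.logb_nonneg (by norm_num) (by
      rw [le_div_iff₀ hn', one_mul]; exact_mod_cast (by omega : n ≤ m))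
    have h4 : 0 ≤ (Real.logb 2 ((m : ℝ) / n) + 8) * ((n - V.card : ℕ) : ℝ) := by positivity
    have h5 : (63 / 64) ^ f * (31 * counterBits m : ℝ) ≤ 1 := by
      rw [lt_div_iff₀ hB0] at hf; exact hf.le
    have h6 : (V.card : ℝ) ≤ n := by exact_mod_cast hVn
    have h7 : (63 / 64) ^ f * (31 * counterBits m : ℝ) * V.card ≤ 1 * n :=
      mul_le_mul h5 h6 (by positivity) (by norm_num)
    linarith
  refine ((ht v).bind (c' := ENNReal.ofReal (2500 * entropyBound m n + n)) fun V hV => ?_).mono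
    (fun _ h => h) ?_
  · subst hV
    set V := Finset.univ.filter fun i => 1 ≤ (v i).card / n
    refine (hsol V v (fun i _ => ?_) fun i hi => (Finset.mem_filter.1 hi).2).mono (fun A hA i _ => ?_)
      (ENNReal.ofReal_le_ofReal (h1 V))
    · refine le_trans (Nat.mul_le_mul_right _ (Finset.card_le_univ V)) (hv i (Finset.mem_univ i))
    · by_cases hi : i ∈ V
      · exact hA i hi
      · have : (v i).card / n = 0 := by
          by_contra h0
          exact hi (Finset.mem_filter.2 ⟨Finset.mem_univ _, Nat.pos_of_ne_zero h0⟩)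
        simp only
        rw [this]
        exact Nat.zero_le _
  · rw [Finset.card_univ, Fintype.card_fin, ← ENNReal.ofReal_natCast,
      ← ENNReal.ofReal_add hn'.le (by
        have := entropyBound_nonneg (show n ≤ m by omega); positivity)]
    refine ENNReal.ofReal_le_ofReal ?_
    have h3 : 1 ≤ Real.logb 2 ((m : ℝ) / n) := by
      rw [Real.le_logb_iff_rpow_le (by norm_num) (by
        have : 0 < m := by omega
        positivity), Real.rpow_one, le_div_iff₀ hn']
      exact_mod_cast hm
    unfold entropyBound
    have := mul_le_mul_of_nonneg_left h3 hn'.le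
    linarith

end

/-! ### Shares of binary valuations, and the theorem. -/

/-- The items that an agent with a binary valuation likes. -/
def likedItems {m : ℕ} (v : Valuation m) : Finset (Fin m) := Finset.univ.filter fun e => v {e} = 1

theorem IsBinary.apply {m : ℕ} {v : Valuation m} (hv : IsBinary v) (S : Finset (Fin m)) :
    v S = ((S.filter fun e => e ∈ likedItems v).card : ℝ≥0) := by
  rw [hv.1 S, Finset.card_filter, Nat.cast_sum]
  refine Finset.sum_congr rfl fun e _ => ?_
  rcases hv.2 e with h | h <;> simp [likedItems, h]

theorem IsBinary.mms_le {n m : ℕ} (hn : 1 ≤ n) {v : Valuation m} (hv : IsBinary v) :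
    mms n v ≤ (((likedItems v).card / n : ℕ) : ℝ≥0) := by
  have : Nonempty (Fin n) := ⟨⟨0, hn⟩⟩
  refine ciSup_le' fun P => ?_
  by_contra! hcon
  have h1 : ∀ i, (likedItems v).card / n + 1 ≤ (likedItems v ∩ bundle P i).card := by
    intro i
    have h2 := hcon.trans_le (ciInf_le (Set.finite_range fun i => v (bundle P i)).bddBelow i)
    rw [hv.apply, Finset.filter_mem_eq_inter, Finset.inter_comm] at h2
    exact_mod_cast h2
  have h2 : ∑ _i : Fin n, ((likedItems v).card / n + 1) ≤ (likedItems v).card := by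
    exact (Finset.sum_le_sum fun i _ => h1 i).trans (sum_card_inter_bundle P _).le
  rw [Finset.sum_const, Finset.card_univ, Fintype.card_fin, smul_eq_mul] at h2
  have := Nat.lt_mul_div_succ (likedItems v).card (show 0 < n by omega)
  omega

theorem binary_upper : ∃ C : ℝ, 0 < C ∧ ∀ n m : ℕ, 1 ≤ n → 2 * n ≤ m →
    arcc (binaryInstances n m) ≤ ENNReal.ofReal (C * Real.logb 2 ((m : ℝ) / n)) := by
  obtain ⟨C, hC, h⟩ := exists_solver
  refine ⟨C, hC, fun n m hn hm => ?_⟩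
  obtain ⟨t, ht⟩ := h n m hn hm
  have key : rcc (binaryInstances n m) ≤ ENNReal.ofReal (C * n * Real.logb 2 ((m : ℝ) / n)) := by
    refine rcc_le likedItems _ t _ ENNReal.ofReal_ne_top fun v hv => ?_
    refine (ht (fun i => likedItems (v i)) fun i _ => ?_).mono (fun A hA i => ?_) le_rfl
    · rw [Finset.inter_univ, Finset.card_univ, Fintype.card_fin]
      exact Nat.mul_div_le _ _
    · refine ((hv i).mms_le hn).trans ?_
      rw [(hv i).apply]
      have h1 := hA i (Finset.mem_univ i)
      rw [Finset.inter_univ] at h1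
      have h2 : ((bundle A i).filter fun e => e ∈ likedItems (v i)) =
          (likedItems (v i)).filter fun e => A e = i := by
        ext e; simp [bundle, and_comm]
      rw [h2]
      exact_mod_cast h1
  unfold arcc
  refine ENNReal.div_le_of_le_mul (key.trans (le_of_eq ?_))
  rw [mul_right_comm, ENNReal.ofReal_mul' (by positivity), ENNReal.ofReal_natCast]

end FairAllocation

end

theorem theorem1 :
    -- unit demand valuations: Θ(1), the lower bound even for identical valuations
    (∃ c₁ c₂ : ℝ, 0 < c₁ ∧ 0 < c₂ ∧ ∀ n m : ℕ, 1 ≤ n → 2 * n ≤ m →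
      FairAllocation.arcc (FairAllocation.unitDemandInstances n m) ≤ ENNReal.ofReal c₂ ∧
      (2 ≤ n →
        ENNReal.ofReal c₁ ≤ FairAllocation.arcc (FairAllocation.unitDemandInstances n m) ∧
        ENNReal.ofReal c₁ ≤ FairAllocation.arcc
          (FairAllocation.unitDemandInstances n m ∩ FairAllocation.identicalInstances n m))) ∧
    -- binary additive valuations: Θ(log (m / n)), the lower bound even for identical valuations
    (∃ c₁ c₂ : ℝ, 0 < c₁ ∧ 0 < c₂ ∧ ∀ n m : ℕ, 1 ≤ n → 2 * n ≤ m →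
      FairAllocation.arcc (FairAllocation.binaryInstances n m) ≤
        ENNReal.ofReal (c₂ * Real.logb 2 ((m : ℝ) / (n : ℝ))) ∧
      (2 ≤ n →
        ENNReal.ofReal (c₁ * Real.logb 2 ((m : ℝ) / (n : ℝ))) ≤
          FairAllocation.arcc (FairAllocation.binaryInstances n m) ∧
        ENNReal.ofReal (c₁ * Real.logb 2 ((m : ℝ) / (n : ℝ))) ≤ FairAllocation.arcc
          (FairAllocation.binaryInstances n m ∩ FairAllocation.identicalInstances n m))) ∧
    -- 2-valued additive valuations: Ω(m / n), even for identical valuations,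
    -- and even for any fixed values a > b > 0 with b ≤ a / m that are known to the protocol
    (∃ c₁ : ℝ, 0 < c₁ ∧ ∀ n m : ℕ, 2 ≤ n → 2 * n ≤ m →
      ENNReal.ofReal (c₁ * ((m : ℝ) / (n : ℝ))) ≤
        FairAllocation.arcc (FairAllocation.twoValuedInstances n m) ∧
      ENNReal.ofReal (c₁ * ((m : ℝ) / (n : ℝ))) ≤ FairAllocation.arcc
        (FairAllocation.twoValuedInstances n m ∩ FairAllocation.identicalInstances n m) ∧
      ∀ a b : NNReal, 0 < b → b ≤ a / (m : NNReal) →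
        ENNReal.ofReal (c₁ * ((m : ℝ) / (n : ℝ))) ≤ FairAllocation.arcc
          (FairAllocation.twoValuedInstancesWith a b n m ∩
            FairAllocation.identicalInstances n m)) := by
  open FairAllocation in
  refine ⟨⟨Real.log (3 / 2) / Real.log 2 / 4, 27, ?_, by norm_num, fun n m hn hm =>
      ⟨unitDemand_upper hn hm, fun hn2 => ⟨?_, unitDemand_lower hn2 hm⟩⟩⟩, ?_,
    ⟨1 / 8, by norm_num, fun n m hn hm => ⟨?_, ?_, fun a b hb hab => twoValued_lower hn hm hb hab⟩⟩⟩
  · have h1 := Real.log_pos (show (1 : ℝ) < 3 / 2 by norm_num)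
    have h2 := Real.log_pos one_lt_two
    positivity
  · exact (unitDemand_lower hn2 hm).trans (arcc_anti Set.inter_subset_left)
  · obtain ⟨C, hC, h⟩ := binary_upper
    exact ⟨1 / 16, C, by norm_num, hC, fun n m hn hm => ⟨h n m hn hm, fun hn2 =>
      ⟨(binary_lower hn2 hm).trans (arcc_anti Set.inter_subset_left), binary_lower hn2 hm⟩⟩⟩
  all_goals
    have hm0 : (0 : NNReal) < m := by exact_mod_cast (by omega : 0 < m)
    -- The values `m` and `1` satisfy `b ≤ a / m` with equality.
    have h1 := twoValued_lower hn hm (a := m) one_pos (by rw [div_self hm0.ne'])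
    refine h1.trans (arcc_anti ?_)
    rintro v ⟨h2, h3⟩
    have h4 : v ∈ twoValuedInstances n m :=
      ⟨m, 1, by exact_mod_cast (by omega : 1 < m), h2⟩
    first | exact h4 | exact ⟨h4, h3⟩
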